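/- **Setting.** An observation is $(W,Z,Y)$ with $W\in\mathbb R^{m_1}$, $Z\in\mathbb R^{m_2}$ and an outcome $Y$ in a standard Borel space (for instance $\{0,1\}$). Its law is $P_0$ (density $p_0$) in the source domain $D=0$ and $P_1$ (density $p_1$) in the target domain $D=1$; $E_d$ is the expectation under $P_d$, and $\ell(W,Z,Y)$ is a real measurable loss with $E_0[\ell^2]<\infty$. For $s\subseteq\{1,\dots,m_2\}$ write $Z=(Z_s,Z_{-s})$; the $s$-partial conditional covariate shift replaces $p_0(z\mid w)$ by $p_1(z_s\mid w)\,p_0(z_{-s}\mid z_s,w)$. Put $$\mu_{\cdot\cdot0}(w,z)=E_0[\ell\mid w,z],\quad \mu_{\cdot0_{-s}0}(w,z_s)=E_0[\ell\mid w,z_s],\quad \mu_{\cdot00}(w)=E_0[\ell\mid w],$$ $$\mu_{\cdot10}(w)=E_1[\mu_{\cdot\cdot0}(W,Z)\mid W=w],\quad \mu_{\cdot s0}(w)=E_1[\mu_{\cdot0_{-s}0}(W,Z_s)\mid W=w],$$ $$\pi_{1s0}(w,z_s)=\frac{p_1(w,z_s)}{p_0(w,z_s)},\quad \pi_{110}(w,z)=\frac{p_1(w,z)}{p_0(w,z)},$$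 and, with $\Delta_{\cdot s0}=\mu_{\cdot s0}-\mu_{\cdot00}$ and $\Delta_{\cdot10}=\mu_{\cdot10}-\mu_{\cdot00}$, $$v_Z^{num}(s)=E_1\big[(\Delta_{\cdot s0}(W)-\Delta_{\cdot10}(W))^2\big],\quad v_Z^{den}=E_1\big[\Delta_{\cdot10}(W)^2\big],\quad v_Z(s)=1-\frac{v_Z^{num}(s)}{v_Z^{den}}.$$ **Data and estimator.** Along a sequence of data sets, the evaluation data consist of $n_0$ IID observations from $P_0$ and $n_1$ IID observations from $P_1$, all mutually independent, with $n=n_0+n_1\to\infty$ and $n_1/n\to\rho\in(0,1)$. The nuisance estimates (marked with hats) are jointly measurable functions of the covariates and of training data that are independent of the evaluation data. With $P_{d,n}$ the average over the evaluation observations from domain $d$, $$\begin{aligned}\hat v_Z^{num}(s)={}&P_{1,n}(\hat\mu_{\cdot s0}-\hat\mu_{\cdot10})^2+2P_{0,n}(\hat\mu_{\cdot s0}-\hat\mu_{\cdot10})(\ell-\hat\mu_{\cdot0_{-s}0})\hat\pi_{1s0}-2P_{0,n}(\hat\mu_{\cdot s0}-\hat\mu_{\cdot10})(\ell-\hat\mu_{\cdot\cdot0})\hat\pi_{110}\\&+2P_{1,n}(\hat\mu_{\cdot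 s0}-\hat\mu_{\cdot10})(\hat\mu_{\cdot0_{-s}0}-\hat\mu_{\cdot s0})-2P_{1,n}(\hat\mu_{\cdot s0}-\hat\mu_{\cdot10})(\hat\mu_{\cdot\cdot0}-\hat\mu_{\cdot10}),\end{aligned}$$ and $\hat v_Z(s)=\hat v_Z^{num}(s)/\hat v_Z^{num}(\emptyset)$. **Theorem.** Fix $s$. Suppose $v_Z^{den}>0$ and: * (positivity) under $P_1$ the law of $(W,Z)$ is absolutely continuous with respect to that under $P_0$, and $\pi_{110}$ is bounded $P_0$-almost everywhere; * for $r=s$ and for $r=\emptyset$, the estimates $\hat\mu_{\cdot r0},\hat\mu_{\cdot10},\hat\pi_{1r0},\hat\pi_{110}$ are uniformly bounded by a constant; $\hat\mu_{\cdot0_{-r}0},\hat\mu_{\cdot\cdot0},\hat\pi_{1r0},\hat\pi_{110}$ are consistent in probability in $L^2(P_0)$; and $$E_0\big|(\mu_{\cdot0_{-r}0}-\hat\mu_{\cdot0_{-r}0})(\hat\pi_{1r0}-\pi_{1r0})\big|=o_p(n^{-1/2}),\qquad E_0\big|(\mu_{\cdot\cdot0}-\hat\mu_{\cdot\cdot0})(\hat\pi_{110}-\pi_{110})\big|=o_p(n^{-1/2}),$$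 $$E_1(\hat\mu_{\cdot r0}-\mu_{\cdot r0})^2=o_p(n^{-1/2}),\qquad E_1(\hat\mu_{\cdot10}-\mu_{\cdot10})^2=o_p(n^{-1/2}),$$ where the expectations integrate over a new observation with the estimates held fixed. Define, for $r=s$ and $r=\emptyset$, $$\begin{aligned}\psi^{num}_r(D,W,Z,Y)={}&\big\{(\mu_{\cdot r0}-\mu_{\cdot10})^2+2(\mu_{\cdot r0}-\mu_{\cdot10})(\mu_{\cdot0_{-r}0}-\mu_{\cdot r0})-2(\mu_{\cdot r0}-\mu_{\cdot10})(\mu_{\cdot\cdot0}-\mu_{\cdot10})\big\}\frac{1\{D=1\}}{\rho}\\&+\big\{2(\mu_{\cdot r0}-\mu_{\cdot10})(\ell-\mu_{\cdot0_{-r}0})\pi_{1r0}-2(\mu_{\cdot r0}-\mu_{\cdot10})(\ell-\mu_{\cdot\cdot0})\pi_{110}\big\}\frac{1\{D=0\}}{1-\rho}-v_Z^{num}(r),\end{aligned}$$ $$\psi_s=\frac{1}{v_Z^{den}}\psi_s^{num}-\frac{v_Z^{num}(s)}{(v_Z^{den})^2}\psi_\emptyset^{num}.$$ Let $(D,W,Z,Y)$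 have the law with $\Pr(D=1)=\rho$ and $(W,Z,Y)\mid D=d\sim P_d$. Then $\psi_s(D,W,Z,Y)$ is square-integrable with mean zero; the estimator is asymptotically linear, $$\hat v_Z(s)-\frac{v_Z^{num}(s)}{v_Z^{den}}=P_n\psi_s+o_p(n^{-1/2}),$$ where $P_n$ is the average over the pooled evaluation sample; and $$\sqrt n\Big(\hat v_Z(s)-\frac{v_Z^{num}(s)}{v_Z^{den}}\Big)\to_d N\big(0,\operatorname{var}(\psi_s)\big)$$ (with $N(0,0)$ the point mass at $0$). Likewise $\sqrt n\,\big((1-\hat v_Z(s))-v_Z(s)\big)\to_d N(0,\operatorname{var}(\psi_s))$. -/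

import Mathlib

open MeasureTheory ProbabilityTheory Filter Topology
open scoped ENNReal

noncomputable section

namespace CondCovShift

/-- One observation `(W, Z, Y)`: baseline variables `W ∈ ℝ^{m₁}`, conditional covariates
`Z ∈ ℝ^{m₂}` and an outcome `Y ∈ 𝒴`. -/
abbrev Obs (m₁ m₂ : ℕ) (𝒴 : Type*) : Type _ := (Fin m₁ → ℝ) × (Fin m₂ → ℝ) × 𝒴

section Basic

variable {m₁ m₂ : ℕ} {𝒴 : Type*}

/-- The variable `W` of an observation. -/
def getW (o : Obs m₁ m₂ 𝒴) : Fin m₁ → ℝ := o.1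

/-- The variables `(W, Z)` of an observation. -/
def getWZ (o : Obs m₁ m₂ 𝒴) : (Fin m₁ → ℝ) × (Fin m₂ → ℝ) := (o.1, o.2.1)

/-- The variables `(W, Z_s)` of an observation, for a subset `s` of the coordinates of `Z`. -/
def getWZs (s : Finset (Fin m₂)) (o : Obs m₁ m₂ 𝒴) : (Fin m₁ → ℝ) × (s → ℝ) :=
  (o.1, fun i => o.2.1 i)

end Basic

/-- `E_P[g | V = b]`, the integral of `g` against the regular conditional law under `P` given
`V = b`. -/
def condMean {α β : Type*} [MeasurableSpace α] [StandardBorelSpace α] [Nonempty α]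
    [MeasurableSpace β] (P : Measure α) [IsFiniteMeasure P] (V : α → β) (g : α → ℝ) (b : β) : ℝ :=
  ∫ a, g a ∂(condDistrib id V P b)

/-- The density ratio `p₁(v) / p₀(v)` of a variable `V`. -/
def densityRatio {α β : Type*} [MeasurableSpace α] [MeasurableSpace β]
    (P : Fin 2 → Measure α) (V : α → β) (b : β) : ℝ :=
  (((P 1).map V).rnDeriv ((P 0).map V) b).toReal

/-- A collection of nuisance parameters (outcome models and density ratio models):
`muPart s` is for `μ_{·s0}(w)`, `muTarget` for `μ_{·10}(w)`, `muSub s` for `μ_{·0_{-s}0}(w, z_s)`,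
`muFull` for `μ_{··0}(w, z)`, `piSub s` for `π_{1s0}(w, z_s)` and `piFull` for `π_{110}(w, z)`. -/
structure Nuisance (m₁ m₂ : ℕ) where
  muPart : Finset (Fin m₂) → (Fin m₁ → ℝ) → ℝ
  muTarget : (Fin m₁ → ℝ) → ℝ
  muSub : (s : Finset (Fin m₂)) → (Fin m₁ → ℝ) × (s → ℝ) → ℝ
  muFull : (Fin m₁ → ℝ) × (Fin m₂ → ℝ) → ℝ
  piSub : (s : Finset (Fin m₂)) → (Fin m₁ → ℝ) × (s → ℝ) → ℝ
  piFull : (Fin m₁ → ℝ) × (Fin m₂ → ℝ) → ℝ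

section OneStep

variable {m₁ m₂ : ℕ} {𝒴 : Type*}

/-- The part of the uncentred influence function of the numerator that is averaged over the
target domain:
`(μ_{·s0} - μ_{·10})² + 2 (μ_{·s0} - μ_{·10}) (μ_{·0_{-s}0} - μ_{·s0})
  - 2 (μ_{·s0} - μ_{·10}) (μ_{··0} - μ_{·10})`. -/
def targetTerm (η : Nuisance m₁ m₂) (s : Finset (Fin m₂)) (o : Obs m₁ m₂ 𝒴) : ℝ :=
  (η.muPart s (getW o) - η.muTarget (getW o)) ^ 2
    + 2 * (η.muPart s (getW o) - η.muTarget (getW o))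
        * (η.muSub s (getWZs s o) - η.muPart s (getW o))
    - 2 * (η.muPart s (getW o) - η.muTarget (getW o))
        * (η.muFull (getWZ o) - η.muTarget (getW o))

/-- The part of the uncentred influence function of the numerator that is averaged over the
source domain:
`2 (μ_{·s0} - μ_{·10}) (ℓ - μ_{·0_{-s}0}) π_{1s0} - 2 (μ_{·s0} - μ_{·10}) (ℓ - μ_{··0}) π_{110}`. -/
def sourceTerm (ℓ : Obs m₁ m₂ 𝒴 → ℝ) (η : Nuisance m₁ m₂) (s : Finset (Fin m₂))
    (o : Obs m₁ m₂ 𝒴) : ℝ :=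
  2 * (η.muPart s (getW o) - η.muTarget (getW o))
      * (ℓ o - η.muSub s (getWZs s o)) * η.piSub s (getWZs s o)
    - 2 * (η.muPart s (getW o) - η.muTarget (getW o))
      * (ℓ o - η.muFull (getWZ o)) * η.piFull (getWZ o)

/-- The sample average of `g`. -/
def empMean {α : Type*} {n : ℕ} (x : Fin n → α) (g : α → ℝ) : ℝ := (∑ i, g (x i)) / (n : ℝ)

/-- The one-step estimator `v̂_Z^num(s)` with nuisance parameters `η`, computed on an evaluation
sample with `n d` observations `x d` from domain `d` (`0` source, `1` target). -/
def numHat (ℓ : Obs m₁ m₂ 𝒴 → ℝ) (η : Nuisance m₁ m₂) (s : Finset (Fin m₂)) {n : Fin 2 → ℕ}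
    (x : (d : Fin 2) → Fin (n d) → Obs m₁ m₂ 𝒴) : ℝ :=
  empMean (x 1) (targetTerm η s) + empMean (x 0) (sourceTerm ℓ η s)

/-- The ratio estimator `v̂_Z^num(s) / v̂_Z^num(∅)`. -/
def ratioHat (ℓ : Obs m₁ m₂ 𝒴 → ℝ) (η : Nuisance m₁ m₂) (s : Finset (Fin m₂)) {n : Fin 2 → ℕ}
    (x : (d : Fin 2) → Fin (n d) → Obs m₁ m₂ 𝒴) : ℝ :=
  numHat ℓ η s x / numHat ℓ η ∅ x

end OneStep

section Population

variable {m₁ m₂ : ℕ} {𝒴 : Type*} [MeasurableSpace 𝒴] [StandardBorelSpace 𝒴] [Nonempty 𝒴]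

/-- The true nuisance parameters for source law `P 0`, target law `P 1` and loss `ℓ`:
`μ_{··0}(w, z) = E₀[ℓ | w, z]`, `μ_{·0_{-s}0}(w, z_s) = E₀[ℓ | w, z_s]`,
`μ_{·10}(w) = ∫ μ_{··0}(w, z) p₁(z | w) dz`,
`μ_{·s0}(w) = ∫ μ_{·0_{-s}0}(w, z_s) p₁(z_s | w) dz_s`, and the two density ratios. -/
def trueNuisance (P : Fin 2 → Measure (Obs m₁ m₂ 𝒴)) [∀ d, IsProbabilityMeasure (P d)]
    (ℓ : Obs m₁ m₂ 𝒴 → ℝ) : Nuisance m₁ m₂ where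
  muPart s := condMean (P 1) getW fun o => condMean (P 0) (getWZs s) ℓ (getWZs s o)
  muTarget := condMean (P 1) getW fun o => condMean (P 0) getWZ ℓ (getWZ o)
  muSub s := condMean (P 0) (getWZs s) ℓ
  muFull := condMean (P 0) getWZ ℓ
  piSub s := densityRatio P (getWZs s)
  piFull := densityRatio P getWZ

/-- `Δ_{·s0}(w) = E_{·s0}[ℓ | w] - E_{·00}[ℓ | w]`. -/
def gapPart (P : Fin 2 → Measure (Obs m₁ m₂ 𝒴)) [∀ d, IsProbabilityMeasure (P d)]
    (ℓ : Obs m₁ m₂ 𝒴 → ℝ) (s : Finset (Fin m₂)) (w : Fin m₁ → ℝ) : ℝ :=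
  (trueNuisance P ℓ).muPart s w - condMean (P 0) getW ℓ w

/-- `Δ_{·10}(w) = E_{·10}[ℓ | w] - E_{·00}[ℓ | w]`. -/
def gapFull (P : Fin 2 → Measure (Obs m₁ m₂ 𝒴)) [∀ d, IsProbabilityMeasure (P d)]
    (ℓ : Obs m₁ m₂ 𝒴 → ℝ) (w : Fin m₁ → ℝ) : ℝ :=
  (trueNuisance P ℓ).muTarget w - condMean (P 0) getW ℓ w

/-- `v_Z^num(s) = E₁[(Δ_{·s0}(W) - Δ_{·10}(W))²]`. -/
def vNum (P : Fin 2 → Measure (Obs m₁ m₂ 𝒴)) [∀ d, IsProbabilityMeasure (P d)]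
    (ℓ : Obs m₁ m₂ 𝒴 → ℝ) (s : Finset (Fin m₂)) : ℝ :=
  ∫ o, (gapPart P ℓ s (getW o) - gapFull P ℓ (getW o)) ^ 2 ∂(P 1)

/-- `v_Z^den = E₁[Δ_{·10}(W)²]`. -/
def vDen (P : Fin 2 → Measure (Obs m₁ m₂ 𝒴)) [∀ d, IsProbabilityMeasure (P d)]
    (ℓ : Obs m₁ m₂ 𝒴 → ℝ) : ℝ :=
  ∫ o, gapFull P ℓ (getW o) ^ 2 ∂(P 1)

/-- The value `v_Z(s) = 1 - v_Z^num(s) / v_Z^den` of the `s`-partial conditional covariate shift. -/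
def value (P : Fin 2 → Measure (Obs m₁ m₂ 𝒴)) [∀ d, IsProbabilityMeasure (P d)]
    (ℓ : Obs m₁ m₂ 𝒴 → ℝ) (s : Finset (Fin m₂)) : ℝ :=
  1 - vNum P ℓ s / vDen P ℓ

/-- The influence function `ψ_{Z,s}^num(d, w, z, y)` of the numerator, where
`ρ = Pr(D = 1)`. -/
def psiNum (P : Fin 2 → Measure (Obs m₁ m₂ 𝒴)) [∀ d, IsProbabilityMeasure (P d)]
    (ℓ : Obs m₁ m₂ 𝒴 → ℝ) (ρ : ℝ) (s : Finset (Fin m₂)) (q : Fin 2 × Obs m₁ m₂ 𝒴) : ℝ :=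
  targetTerm (trueNuisance P ℓ) s q.2 * (if q.1 = 1 then 1 else 0) / ρ
    + sourceTerm ℓ (trueNuisance P ℓ) s q.2 * (if q.1 = 0 then 1 else 0) / (1 - ρ)
    - vNum P ℓ s

/-- The influence function of the ratio, given by the delta method:
`ψ_{Z,s} = ψ_{Z,s}^num / v_Z^den - (v_Z^num(s) / (v_Z^den)²) ψ_{Z,∅}^num`. -/
def psi (P : Fin 2 → Measure (Obs m₁ m₂ 𝒴)) [∀ d, IsProbabilityMeasure (P d)]
    (ℓ : Obs m₁ m₂ 𝒴 → ℝ) (ρ : ℝ) (s : Finset (Fin m₂)) (q : Fin 2 × Obs m₁ m₂ 𝒴) : ℝ :=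
  1 / vDen P ℓ * psiNum P ℓ ρ s q - vNum P ℓ s / vDen P ℓ ^ 2 * psiNum P ℓ ρ ∅ q

end Population

section Sampling

variable {m₁ m₂ : ℕ} {𝒴 : Type*}

/-- The law of `(D, W, Z, Y)` when `Pr(D = 1) = ρ` and `(W, Z, Y)` has law `P d` given `D = d`. -/
def jointLaw [MeasurableSpace 𝒴] (P : Fin 2 → Measure (Obs m₁ m₂ 𝒴)) (ρ : ℝ) :
    Measure (Fin 2 × Obs m₁ m₂ 𝒴) :=
  ENNReal.ofReal (1 - ρ) • (P 0).map (fun o => ((0 : Fin 2), o))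
    + ENNReal.ofReal ρ • (P 1).map (fun o => ((1 : Fin 2), o))

/-- The average of `g(D, W, Z, Y)` over the pooled evaluation sample of both domains. -/
def pooledMean {n : Fin 2 → ℕ} (x : (d : Fin 2) → Fin (n d) → Obs m₁ m₂ 𝒴)
    (g : Fin 2 × Obs m₁ m₂ 𝒴 → ℝ) : ℝ :=
  (∑ d, ∑ i, g (d, x d i)) / ((n 0 + n 1 : ℕ) : ℝ)

/-- `R_k = o_p(a_k)` for nonnegative random quantities `R_k`, possibly on different probability
spaces: `Pr(R_k > ε a_k) → 0` for every `ε > 0`. -/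
def IsLittleOP {Ω : ℕ → Type*} [∀ k, MeasurableSpace (Ω k)] (μ : (k : ℕ) → Measure (Ω k))
    (R : (k : ℕ) → Ω k → ℝ≥0∞) (a : ℕ → ℝ) : Prop :=
  ∀ ε : ℝ, 0 < ε → Tendsto (fun k => μ k {ω | ENNReal.ofReal (ε * a k) < R k ω}) atTop (𝓝 0)

/-- The estimated nuisance functions needed for the subset `s` are jointly measurable in the
training data and the covariates, and those of `μ_{·s0}`, `μ_{·10}`, `π_{1s0}`, `π_{110}` are
uniformly bounded. -/
structure Regular {𝒯 : ℕ → Type*} [∀ k, MeasurableSpace (𝒯 k)] (s : Finset (Fin m₂))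
    (ηhat : (k : ℕ) → 𝒯 k → Nuisance m₁ m₂) : Prop where
  meas_muPart : ∀ k, Measurable fun p : 𝒯 k × (Fin m₁ → ℝ) => (ηhat k p.1).muPart s p.2
  meas_muTarget : ∀ k, Measurable fun p : 𝒯 k × (Fin m₁ → ℝ) => (ηhat k p.1).muTarget p.2
  meas_muSub : ∀ k,
    Measurable fun p : 𝒯 k × ((Fin m₁ → ℝ) × (s → ℝ)) => (ηhat k p.1).muSub s p.2
  meas_muFull : ∀ k,
    Measurable fun p : 𝒯 k × ((Fin m₁ → ℝ) × (Fin m₂ → ℝ)) => (ηhat k p.1).muFull p.2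
  meas_piSub : ∀ k,
    Measurable fun p : 𝒯 k × ((Fin m₁ → ℝ) × (s → ℝ)) => (ηhat k p.1).piSub s p.2
  meas_piFull : ∀ k,
    Measurable fun p : 𝒯 k × ((Fin m₁ → ℝ) × (Fin m₂ → ℝ)) => (ηhat k p.1).piFull p.2
  bdd : ∃ C : ℝ, ∀ k t, (∀ w, |(ηhat k t).muPart s w| ≤ C) ∧ (∀ w, |(ηhat k t).muTarget w| ≤ C) ∧
    (∀ v, |(ηhat k t).piSub s v| ≤ C) ∧ (∀ v, |(ηhat k t).piFull v| ≤ C)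

variable [MeasurableSpace 𝒴] [StandardBorelSpace 𝒴] [Nonempty 𝒴]

/-- Convergence of the estimated nuisance functions for the subset `s`; `N k` is the size of the
`k`-th sample and `ηhat k ω` the estimate computed from the realization `ω`. -/
structure NuisanceRates {Ω : ℕ → Type*} [∀ k, MeasurableSpace (Ω k)]
    (μ : (k : ℕ) → Measure (Ω k)) (P : Fin 2 → Measure (Obs m₁ m₂ 𝒴))
    [∀ d, IsProbabilityMeasure (P d)] (ℓ : Obs m₁ m₂ 𝒴 → ℝ) (s : Finset (Fin m₂))
    (N : ℕ → ℕ) (ηhat : (k : ℕ) → Ω k → Nuisance m₁ m₂) : Prop where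
  /-- `P₀ |(μ_{·0_{-s}0} - μ̂_{·0_{-s}0}) (π̂_{1s0} - π_{1s0})| = o_p(n^{-1/2})` -/
  prod_sub : IsLittleOP μ (fun k ω => ∫⁻ o,
      ‖((trueNuisance P ℓ).muSub s (getWZs s o) - (ηhat k ω).muSub s (getWZs s o))
        * ((ηhat k ω).piSub s (getWZs s o) - (trueNuisance P ℓ).piSub s (getWZs s o))‖ₑ ∂(P 0))
    (fun k => (N k : ℝ) ^ (-(1 / 2) : ℝ))
  /-- `P₀ |(μ_{··0} - μ̂_{··0}) (π̂_{110} - π_{110})| = o_p(n^{-1/2})` -/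
  prod_full : IsLittleOP μ (fun k ω => ∫⁻ o,
      ‖((trueNuisance P ℓ).muFull (getWZ o) - (ηhat k ω).muFull (getWZ o))
        * ((ηhat k ω).piFull (getWZ o) - (trueNuisance P ℓ).piFull (getWZ o))‖ₑ ∂(P 0))
    (fun k => (N k : ℝ) ^ (-(1 / 2) : ℝ))
  /-- `P₁ (μ̂_{·s0} - μ_{·s0})² = o_p(n^{-1/2})` -/
  rate_part : IsLittleOP μ (fun k ω => ∫⁻ o,
      ‖(ηhat k ω).muPart s (getW o) - (trueNuisance P ℓ).muPart s (getW o)‖ₑ ^ 2 ∂(P 1))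
    (fun k => (N k : ℝ) ^ (-(1 / 2) : ℝ))
  /-- `P₁ (μ̂_{·10} - μ_{·10})² = o_p(n^{-1/2})` -/
  rate_target : IsLittleOP μ (fun k ω => ∫⁻ o,
      ‖(ηhat k ω).muTarget (getW o) - (trueNuisance P ℓ).muTarget (getW o)‖ₑ ^ 2 ∂(P 1))
    (fun k => (N k : ℝ) ^ (-(1 / 2) : ℝ))
  /-- `μ̂_{·0_{-s}0}` is consistent. -/
  cons_muSub : IsLittleOP μ (fun k ω => ∫⁻ o,
      ‖(ηhat k ω).muSub s (getWZs s o) - (trueNuisance P ℓ).muSub s (getWZs s o)‖ₑ ^ 2 ∂(P 0))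
    (fun _ => 1)
  /-- `μ̂_{··0}` is consistent. -/
  cons_muFull : IsLittleOP μ (fun k ω => ∫⁻ o,
      ‖(ηhat k ω).muFull (getWZ o) - (trueNuisance P ℓ).muFull (getWZ o)‖ₑ ^ 2 ∂(P 0))
    (fun _ => 1)
  /-- `π̂_{1s0}` is consistent. -/
  cons_piSub : IsLittleOP μ (fun k ω => ∫⁻ o,
      ‖(ηhat k ω).piSub s (getWZs s o) - (trueNuisance P ℓ).piSub s (getWZs s o)‖ₑ ^ 2 ∂(P 0))
    (fun _ => 1)
  /-- `π̂_{110}` is consistent. -/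
  cons_piFull : IsLittleOP μ (fun k ω => ∫⁻ o,
      ‖(ηhat k ω).piFull (getWZ o) - (trueNuisance P ℓ).piFull (getWZ o)‖ₑ ^ 2 ∂(P 0))
    (fun _ => 1)

end Sampling

end CondCovShift

end

open CondCovShift

/-! Write `d = μ_{·r0} - μ_{·10}` for the contrast, a function of `W`, with estimate `d̂`. For `V =
(W, Z_r)` or `V = (W, Z)` let `M` estimate `m = E₀[ℓ | V]` and `R` estimate the density ratio `p` of
`V`; the arm of `V` is the target average of `d̂ M` plus the source average of `d̂ (ℓ - M) R`. The
one-step numerator is minus the target average of `d̂²`, plus twice the arm of `(W, Z_r)`, minus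
twice the arm of `(W, Z)` (`targetTerm_eq`, `sourceTerm_eq`).

Bias. With the estimates held fixed, an arm has mean `E₁[d̂ m] + E₀[d̂ (m - M)(R - p)]`, because `ℓ
- m` has conditional mean zero given `V` and weighting by `p` turns source means into target means
(`enorm_arm_bias_le`). In `E₁[d̂ m]` the function `m` may be replaced by `E₁[m | W]`, so the arms
together contribute `2 E₁[d̂ d]`. Since `-d̂² + 2 d̂ d = d² - (d̂ - d)²`, the bias is `-E₁(d̂ - d)²`
plus products of nuisance errors, hence `o_p(n^{-1/2})` by assumption (`enorm_numerator_bias_le`).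

Fluctuation. Given the training data, the centred average of estimated minus true summands has
variance at most their mean square difference over `n_d`. That difference tends to zero in
probability (`isLittleOP_target_arm`, `isLittleOP_source_arm`), so Chebyshev's inequality gives
`o_p(n^{-1/2})` with no complexity condition on the estimates (`IsLittleOP.empMean_sub_integral`).
Hence each numerator agrees with its average at the true nuisance parameters up to `o_p(n^{-1/2})`
(`numHat_sub_oracle`).

Ratio. As `v_Z^num(∅) = v_Z^den` (`vNum_empty`), the delta method applies. Its remainder is a
product of two errors, for which rates `o_p(n^{-1/4})` suffice (`abs_ratio_sub_linear_le`). The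
centring constants cancel in `ψ_s`, so `ψ_s` has mean zero within each domain; replacing `n_d / n`
by its limit is then free to first order, and the limit variance of the two samples is the variance
of `ψ_s` under the mixture law. Normality follows from characteristic functions
(`tendstoInDistribution_two_samples`) and Slutsky's lemma. -/

namespace CondCovShift

/-! ### Calculus of `o_p` on varying probability spaces. -/

namespace IsLittleOP

variable {Ω : ℕ → Type*} [∀ k, MeasurableSpace (Ω k)] {μ : (k : ℕ) → Measure (Ω k)}
  {R R' Q : (k : ℕ) → Ω k → ℝ≥0∞} {a b c : ℕ → ℝ}

lemma mono (h : IsLittleOP μ R' a) (hle : ∀ᶠ k in atTop, ∀ ω, R k ω ≤ R' k ω) :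
    IsLittleOP μ R a := by
  intro ε hε
  refine tendsto_of_tendsto_of_tendsto_of_le_of_le' tendsto_const_nhds (h ε hε)
    (Eventually.of_forall fun _ => zero_le) ?_
  filter_upwards [hle] with k hk
  exact measure_mono fun ω hω => lt_of_lt_of_le hω (hk ω)

/-- The rules below reduce to an inclusion of events followed by the union bound. A rule with a
single hypothesis passes it twice. -/
lemma of_subset_union (h : ∀ ε > 0, ∃ ε₁ > 0, ∃ ε₂ > 0, ∀ᶠ k in atTop, ∀ ω,
      ENNReal.ofReal (ε * a k) < R k ω →
        ENNReal.ofReal (ε₁ * b k) < R' k ω ∨ ENNReal.ofReal (ε₂ * c k) < Q k ω)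
    (h₁ : IsLittleOP μ R' b) (h₂ : IsLittleOP μ Q c) : IsLittleOP μ R a := by
  intro ε hε
  obtain ⟨ε₁, hε₁, ε₂, hε₂, h⟩ := h ε hε
  have hsum := (h₁ ε₁ hε₁).add (h₂ ε₂ hε₂)
  rw [add_zero] at hsum
  refine tendsto_of_tendsto_of_tendsto_of_le_of_le' tendsto_const_nhds hsum
    (Eventually.of_forall fun _ => zero_le) ?_
  filter_upwards [h] with k hk
  exact (measure_mono fun ω hω => hk ω hω).trans (measure_union_le _ _)

lemma add (h : IsLittleOP μ R a) (h' : IsLittleOP μ R' a) :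
    IsLittleOP μ (fun k ω => R k ω + R' k ω) a := by
  refine of_subset_union (fun ε hε => ⟨ε / 2, half_pos hε, ε / 2, half_pos hε,
    Eventually.of_forall fun k ω hω => ?_⟩) h h'
  by_contra! hc
  refine hω.not_ge ((add_le_add hc.1 hc.2).trans ?_)
  rw [← two_mul, show ε * a k = 2 * (ε / 2 * a k) by ring,
    ENNReal.ofReal_mul (p := 2) (by norm_num), ENNReal.ofReal_ofNat]

lemma const_mul (h : IsLittleOP μ R a) {c : ℝ} (hc : 0 ≤ c) :
    IsLittleOP μ (fun k ω => ENNReal.ofReal c * R k ω) a := by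
  -- Dividing by `c + 1` instead of `c` includes the case `c = 0`.
  refine of_subset_union (fun ε hε => ⟨ε / (c + 1), by positivity, 1, one_pos,
    Eventually.of_forall fun k ω hω => Or.inl ?_⟩) h h
  by_contra! hR
  refine hω.not_ge ((mul_le_mul_right hR _).trans ?_)
  rcases le_or_gt 0 (a k) with ha | ha
  · rw [← ENNReal.ofReal_mul hc]
    apply ENNReal.ofReal_le_ofReal
    have : c * (ε / (c + 1) * a k) = (c / (c + 1)) * (ε * a k) := by ring
    rw [this]
    exact mul_le_of_le_one_left (by positivity) ((div_le_one (by positivity)).2 (by linarith))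
  · rw [ENNReal.ofReal_of_nonpos (mul_nonpos_of_nonneg_of_nonpos (by positivity) ha.le)]
    simp

/-- A bound that holds where a consistent quantity is at most one is enough. -/
lemma mono_of_le_one (h : IsLittleOP μ R' a) (hQ : IsLittleOP μ Q fun _ => 1)
    (hle : ∀ᶠ k in atTop, ∀ ω, Q k ω ≤ 1 → R k ω ≤ R' k ω) : IsLittleOP μ R a := by
  refine of_subset_union (fun ε hε => ⟨ε, hε, 1, one_pos, ?_⟩) h hQ
  filter_upwards [hle] with k hk ω hω
  by_contra! hc
  exact hω.not_ge ((hk ω (by simpa using hc.2)).trans hc.1)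

lemma rate_mono (h : IsLittleOP μ R a) (hab : ∀ᶠ k in atTop, a k ≤ b k) :
    IsLittleOP μ R b := by
  refine of_subset_union (fun ε hε => ⟨ε, hε, 1, one_pos, ?_⟩) h h
  filter_upwards [hab] with k hk ω hω
  exact Or.inl (lt_of_le_of_lt (ENNReal.ofReal_le_ofReal (by gcongr)) hω)

lemma mul (h : IsLittleOP μ R a) (h' : IsLittleOP μ R' b) (ha : ∀ k, 0 ≤ a k) :
    IsLittleOP μ (fun k ω => R k ω * R' k ω) (fun k => a k * b k) := by
  refine of_subset_union (fun ε hε => ⟨ε, hε, 1, one_pos,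
    Eventually.of_forall fun k ω hω => ?_⟩) h h'
  by_contra! hc
  refine hω.not_ge ((mul_le_mul' hc.1 hc.2).trans ?_)
  rw [← ENNReal.ofReal_mul (mul_nonneg hε.le (ha k))]
  apply ENNReal.ofReal_le_ofReal
  linarith

/-- A deterministic sequence of smaller order. -/
lemma of_tendsto {r : ℕ → ℝ} (hr : ∀ ε > 0, ∀ᶠ k in atTop, r k ≤ ε * a k) :
    IsLittleOP μ (fun k _ => ENNReal.ofReal (r k)) a := by
  intro ε hε
  refine tendsto_const_nhds.congr' ?_
  filter_upwards [hr ε hε] with k hk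
  have : {ω : Ω k | ENNReal.ofReal (ε * a k) < ENNReal.ofReal (r k)} = ∅ := by
    ext ω
    simpa using ENNReal.ofReal_le_ofReal hk
  rw [this, measure_empty]

lemma add_real {f g : (k : ℕ) → Ω k → ℝ} (hf : IsLittleOP μ (fun k ω => ‖f k ω‖ₑ) a)
    (hg : IsLittleOP μ (fun k ω => ‖g k ω‖ₑ) a) :
    IsLittleOP μ (fun k ω => ‖f k ω + g k ω‖ₑ) a :=
  (hf.add hg).mono (Eventually.of_forall fun _ _ => enorm_add_le _ _)

lemma const_mul_real {f : (k : ℕ) → Ω k → ℝ} (hf : IsLittleOP μ (fun k ω => ‖f k ω‖ₑ) a)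
    (c : ℝ) : IsLittleOP μ (fun k ω => ‖c * f k ω‖ₑ) a :=
  (hf.const_mul (abs_nonneg c)).mono (Eventually.of_forall fun _ _ => by
    rw [enorm_mul, Real.enorm_eq_ofReal_abs c])

lemma sub_real {f g : (k : ℕ) → Ω k → ℝ} (hf : IsLittleOP μ (fun k ω => ‖f k ω‖ₑ) a)
    (hg : IsLittleOP μ (fun k ω => ‖g k ω‖ₑ) a) :
    IsLittleOP μ (fun k ω => ‖f k ω - g k ω‖ₑ) a :=
  (hf.add hg).mono (Eventually.of_forall fun _ _ => enorm_sub_le)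

/-- Consistency survives multiplication by a fixed square-integrable function if the errors are
uniformly bounded. -/
lemma lintegral_mul_of_bounded {α : Type*} [MeasurableSpace α] {ν : Measure α}
    {D : (k : ℕ) → Ω k → α → ℝ≥0∞} {h : α → ℝ≥0∞} (hh : Measurable h)
    (hh_int : ∫⁻ x, h x ∂ν ≠ ∞) {C : ℝ} (hC : ∀ k ω, ∀ᵐ x ∂ν, D k ω x ≤ ENNReal.ofReal C)
    (hD : ∀ k ω, AEMeasurable (D k ω) ν)
    (hcons : IsLittleOP μ (fun k ω => ∫⁻ x, D k ω x ∂ν) fun _ => 1) :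
    IsLittleOP μ (fun k ω => ∫⁻ x, D k ω x * h x ∂ν) fun _ => 1 := by
  -- Markov's inequality makes `{h > m}` small in measure, and the integral of the integrable `h`
  -- over small sets is small.
  have htail : Tendsto (fun m : ℕ => ∫⁻ x in {x | (m : ℝ≥0∞) < h x}, h x ∂ν) atTop (𝓝 0) := by
    have hlim := tendsto_setLIntegral_zero (μ := ν) (f := h) hh_int
      (s := fun m : ℕ => {x | (m : ℝ≥0∞) < h x}) (l := atTop) ?_
    · exact hlim
    · have hmarkov : ∀ m : ℕ, ν {x | ((m : ℝ≥0∞) + 1) < h x} ≤ (∫⁻ x, h x ∂ν) / ((m : ℝ≥0∞) + 1) :=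
        fun m => (measure_mono (Set.ofPred_subset_ofPred.2 fun x hx => hx.le)).trans
          (meas_ge_le_lintegral_div hh.aemeasurable (ε := (m : ℝ≥0∞) + 1) (by simp)
            (by finiteness))
      rw [← tendsto_add_atTop_iff_nat 1]
      refine tendsto_of_tendsto_of_tendsto_of_le_of_le tendsto_const_nhds ?_
        (fun _ => zero_le) (fun m => by simpa using hmarkov m)
      have := ENNReal.Tendsto.const_div (a := ∫⁻ x, h x ∂ν)
        ((tendsto_add_atTop_iff_nat 1).2 ENNReal.tendsto_nat_nhds_top) (Or.inr hh_int)
      simpa using this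
  refine of_subset_union (fun ε hε => ?_) hcons hcons
  have hC1 : (0 : ℝ) < |C| + 1 := by positivity
  -- `m` truncates `h`. On `{h > m}` the uniform bound on `D` and the small tail cost at most `ε /
  -- 2`; elsewhere `h ≤ m`, and the consistency of `D` at level `ε / 2 / (m + 1)` costs the other
  -- half.
  obtain ⟨m, hm⟩ := ((ENNReal.tendsto_nhds_zero.1 htail) (ENNReal.ofReal (ε / 2 / (|C| + 1)))
    (by simp only [ENNReal.ofReal_pos]; positivity)).exists
  refine ⟨ε / 2 / (m + 1), by positivity, 1, one_pos, Eventually.of_forall fun k ω hω => Or.inl ?_⟩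
  by_contra! hR
  refine hω.not_ge ?_
  set S : Set α := {x | (m : ℝ≥0∞) < h x} with hS
  have hSm : MeasurableSet S := measurableSet_lt measurable_const hh
  have hbound : ∫⁻ x, D k ω x * h x ∂ν
      ≤ ∫⁻ x, (m + 1 : ℝ≥0∞) * D k ω x + ENNReal.ofReal (|C| + 1) * S.indicator h x ∂ν := by
    refine lintegral_mono_ae ?_
    filter_upwards [hC k ω] with x hx
    by_cases hxS : x ∈ S
    · rw [Set.indicator_of_mem hxS]
      refine le_trans ?_ le_add_self
      gcongr
      exact hx.trans (ENNReal.ofReal_le_ofReal (by linarith [le_abs_self C]))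
    · refine le_trans ?_ le_self_add
      rw [mul_comm]
      gcongr
      have : h x ≤ m := not_lt.1 hxS
      exact this.trans le_self_add
  refine hbound.trans ?_
  rw [lintegral_add_left' ((hD k ω).const_mul _), lintegral_const_mul'' _ (hD k ω),
    lintegral_const_mul _ (hh.indicator hSm), lintegral_indicator hSm]
  have h1 : (m + 1 : ℝ≥0∞) * ∫⁻ x, D k ω x ∂ν ≤ ENNReal.ofReal (ε / 2) := by
    refine (mul_le_mul_right hR _).trans ?_
    rw [show (m + 1 : ℝ≥0∞) = ENNReal.ofReal (m + 1) by
      rw [ENNReal.ofReal_add (by positivity) (by positivity)]; simp,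
      ← ENNReal.ofReal_mul (by positivity)]
    apply le_of_eq
    congr 1
    field_simp
  have h2 : ENNReal.ofReal (|C| + 1) * ∫⁻ x in S, h x ∂ν ≤ ENNReal.ofReal (ε / 2) := by
    refine (mul_le_mul_right hm _).trans ?_
    rw [← ENNReal.ofReal_mul (by positivity)]
    apply le_of_eq
    congr 1
    field_simp
  refine (add_le_add h1 h2).trans ?_
  rw [← ENNReal.ofReal_add (by positivity) (by positivity)]
  simp

end IsLittleOP

/-! ### Chebyshev bounds for sample averages, also given training data. -/

section Chebyshev

variable {Ω α τ : Type*} [MeasurableSpace Ω] [MeasurableSpace α] [MeasurableSpace τ]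
  {μ : Measure Ω} [IsProbabilityMeasure μ] {P : Measure α} [IsProbabilityMeasure P]

/-- Chebyshev's inequality for the average of a function over an IID sample. -/
lemma measure_lt_abs_empMean_sub_le {n : ℕ} (hn : 0 < n) {X : Fin n → Ω → α}
    (hlaw : ∀ i, HasLaw (X i) P μ) (hindep : iIndepFun X μ) {g : α → ℝ} (hg : Measurable g)
    {c : ℝ} (hc : 0 < c) :
    μ {ω | c < |empMean (fun i => X i ω) g - ∫ x, g x ∂P|}
      ≤ (∫⁻ x, ‖g x‖ₑ ^ 2 ∂P) / ENNReal.ofReal (n * c ^ 2) := by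
  -- An infinite second moment makes the bound trivial, so `g` may be taken square-integrable.
  by_cases htop : ∫⁻ x, ‖g x‖ₑ ^ 2 ∂P = ∞
  · rw [htop, ENNReal.top_div_of_ne_top (by finiteness)]
    exact le_top
  have hmem : MemLp g 2 P := by
    refine ⟨hg.aestronglyMeasurable, ?_⟩
    rw [eLpNorm_lt_top_iff_lintegral_rpow_enorm_lt_top (by simp) (by simp)]
    simpa [lt_top_iff_ne_top] using htop
  have hmemX : ∀ i, MemLp (fun ω => g (X i ω)) 2 μ := fun i => by
    refine MemLp.comp_of_map (f := X i) ?_ (hlaw i).aemeasurable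
    rwa [(hlaw i).map_eq]
  have hint : ∀ i, ∫ ω, g (X i ω) ∂μ = ∫ x, g x ∂P := fun i =>
    (hlaw i).integral_comp hg.aestronglyMeasurable
  have hn' : (0 : ℝ) < n := by exact_mod_cast hn
  have hmean : ∫ ω, ∑ i, g (X i ω) ∂μ = n * ∫ x, g x ∂P := by
    rw [integral_finsetSum _ fun i _ => (hmemX i).integrable one_le_two]
    simp [hint]
  have hvar : Var[fun ω => ∑ i, g (X i ω); μ] = n * Var[g; P] := by
    have := IndepFun.variance_sum (s := Finset.univ) (X := fun i ω => g (X i ω)) (μ := μ)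
      (fun i _ => hmemX i) (fun i _ j _ hij => (hindep.indepFun hij).comp hg hg)
    rw [show (∑ i, fun ω => g (X i ω)) = fun ω => ∑ i, g (X i ω) by ext; simp] at this
    rw [this]
    have hv : ∀ i, Var[fun ω => g (X i ω); μ] = Var[g; P] := fun i => by
      rw [← (hlaw i).map_eq, variance_map hg.aemeasurable (hlaw i).aemeasurable]
      rfl
    simp [hv]
  have hcheb := meas_ge_le_variance_div_sq (memLp_finsetSum Finset.univ fun i _ => hmemX i)
    (μ := μ) (mul_pos hn' hc)
  rw [hmean, hvar] at hcheb
  refine (measure_mono fun ω hω => ?_).trans (hcheb.trans ?_)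
  · simp only [Set.mem_ofPred_eq, empMean] at hω ⊢
    have : ∑ i, g (X i ω) - n * ∫ x, g x ∂P
        = n * ((∑ i, g (X i ω)) / n - ∫ x, g x ∂P) := by field_simp
    rw [this, abs_mul, abs_of_pos hn']
    gcongr
  · rw [show (n : ℝ) * Var[g; P] / (n * c) ^ 2 = Var[g; P] / (n * c ^ 2) by field_simp,
      ENNReal.ofReal_div_of_pos (by positivity)]
    gcongr
    refine (ENNReal.ofReal_le_ofReal (variance_le_expectation_sq hg.aestronglyMeasurable)).trans ?_
    have hsq : Integrable (g ^ 2) P := hmem.integrable_sq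
    rw [ofReal_integral_eq_lintegral_ofReal hsq (ae_of_all _ fun x => sq_nonneg (g x))]
    refine lintegral_mono fun x => le_of_eq ?_
    rw [Real.enorm_eq_ofReal_abs, ← ENNReal.ofReal_pow (abs_nonneg _), sq_abs]
    rfl

/-- The conditional Chebyshev inequality for a function estimated from independent training
data. -/
lemma measure_lt_abs_empMean_sub_le_of_indepFun {n : ℕ} (hn : 0 < n) {X : Fin n → Ω → α}
    (hlaw : ∀ i, HasLaw (X i) P μ) (hindep : iIndepFun X μ) {T : Ω → τ} (hT : Measurable T)
    (hsplit : IndepFun T (fun ω i => X i ω) μ) {g : τ → α → ℝ}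
    (hg : Measurable fun p : τ × α => g p.1 p.2) {c : ℝ} (hc : 0 < c) {q : ℝ≥0∞} :
    μ {ω | c < |empMean (fun i => X i ω) (g (T ω)) - ∫ x, g (T ω) x ∂P|}
      ≤ q / ENNReal.ofReal (n * c ^ 2) + μ {ω | q < ∫⁻ x, ‖g (T ω) x‖ₑ ^ 2 ∂P} := by
  have hX : AEMeasurable (fun ω i => X i ω) μ := aemeasurable_pi_lambda _ fun i => (hlaw i).aemeasurable
  set S : Set (τ × (Fin n → α)) := {p | c < |empMean p.2 (g p.1) - ∫ x, g p.1 x ∂P|} with hS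
  have hSm : MeasurableSet S := by
    have h1 : Measurable fun p : τ × (Fin n → α) => empMean p.2 (g p.1) := by
      unfold empMean
      refine (Finset.measurable_sum _ fun i _ => ?_).div_const _
      exact hg.comp (measurable_fst.prodMk ((measurable_pi_apply i).comp measurable_snd))
    have h2 : Measurable fun t : τ => ∫ x, g t x ∂P :=
      (hg.stronglyMeasurable.integral_prod_right (f := fun t x => g t x)).measurable
    exact measurableSet_lt measurable_const (h1.sub (h2.comp measurable_fst)).abs
  have hQm : Measurable fun t : τ => ∫⁻ x, ‖g t x‖ₑ ^ 2 ∂P :=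
    Measurable.lintegral_prod_right' (f := fun p : τ × α => ‖g p.1 p.2‖ₑ ^ 2) (by fun_prop)
  -- Independence makes the joint law of training data and sample a product, so the event is sliced
  -- at fixed training data `t`. Where the second moment of `g t` is at most `q` the unconditional
  -- bound applies; elsewhere the slice is bounded by one.
  have hmap : μ {ω | c < |empMean (fun i => X i ω) (g (T ω)) - ∫ x, g (T ω) x ∂P|}
      = ((μ.map T).prod (μ.map fun ω i => X i ω)) S := by
    rw [← (indepFun_iff_map_prod_eq_prod_map_map hT.aemeasurable hX).1 hsplit,
      Measure.map_apply_of_aemeasurable (hT.aemeasurable.prodMk hX) hSm]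
    rfl
  have hsec : ∀ t, (μ.map fun ω i => X i ω) (Prod.mk t ⁻¹' S)
      ≤ q / ENNReal.ofReal (n * c ^ 2) + {t | q < ∫⁻ x, ‖g t x‖ₑ ^ 2 ∂P}.indicator 1 t := by
    intro t
    rw [Measure.map_apply_of_aemeasurable hX (measurable_prodMk_left hSm)]
    by_cases ht : q < ∫⁻ x, ‖g t x‖ₑ ^ 2 ∂P
    · refine prob_le_one.trans ?_
      rw [Set.indicator_of_mem (by exact ht)]
      exact le_add_self
    · refine le_trans ?_ le_self_add
      refine (measure_lt_abs_empMean_sub_le hn hlaw hindep (g := g t)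
        (hg.comp measurable_prodMk_left) hc).trans ?_
      gcongr
      exact not_lt.1 ht
  have hBm : MeasurableSet {t | q < ∫⁻ x, ‖g t x‖ₑ ^ 2 ∂P} := measurableSet_lt measurable_const hQm
  have : IsProbabilityMeasure (μ.map T) := Measure.isProbabilityMeasure_map hT.aemeasurable
  have : IsProbabilityMeasure (μ.map fun ω i => X i ω) := Measure.isProbabilityMeasure_map hX
  rw [hmap, Measure.prod_apply hSm]
  refine (lintegral_mono hsec).trans ?_
  rw [lintegral_add_left measurable_const, lintegral_const, measure_univ, mul_one,
    lintegral_indicator_one hBm, Measure.map_apply hT hBm]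
  rfl

end Chebyshev

/-! ### Sample splitting. -/

section SampleSplitting

variable {Ω : ℕ → Type*} [∀ k, MeasurableSpace (Ω k)] {μ : (k : ℕ) → Measure (Ω k)}
  [∀ k, IsProbabilityMeasure (μ k)] {α : Type*} [MeasurableSpace α] {P : Measure α}
  [IsProbabilityMeasure P] {𝒯 : ℕ → Type*} [∀ k, MeasurableSpace (𝒯 k)]

/-- Sample splitting: an empirical process over functions estimated from independent training
data is negligible if the second moments of the functions are. -/
lemma IsLittleOP.empMean_sub_integral {T : (k : ℕ) → Ω k → 𝒯 k} (hT : ∀ k, Measurable (T k))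
    {n N : ℕ → ℕ} {X : (k : ℕ) → Fin (n k) → Ω k → α} (hlaw : ∀ k i, HasLaw (X k i) P (μ k))
    (hindep : ∀ k, iIndepFun (X k) (μ k))
    (hsplit : ∀ k, IndepFun (T k) (fun ω i => X k i ω) (μ k))
    {r : ℝ} (hr : 0 < r) (hN : Tendsto N atTop atTop)
    (hfrac : Tendsto (fun k => (n k : ℝ) / (N k : ℝ)) atTop (𝓝 r))
    {g : (k : ℕ) → 𝒯 k → α → ℝ} (hg : ∀ k, Measurable fun p : 𝒯 k × α => g k p.1 p.2)
    {c : ℕ → ℝ} (hc : ∀ᶠ k in atTop, 0 < c k)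
    (hcons : IsLittleOP μ (fun k ω => ∫⁻ x, ‖g k (T k ω) x‖ₑ ^ 2 ∂P) fun k => c k ^ 2) :
    IsLittleOP μ
      (fun k ω => ‖empMean (fun i => X k i ω) (g k (T k ω)) - ∫ x, g k (T k ω) x ∂P‖ₑ)
      (fun k => c k * (N k : ℝ) ^ (-(1 / 2) : ℝ)) := by
  intro ε hε
  rw [ENNReal.tendsto_nhds_zero]
  intro δ hδ
  obtain ⟨δ', hδ'0, hδ'⟩ : ∃ δ' : ℝ, 0 < δ' ∧ ENNReal.ofReal δ' ≤ δ / 2 := by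
    rcases eq_or_ne δ ∞ with rfl | hδt
    · exact ⟨1, one_pos, by simp [ENNReal.top_div]⟩
    · refine ⟨(δ / 2).toReal, ENNReal.toReal_pos (by simpa using hδ.ne') (by finiteness), ?_⟩
      rw [ENNReal.ofReal_toReal (by finiteness)]
  -- The level for the second moment: since `n_k / N_k > r / 2` eventually, dividing `δ' (r / 2) ε²
  -- c_k²` by `n_k ε² c_k² / N_k` leaves at most `δ'`.
  have hη : 0 < δ' * (r / 2 * ε ^ 2) := by positivity
  filter_upwards [hc, hN.eventually_gt_atTop 0, hfrac.eventually (lt_mem_nhds (half_lt_self hr)),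
    (ENNReal.tendsto_nhds_zero.1 (hcons _ hη)) (δ / 2) (by simpa using hδ.ne')]
    with k hck hNk hfk hbad
  have hNk' : (0 : ℝ) < N k := by exact_mod_cast hNk
  have hnk : 0 < n k := by
    rcases Nat.eq_zero_or_pos (n k) with h | h
    · rw [h] at hfk
      simp at hfk
      linarith
    · exact h
  have hnk' : (0 : ℝ) < n k := by exact_mod_cast hnk
  have hpow : 0 < (N k : ℝ) ^ (-(1 / 2) : ℝ) := Real.rpow_pos_of_pos hNk' _
  have hpow2 : ((N k : ℝ) ^ (-(1 / 2) : ℝ)) ^ 2 = (N k : ℝ)⁻¹ := by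
    rw [← Real.rpow_natCast, ← Real.rpow_mul hNk'.le]
    norm_num
    exact Real.rpow_neg_one _
  have hset : {ω | ENNReal.ofReal (ε * (c k * (N k : ℝ) ^ (-(1 / 2) : ℝ)))
        < ‖empMean (fun i => X k i ω) (g k (T k ω)) - ∫ x, g k (T k ω) x ∂P‖ₑ}
      ⊆ {ω | ε * (c k * (N k : ℝ) ^ (-(1 / 2) : ℝ))
        < |empMean (fun i => X k i ω) (g k (T k ω)) - ∫ x, g k (T k ω) x ∂P|} := by
    intro ω hω
    rw [Set.mem_ofPred_eq, Real.enorm_eq_ofReal_abs] at hω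
    exact (ENNReal.ofReal_lt_ofReal_iff'.1 hω).1
  refine (measure_mono hset).trans ((measure_lt_abs_empMean_sub_le_of_indepFun hnk (hlaw k)
    (hindep k) (hT k) (hsplit k) (hg k) (by positivity)
    (q := ENNReal.ofReal (δ' * (r / 2 * ε ^ 2) * c k ^ 2))).trans ?_)
  refine (add_le_add ?_ hbad).trans (ENNReal.add_halves δ).le
  refine le_trans ?_ hδ'
  rw [← ENNReal.ofReal_div_of_pos (by positivity)]
  apply ENNReal.ofReal_le_ofReal
  rw [div_le_iff₀ (by positivity), mul_pow, mul_pow, hpow2]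
  have : δ' * ((n k : ℝ) * (ε ^ 2 * (c k ^ 2 * (N k : ℝ)⁻¹)))
      = δ' * (n k / N k * ε ^ 2) * c k ^ 2 := by
    field_simp
  rw [this]
  gcongr

end SampleSplitting

lemma enorm_sq_eq_ofReal (x : ℝ) : ‖x‖ₑ ^ 2 = ENNReal.ofReal (x ^ 2) := by
  rw [Real.enorm_eq_ofReal_abs, ← ENNReal.ofReal_pow (abs_nonneg _), sq_abs]

lemma memLp_two_iff_lintegral_enorm_sq {α : Type*} [MeasurableSpace α] {ν : Measure α} {f : α → ℝ}
    (hf : AEStronglyMeasurable f ν) : MemLp f 2 ν ↔ ∫⁻ x, ‖f x‖ₑ ^ 2 ∂ν < ∞ := by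
  rw [MemLp, and_iff_right hf, eLpNorm_lt_top_iff_lintegral_rpow_enorm_lt_top (by simp) (by simp)]
  simp

lemma memLp_two_bdd_mul {α : Type*} [MeasurableSpace α] {ν : Measure α} [IsFiniteMeasure ν]
    {f g : α → ℝ} {B : ℝ} (hf : Measurable f) (hB : ∀ a, |f a| ≤ B) (hg : MemLp g 2 ν) :
    MemLp (fun a => f a * g a) 2 ν :=
  hg.mul (MemLp.of_bound (p := ∞) hf.aestronglyMeasurable B (ae_of_all _ hB))

/-! ### Conditional means through regular conditional laws. -/

section CondMean

variable {α β γ : Type*} [MeasurableSpace α] [StandardBorelSpace α] [Nonempty α]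
  [MeasurableSpace β] [MeasurableSpace γ] {P : Measure α} [IsProbabilityMeasure P]
  {V : α → β} {g : α → ℝ}

lemma measurable_condMean (hg : Measurable g) : Measurable (condMean P V g) :=
  (StronglyMeasurable.integral_condDistrib (Y := id) (X := V) (μ := P) (f := fun p : β × α => g p.2)
    (hg.comp measurable_snd).stronglyMeasurable).measurable

/-- The bridge from the kernel integral to conditional expectation, through which pull-out, the
tower property and `L²` contraction become available. -/
lemma condMean_comp_ae_eq (hV : Measurable V) (hg : Integrable g P) :
    P[g | MeasurableSpace.comap V inferInstance] =ᵐ[P] fun a => condMean P V g (V a) :=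
  condExp_ae_eq_integral_condDistrib_id hV hg

lemma memLp_condMean_comp (hV : Measurable V) (hg : MemLp g 2 P) :
    MemLp (fun a => condMean P V g (V a)) 2 P :=
  (hg.condExp one_le_two).ae_eq (condMean_comp_ae_eq hV (hg.integrable one_le_two))

lemma integral_mul_condMean_comp (hV : Measurable V) (hg : Integrable g P) {f : β → ℝ}
    (hf : Measurable f) (hfg : Integrable (fun a => f (V a) * g a) P) :
    ∫ a, f (V a) * condMean P V g (V a) ∂P = ∫ a, f (V a) * g a ∂P := by
  rw [← integral_condExp hV.comap_le (f := fun a => f (V a) * g a)]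
  refine integral_congr_ae ?_
  have hfm : StronglyMeasurable[MeasurableSpace.comap V inferInstance] (fun a => f (V a)) :=
    (hf.comp (comap_measurable V)).stronglyMeasurable
  filter_upwards [condMean_comp_ae_eq hV hg,
    condExp_mul_of_stronglyMeasurable_left hfm hfg hg] with a h1 h2
  rw [← h1]
  exact h2.symm

/-- Conditioning on more variables that carry the same information changes nothing. -/
lemma condMean_comp_ae_eq_of_leftInverse (hV : Measurable V) (hg : Integrable g P) {q : β → γ}
    {r : γ → β} (hq : Measurable q) (hr : Measurable r) (hrq : ∀ a, r (q (V a)) = V a) :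
    (fun a => condMean P V g (V a)) =ᵐ[P] fun a => condMean P (fun a => q (V a)) g (q (V a)) := by
  -- As `r` recovers `V` from `q ∘ V`, both generate the same σ-algebra.
  have hcomap : MeasurableSpace.comap V inferInstance
      = MeasurableSpace.comap (fun a => q (V a)) inferInstance := by
    refine le_antisymm ?_ ?_
    · have : V = fun a => r (q (V a)) := funext fun a => (hrq a).symm
      conv_lhs => rw [this]
      exact (hr.comp (comap_measurable fun a => q (V a))).comap_le
    · exact (hq.comp (comap_measurable V)).comap_le
  have h1 := condMean_comp_ae_eq hV hg
  rw [hcomap] at h1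
  exact h1.symm.trans (condMean_comp_ae_eq (hq.comp hV) hg)

lemma condMean_comp_self_ae_eq (hV : Measurable V) {f : β → ℝ} (hf : Measurable f)
    (hfV : Integrable (fun a => f (V a)) P) :
    (fun a => condMean P V (fun a => f (V a)) (V a)) =ᵐ[P] fun a => f (V a) := by
  refine (condMean_comp_ae_eq hV hfV).symm.trans ?_
  exact (condExp_of_stronglyMeasurable hV.comap_le
    (hf.comp (comap_measurable V)).stronglyMeasurable hfV).eventuallyEq

end CondMean

/-! ### Domination of the target law and importance weighting. -/

section Domination

variable {α β γ : Type*} [MeasurableSpace α] [MeasurableSpace β] [MeasurableSpace γ]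
  {P : Fin 2 → Measure α} {V : α → β} {C : ℝ}

/-- The law of `V` in the target domain is dominated by a multiple of its law in the source
domain. -/
def IsDominated (P : Fin 2 → Measure α) (V : α → β) (C : ℝ) : Prop :=
  (P 1).map V ≤ ENNReal.ofReal C • (P 0).map V

lemma measurable_densityRatio : Measurable (densityRatio P V) :=
  (Measure.measurable_rnDeriv _ _).ennreal_toReal

lemma densityRatio_nonneg (b : β) : 0 ≤ densityRatio P V b := ENNReal.toReal_nonneg

lemma measurable_densityRatio_comp (hV : Measurable V) :
    Measurable fun a => densityRatio P V (V a) := measurable_densityRatio.comp hV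

/-- The reason for phrasing positivity as an inequality of laws: it pushes forward to every coarser
variable, in particular from `(W, Z)` to `(W, Z_s)`. -/
lemma IsDominated.comp (h : IsDominated P V C) (hV : Measurable V) {q : β → γ}
    (hq : Measurable q) : IsDominated P (fun a => q (V a)) C := by
  unfold IsDominated at h ⊢
  have := Measure.map_mono (f := q) h hq
  rw [Measure.map_smul, Measure.map_map hq hV, Measure.map_map hq hV] at this
  exact this

lemma IsDominated.absolutelyContinuous (h : IsDominated P V C) : (P 1).map V ≪ (P 0).map V :=
  Measure.absolutelyContinuous_of_le_smul h

lemma IsDominated.lintegral_le (h : IsDominated P V C) (hV : Measurable V) {f : β → ℝ≥0∞}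
    (hf : Measurable f) : ∫⁻ a, f (V a) ∂(P 1) ≤ ENNReal.ofReal C * ∫⁻ a, f (V a) ∂(P 0) := by
  rw [← lintegral_map hf hV, ← lintegral_map hf hV]
  refine (lintegral_mono' h le_rfl).trans ?_
  rw [lintegral_smul_measure, smul_eq_mul]

lemma IsDominated.ae_of_ae (h : IsDominated P V C) (hV : Measurable V) {p : β → Prop}
    (hp : MeasurableSet {b | p b}) (hP : ∀ᵐ a ∂(P 0), p (V a)) : ∀ᵐ a ∂(P 1), p (V a) := by
  rw [← ae_map_iff hV.aemeasurable hp] at hP ⊢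
  exact h.absolutelyContinuous.ae_le hP

lemma IsDominated.memLp (h : IsDominated P V C) (hV : Measurable V) {f : β → ℝ}
    (hf : Measurable f) (hf2 : MemLp (fun a => f (V a)) 2 (P 0)) :
    MemLp (fun a => f (V a)) 2 (P 1) := by
  have hfV : Measurable fun a => f (V a) := hf.comp hV
  rw [memLp_two_iff_lintegral_enorm_sq hfV.aestronglyMeasurable] at hf2 ⊢
  exact (h.lintegral_le hV (f := fun b => ‖f b‖ₑ ^ 2) (by fun_prop)).trans_lt
    (ENNReal.mul_lt_top (by simp) hf2)

/-- The source law reweighted by the density ratio of `V`. -/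
noncomputable def reweighted (P : Fin 2 → Measure α) (V : α → β) : Measure α :=
  (P 0).withDensity fun a => ENNReal.ofReal (densityRatio P V (V a))

lemma lintegral_mul_densityRatio (hV : Measurable V) {f : α → ℝ≥0∞} (hf : Measurable f) :
    ∫⁻ a, f a ∂(reweighted P V) = ∫⁻ a, ENNReal.ofReal (densityRatio P V (V a)) * f a ∂(P 0) :=
  lintegral_withDensity_eq_lintegral_mul _ (measurable_densityRatio_comp hV).ennreal_ofReal hf

variable [∀ d, IsProbabilityMeasure (P d)]

lemma isDominated_of_densityRatio_le (hac : (P 1).map V ≪ (P 0).map V)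
    (hC : ∀ᵐ v ∂((P 0).map V), densityRatio P V v ≤ C) : IsDominated P V C := by
  rw [IsDominated, ← Measure.withDensity_rnDeriv_eq _ _ hac, ← withDensity_const]
  refine withDensity_mono ?_
  -- `toReal` would hide an infinite density, so almost sure finiteness is needed to return to
  -- `ℝ≥0∞`.
  filter_upwards [hC, Measure.rnDeriv_lt_top ((P 1).map V) ((P 0).map V)] with v hv hlt
  exact (ENNReal.le_ofReal_iff_toReal_le hlt.ne (ENNReal.toReal_nonneg.trans hv)).2 hv

/-- The density integrates over each set to its target mass, which is at most `C` times its source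
mass; comparing over all sets bounds the density itself. -/
lemma IsDominated.densityRatio_le (h : IsDominated P V C) (hC : 0 ≤ C) (hV : Measurable V) :
    ∀ᵐ a ∂(P 0), densityRatio P V (V a) ≤ C := by
  have : ∀ᵐ v ∂((P 0).map V), ((P 1).map V).rnDeriv ((P 0).map V) v ≤ ENNReal.ofReal C := by
    have : IsProbabilityMeasure ((P 0).map V) := Measure.isProbabilityMeasure_map hV.aemeasurable
    refine ae_le_of_forall_setLIntegral_le_of_sigmaFinite (Measure.measurable_rnDeriv _ _)
      fun s hs _ => ?_
    rw [Measure.setLIntegral_rnDeriv h.absolutelyContinuous]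
    simpa using h s
  filter_upwards [ae_of_ae_map hV.aemeasurable this] with a ha
  exact ENNReal.toReal_le_of_le_ofReal hC ha

/-- On events determined by `V` the reweighted source law is the target law. Target statements about
functions of `V` can therefore be used inside source integrals that also involve `ℓ`. -/
lemma map_reweighted (hac : (P 1).map V ≪ (P 0).map V) (hV : Measurable V) :
    (reweighted P V).map V = (P 1).map V := by
  have : IsProbabilityMeasure ((P 0).map V) := Measure.isProbabilityMeasure_map hV.aemeasurable
  have : IsProbabilityMeasure ((P 1).map V) := Measure.isProbabilityMeasure_map hV.aemeasurable
  rw [← Measure.withDensity_rnDeriv_eq _ _ hac]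
  ext s hs
  rw [Measure.map_apply hV hs, reweighted, withDensity_apply _ (hV hs), withDensity_apply _ hs,
    setLIntegral_map hs (Measure.measurable_rnDeriv _ _) hV]
  refine setLIntegral_congr_fun_ae (hV hs) ?_
  filter_upwards [ae_of_ae_map hV.aemeasurable
    (Measure.rnDeriv_lt_top ((P 1).map V) ((P 0).map V))] with a ha _
  exact ENNReal.ofReal_toReal ha.ne

lemma lintegral_reweighted (hac : (P 1).map V ≪ (P 0).map V) (hV : Measurable V) {f : β → ℝ≥0∞}
    (hf : Measurable f) : ∫⁻ a, f (V a) ∂(reweighted P V) = ∫⁻ a, f (V a) ∂(P 1) := by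
  rw [← lintegral_map hf hV, map_reweighted hac hV, lintegral_map hf hV]

lemma ae_reweighted_iff (hac : (P 1).map V ≪ (P 0).map V) (hV : Measurable V) {p : β → Prop}
    (hp : MeasurableSet {b | p b}) : (∀ᵐ a ∂(reweighted P V), p (V a)) ↔ ∀ᵐ a ∂(P 1), p (V a) := by
  rw [← ae_map_iff hV.aemeasurable hp, map_reweighted hac hV, ae_map_iff hV.aemeasurable hp]

lemma reweighted_le (h : IsDominated P V C) (hC : 0 ≤ C) (hV : Measurable V) :
    reweighted P V ≤ ENNReal.ofReal C • P 0 := by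
  rw [reweighted, ← withDensity_const]
  refine withDensity_mono ?_
  filter_upwards [h.densityRatio_le hC hV] with a ha
  exact ENNReal.ofReal_le_ofReal ha

/-- Importance weighting: the density ratio turns source means into target means. -/
lemma integral_mul_densityRatio (hac : (P 1).map V ≪ (P 0).map V) (hV : Measurable V)
    {f : β → ℝ} (hf : Measurable f) :
    ∫ a, f (V a) * densityRatio P V (V a) ∂(P 0) = ∫ a, f (V a) ∂(P 1) := by
  rw [← integral_map hV.aemeasurable hf.aestronglyMeasurable, ← map_reweighted hac hV,
    integral_map hV.aemeasurable hf.aestronglyMeasurable, reweighted,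
    integral_withDensity_eq_integral_toReal_smul
      (measurable_densityRatio_comp hV).ennreal_ofReal (by simp)]
  refine integral_congr_ae (ae_of_all _ fun a => ?_)
  simp only [smul_eq_mul]
  rw [ENNReal.toReal_ofReal (densityRatio_nonneg _), mul_comm]

/-- A property that holds almost surely in the target domain holds in the source domain wherever
the density ratio is positive. -/
lemma ae_densityRatio_ne_zero (hac : (P 1).map V ≪ (P 0).map V) (hV : Measurable V) {p : β → Prop}
    (hp : MeasurableSet {b | p b}) (h : ∀ᵐ a ∂(P 1), p (V a)) :
    ∀ᵐ a ∂(P 0), densityRatio P V (V a) ≠ 0 → p (V a) := by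
  rw [← ae_reweighted_iff hac hV hp, reweighted,
    ae_withDensity_iff (measurable_densityRatio_comp hV).ennreal_ofReal] at h
  filter_upwards [h] with a ha h0
  refine ha ?_
  rw [ne_eq, ENNReal.ofReal_eq_zero, not_le]
  exact lt_of_le_of_ne (densityRatio_nonneg _) h0.symm

end Domination

lemma sq_le_sq_of_abs_le {x b : ℝ} (h : |x| ≤ b) : x ^ 2 ≤ b ^ 2 :=
  sq_le_sq' (abs_le.1 h).1 (abs_le.1 h).2

lemma abs_sub_le_add_of_abs_le {x y a b : ℝ} (hx : |x| ≤ a) (hy : |y| ≤ b) : |x - y| ≤ a + b :=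
  (abs_sub _ _).trans (add_le_add hx hy)

/-! ### Mean square consistency of the summands. -/

section Consistency

variable {Ω : ℕ → Type*} [∀ k, MeasurableSpace (Ω k)] {μ : (k : ℕ) → Measure (Ω k)}
  {α β γ : Type*} [MeasurableSpace α] [MeasurableSpace β] [MeasurableSpace γ]

/-- An `L²` limit in probability of functions that are bounded by `B` is bounded by `B`. -/
lemma IsLittleOP.ae_abs_le [∀ k, IsProbabilityMeasure (μ k)] {ν : Measure α}
    {F : (k : ℕ) → Ω k → α → ℝ} {f : α → ℝ} (hf : Measurable f) {B : ℝ}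
    (hF : ∀ k ω a, |F k ω a| ≤ B)
    (h : IsLittleOP μ (fun k ω => ∫⁻ a, ‖F k ω a - f a‖ₑ ^ 2 ∂ν) fun _ => 1) :
    ∀ᵐ a ∂ν, |f a| ≤ B := by
  -- The squared excess of `|f|` over `B`; `ofReal` takes the positive part. It bounds the squared
  -- error from below for every `k` and `ω`, and a positive constant is not `o_p(1)`.
  set I : ℝ≥0∞ := ∫⁻ a, ENNReal.ofReal (|f a| - B) ^ 2 ∂ν with hI
  have hle : ∀ k ω, I ≤ ∫⁻ a, ‖F k ω a - f a‖ₑ ^ 2 ∂ν := fun k ω => by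
    refine lintegral_mono fun a => ?_
    rw [Real.enorm_eq_ofReal_abs]
    gcongr
    have h1 := abs_sub_abs_le_abs_sub (f a) (F k ω a)
    rw [abs_sub_comm] at h1
    linarith [hF k ω a]
  have hI0 : I = 0 := by
    by_contra hne
    obtain ⟨ε, hε0, hε⟩ : ∃ ε : ℝ, 0 < ε ∧ ENNReal.ofReal ε < I := by
      obtain ⟨r, hr0, hr⟩ := ENNReal.lt_iff_exists_nnreal_btwn.1 (pos_iff_ne_zero.2 hne)
      exact ⟨r, by simpa using hr0, by simpa using hr⟩
    have hlim := h ε hε0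
    have huniv : ∀ k, μ k {ω | ENNReal.ofReal (ε * 1) < ∫⁻ a, ‖F k ω a - f a‖ₑ ^ 2 ∂ν} = 1 := by
      intro k
      rw [← measure_univ (μ := μ k)]
      congr 1
      ext ω
      simpa using hε.trans_le (hle k ω)
    simp only [huniv] at hlim
    exact one_ne_zero (tendsto_nhds_unique tendsto_const_nhds hlim)
  rw [hI, lintegral_eq_zero_iff (by fun_prop)] at hI0
  filter_upwards [hI0] with a ha
  simpa using ha

variable {P : Fin 2 → Measure α} {V : α → β} {q : β → γ} {C B : ℝ}
  {D : (k : ℕ) → Ω k → γ → ℝ} {d : γ → ℝ} {M : (k : ℕ) → Ω k → β → ℝ} {m : β → ℝ}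
  {R : (k : ℕ) → Ω k → β → ℝ}

lemma isLittleOP_sq_sub_sq {ν : Measure α} {F : (k : ℕ) → Ω k → α → ℝ} {f : α → ℝ}
    (hF : ∀ k ω a, |F k ω a| ≤ B) (hf : ∀ᵐ a ∂ν, |f a| ≤ B)
    (h : IsLittleOP μ (fun k ω => ∫⁻ a, ‖F k ω a - f a‖ₑ ^ 2 ∂ν) fun _ => 1) :
    IsLittleOP μ (fun k ω => ∫⁻ a, ‖F k ω a ^ 2 - f a ^ 2‖ₑ ^ 2 ∂ν) fun _ => 1 := by
  refine (h.const_mul (c := (2 * B) ^ 2) (by positivity)).mono (Eventually.of_forall fun k ω => ?_)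
  rw [← lintegral_const_mul' _ _ (by finiteness)]
  refine lintegral_mono_ae ?_
  filter_upwards [hf] with a ha
  rw [enorm_sq_eq_ofReal, enorm_sq_eq_ofReal, ← ENNReal.ofReal_mul (by positivity)]
  apply ENNReal.ofReal_le_ofReal
  have h1 : (F k ω a + f a) ^ 2 ≤ (2 * B) ^ 2 :=
    sq_le_sq_of_abs_le (by linarith [abs_add_le (F k ω a) (f a), hF k ω a])
  calc (F k ω a ^ 2 - f a ^ 2) ^ 2 = (F k ω a + f a) ^ 2 * (F k ω a - f a) ^ 2 := by ring
    _ ≤ _ := by gcongr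

/-- `L²(P₁)` consistency of the outcome model term of the target average. -/
lemma isLittleOP_target_arm (hV : Measurable V) (hq : Measurable q) (hdom : IsDominated P V C)
    (hC : 0 ≤ C) (hD : ∀ k ω w, |D k ω w| ≤ B) (hDm : ∀ k ω, Measurable (D k ω))
    (hd : ∀ᵐ a ∂(P 1), |d (q (V a))| ≤ B) (hdm : Measurable d)
    (hMm : ∀ k ω, Measurable (M k ω)) (hmm : Measurable m)
    (hm : MemLp (fun a => m (V a)) 2 (P 1))
    (hDcons : IsLittleOP μ (fun k ω => ∫⁻ a, ‖D k ω (q (V a)) - d (q (V a))‖ₑ ^ 2 ∂(P 1)) fun _ => 1)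
    (hMcons : IsLittleOP μ (fun k ω => ∫⁻ a, ‖M k ω (V a) - m (V a)‖ₑ ^ 2 ∂(P 0)) fun _ => 1) :
    IsLittleOP μ (fun k ω => ∫⁻ a,
      ‖D k ω (q (V a)) * M k ω (V a) - d (q (V a)) * m (V a)‖ₑ ^ 2 ∂(P 1)) fun _ => 1 := by
  have hqV : Measurable fun a => q (V a) := hq.comp hV
  have hmV : Measurable fun a => m (V a) := hmm.comp hV
  -- In `D M - d m = D (M - m) + (D - d) m` the model `m` is only square-integrable, so the last
  -- term needs truncation of `m²` rather than a uniform bound.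
  have htrunc := hDcons.lintegral_mul_of_bounded (h := fun a => ‖m (V a)‖ₑ ^ 2) (C := (2 * B) ^ 2)
    (by fun_prop)
    (((memLp_two_iff_lintegral_enorm_sq hmV.aestronglyMeasurable).1 hm).ne)
    (fun k ω => by
      filter_upwards [hd] with a ha
      rw [enorm_sq_eq_ofReal]
      apply ENNReal.ofReal_le_ofReal
      rw [two_mul]
      exact sq_le_sq_of_abs_le (abs_sub_le_add_of_abs_le (hD k ω _) ha))
    (fun k ω => by have := (hDm k ω).comp hqV; have := hdm.comp hqV; fun_prop)
  refine ((hMcons.const_mul (c := 2 * B ^ 2 * C) (by positivity)).add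
    (htrunc.const_mul (c := 2) (by positivity))).mono (Eventually.of_forall fun k ω => ?_)
  have hpt : ∀ a, ‖D k ω (q (V a)) * M k ω (V a) - d (q (V a)) * m (V a)‖ₑ ^ 2
      ≤ ENNReal.ofReal (2 * B ^ 2) * ‖M k ω (V a) - m (V a)‖ₑ ^ 2
        + ENNReal.ofReal 2 * (‖D k ω (q (V a)) - d (q (V a))‖ₑ ^ 2 * ‖m (V a)‖ₑ ^ 2) := by
    intro a
    simp only [enorm_sq_eq_ofReal]
    rw [← ENNReal.ofReal_mul (by positivity), ← ENNReal.ofReal_mul (by positivity),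
      ← ENNReal.ofReal_mul (by positivity), ← ENNReal.ofReal_add (by positivity) (by positivity)]
    apply ENNReal.ofReal_le_ofReal
    have hDB : D k ω (q (V a)) ^ 2 ≤ B ^ 2 := sq_le_sq_of_abs_le (hD k ω _)
    have := mul_le_mul_of_nonneg_right hDB (sq_nonneg (M k ω (V a) - m (V a)))
    nlinarith [sq_nonneg (D k ω (q (V a)) * (M k ω (V a) - m (V a))
      - (D k ω (q (V a)) - d (q (V a))) * m (V a))]
  have hMV : Measurable fun a => M k ω (V a) - m (V a) := ((hMm k ω).comp hV).sub hmV
  refine (lintegral_mono hpt).trans ?_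
  rw [lintegral_add_left (by fun_prop), lintegral_const_mul' _ _ (by finiteness),
    lintegral_const_mul' _ _ (by finiteness)]
  refine add_le_add ?_ le_rfl
  rw [ENNReal.ofReal_mul (p := 2 * B ^ 2) (by positivity), mul_assoc]
  refine mul_le_mul_right ?_ _
  exact hdom.lintegral_le hV (f := fun b => ‖M k ω b - m b‖ₑ ^ 2)
    (((hMm k ω).sub hmm).enorm.pow_const 2)

/-- `L²(P₀)` consistency of the weighted residual term of the source average. -/
lemma isLittleOP_source_arm [∀ d, IsProbabilityMeasure (P d)] (hV : Measurable V)
    (hq : Measurable q) (hdom : IsDominated P V C)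
    (hC : 0 ≤ C) (hD : ∀ k ω w, |D k ω w| ≤ B) (hDm : ∀ k ω, Measurable (D k ω))
    (hd : ∀ᵐ a ∂(P 1), |d (q (V a))| ≤ B) (hdm : Measurable d)
    (hMm : ∀ k ω, Measurable (M k ω)) (hmm : Measurable m)
    (hm : MemLp (fun a => m (V a)) 2 (P 0))
    (hR : ∀ k ω v, |R k ω v| ≤ B) (hRm : ∀ k ω, Measurable (R k ω))
    {ℓ : α → ℝ} (hℓ : Measurable ℓ) (hℓ2 : MemLp ℓ 2 (P 0))
    (hDcons : IsLittleOP μ (fun k ω => ∫⁻ a, ‖D k ω (q (V a)) - d (q (V a))‖ₑ ^ 2 ∂(P 1)) fun _ => 1)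
    (hMcons : IsLittleOP μ (fun k ω => ∫⁻ a, ‖M k ω (V a) - m (V a)‖ₑ ^ 2 ∂(P 0)) fun _ => 1)
    (hRcons : IsLittleOP μ
      (fun k ω => ∫⁻ a, ‖R k ω (V a) - densityRatio P V (V a)‖ₑ ^ 2 ∂(P 0)) fun _ => 1) :
    IsLittleOP μ (fun k ω => ∫⁻ a, ‖D k ω (q (V a)) * (ℓ a - M k ω (V a)) * R k ω (V a)
      - d (q (V a)) * (ℓ a - m (V a)) * densityRatio P V (V a)‖ₑ ^ 2 ∂(P 0)) fun _ => 1 := by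
  have hqV : Measurable fun a => q (V a) := hq.comp hV
  have hdV : Measurable fun a => d (q (V a)) := hdm.comp hqV
  have hmV : Measurable fun a => m (V a) := hmm.comp hV
  have hpV : Measurable fun a => densityRatio P V (V a) := measurable_densityRatio_comp hV
  have hres : Measurable fun a => ℓ a - m (V a) := hℓ.sub hmV
  have hresfin : ∫⁻ a, ‖ℓ a - m (V a)‖ₑ ^ 2 ∂(P 0) < ∞ :=
    (memLp_two_iff_lintegral_enorm_sq hres.aestronglyMeasurable).1 (hℓ2.sub hm)
  have hac := hdom.absolutelyContinuous
  have hple := hdom.densityRatio_le hC hV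
  have htrunc1 := hRcons.lintegral_mul_of_bounded (h := fun a => ‖ℓ a - m (V a)‖ₑ ^ 2)
    (C := (B + C) ^ 2) (by fun_prop) hresfin.ne
    (fun k ω => by
      filter_upwards [hple] with a ha
      rw [enorm_sq_eq_ofReal]
      apply ENNReal.ofReal_le_ofReal
      exact sq_le_sq_of_abs_le (abs_sub_le_add_of_abs_le (hR k ω _)
        ((abs_of_nonneg (densityRatio_nonneg _)).trans_le ha)))
    (fun k ω => by have := (hRm k ω).comp hV; fun_prop)
  -- The contrast is consistent under the target law only. In the source average its error carries
  -- the density ratio as a factor, so it is measured under the reweighted law, where it has the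
  -- same size as under the target law.
  have htrunc2 := IsLittleOP.lintegral_mul_of_bounded (μ := μ) (ν := reweighted P V)
    (D := fun k ω a => ‖D k ω (q (V a)) - d (q (V a))‖ₑ ^ 2)
    (h := fun a => ‖ℓ a - m (V a)‖ₑ ^ 2) (C := (2 * B) ^ 2) (by fun_prop)
    (((lintegral_mono' (reweighted_le hdom hC hV) le_rfl).trans_lt (by
      rw [lintegral_smul_measure, smul_eq_mul]
      exact ENNReal.mul_lt_top (by simp) hresfin)).ne)
    (fun k ω => by
      rw [ae_reweighted_iff hac hV (p := fun v => ‖D k ω (q v) - d (q v)‖ₑ ^ 2 ≤ _)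
        (measurableSet_le ((((hDm k ω).comp hq).sub (hdm.comp hq)).enorm.pow_const 2)
          measurable_const)]
      filter_upwards [hd] with a ha
      rw [enorm_sq_eq_ofReal]
      apply ENNReal.ofReal_le_ofReal
      rw [two_mul]
      exact sq_le_sq_of_abs_le (abs_sub_le_add_of_abs_le (hD k ω _) ha))
    (fun k ω => by have := (hDm k ω).comp hqV; fun_prop)
    (hDcons.mono (Eventually.of_forall fun k ω => (lintegral_reweighted hac hV
      (f := fun v => ‖D k ω (q v) - d (q v)‖ₑ ^ 2)
      ((((hDm k ω).comp hq).sub (hdm.comp hq)).enorm.pow_const 2)).le))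
  refine (((hMcons.const_mul (c := 3 * B ^ 2 * B ^ 2) (by positivity)).add
    (htrunc1.const_mul (c := 3 * B ^ 2) (by positivity))).add
    (htrunc2.const_mul (c := 3 * C) (by positivity))).mono (Eventually.of_forall fun k ω => ?_)
  have hMV : Measurable fun a => M k ω (V a) - m (V a) := ((hMm k ω).comp hV).sub hmV
  have hRV : Measurable fun a => R k ω (V a) := (hRm k ω).comp hV
  have hDV : Measurable fun a => D k ω (q (V a)) := (hDm k ω).comp hqV
  rw [lintegral_mul_densityRatio hV (by fun_prop), ← lintegral_const_mul' _ _ (by finiteness),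
    ← lintegral_const_mul' _ _ (by finiteness), ← lintegral_const_mul' _ _ (by finiteness),
    ← lintegral_add_left (by fun_prop), ← lintegral_add_left (by fun_prop)]
  refine lintegral_mono_ae ?_
  filter_upwards [hple] with a ha
  have hp0 : 0 ≤ densityRatio P V (V a) := densityRatio_nonneg _
  simp only [enorm_sq_eq_ofReal]
  rw [← ENNReal.ofReal_mul (by positivity), ← ENNReal.ofReal_mul (by positivity),
    ← ENNReal.ofReal_mul (by positivity), ← ENNReal.ofReal_mul (by positivity),
    ← ENNReal.ofReal_mul (by positivity), ← ENNReal.ofReal_mul (by positivity),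
    ← ENNReal.ofReal_add (by positivity) (by positivity),
    ← ENNReal.ofReal_add (by positivity) (by positivity)]
  apply ENNReal.ofReal_le_ofReal
  have hDB : D k ω (q (V a)) ^ 2 ≤ B ^ 2 := sq_le_sq_of_abs_le (hD k ω _)
  have hRB : R k ω (V a) ^ 2 ≤ B ^ 2 := sq_le_sq_of_abs_le (hR k ω _)
  generalize D k ω (q (V a)) = x at *
  generalize M k ω (V a) = y at *
  generalize R k ω (V a) = z at *
  generalize d (q (V a)) = x₀ at *
  generalize m (V a) = y₀ at *
  generalize densityRatio P V (V a) = z₀ at *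
  have hsum : ∀ u v w : ℝ, (u + v + w) ^ 2 ≤ 3 * u ^ 2 + 3 * v ^ 2 + 3 * w ^ 2 := fun u v w => by
    nlinarith [sq_nonneg (u - v), sq_nonneg (v - w), sq_nonneg (u - w)]
  -- The contrast error is paired with the true ratio `z₀`, not with its estimate `z`: of the two
  -- factors `z₀` in the square, one is bounded by `C` and the other is the weight of the reweighted
  -- law.
  have hdec : x * (ℓ a - y) * z - x₀ * (ℓ a - y₀) * z₀
      = x * z * (y₀ - y) + x * ((z - z₀) * (ℓ a - y₀)) + z₀ * ((x - x₀) * (ℓ a - y₀)) := by ring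
  rw [hdec]
  refine (hsum _ _ _).trans (add_le_add (add_le_add ?_ ?_) ?_)
  · calc 3 * (x * z * (y₀ - y)) ^ 2 = 3 * (x ^ 2) * (z ^ 2) * (y - y₀) ^ 2 := by ring
      _ ≤ _ := by gcongr
  · calc 3 * (x * ((z - z₀) * (ℓ a - y₀))) ^ 2
        = 3 * (x ^ 2) * ((z - z₀) ^ 2 * (ℓ a - y₀) ^ 2) := by ring
      _ ≤ _ := by gcongr
  · calc 3 * (z₀ * ((x - x₀) * (ℓ a - y₀))) ^ 2
        = 3 * z₀ * (z₀ * ((x - x₀) ^ 2 * (ℓ a - y₀) ^ 2)) := by ring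
      _ ≤ _ := by gcongr

end Consistency

/-! ### Double robustness of one arm. -/

section Bias

variable {α β γ : Type*} [MeasurableSpace α] [StandardBorelSpace α] [Nonempty α]
  [MeasurableSpace β] [MeasurableSpace γ] {P : Fin 2 → Measure α} [∀ d, IsProbabilityMeasure (P d)]
  {V : α → β} {q : β → γ} {ℓ : α → ℝ} {C B : ℝ} {D : γ → ℝ} {M R : β → ℝ}

/-- The plug-in target mean plus the weighted source residual estimates the target mean of the
true outcome model up to a product of errors. -/
lemma enorm_arm_bias_le (hV : Measurable V) (hq : Measurable q) (hdom : IsDominated P V C)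
    (hC : 0 ≤ C) (hℓ : Measurable ℓ) (hℓ2 : MemLp ℓ 2 (P 0))
    (hD : ∀ w, |D w| ≤ B) (hDm : Measurable D) (hMm : Measurable M)
    (hR : ∀ v, |R v| ≤ B) (hRm : Measurable R)
    (hM : ∫⁻ a, ‖M (V a) - condMean (P 0) V ℓ (V a)‖ₑ ^ 2 ∂(P 0) < ∞) :
    MemLp (fun a => D (q (V a)) * M (V a)) 2 (P 1) ∧
    MemLp (fun a => D (q (V a)) * (ℓ a - M (V a)) * R (V a)) 2 (P 0) ∧
    ‖∫ a, D (q (V a)) * M (V a) ∂(P 1) + ∫ a, D (q (V a)) * (ℓ a - M (V a)) * R (V a) ∂(P 0)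
        - ∫ a, D (q (V a)) * condMean (P 1) (fun a => q (V a))
            (fun a => condMean (P 0) V ℓ (V a)) (q (V a)) ∂(P 1)‖ₑ
      ≤ ENNReal.ofReal B * ∫⁻ a, ‖(condMean (P 0) V ℓ (V a) - M (V a))
          * (R (V a) - densityRatio P V (V a))‖ₑ ∂(P 0) := by
  set m : β → ℝ := condMean (P 0) V ℓ with hmdef
  set p : β → ℝ := densityRatio P V with hpdef
  have hmm : Measurable m := measurable_condMean hℓ
  have hpm : Measurable p := measurable_densityRatio
  have hqV : Measurable fun a => q (V a) := hq.comp hV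
  have hmV : Measurable fun a => m (V a) := hmm.comp hV
  have hpV : Measurable fun a => p (V a) := hpm.comp hV
  have hMV : Measurable fun a => M (V a) := hMm.comp hV
  have hRV : Measurable fun a => R (V a) := hRm.comp hV
  have hDV : Measurable fun a => D (q (V a)) := hDm.comp hqV
  have hm2 : MemLp (fun a => m (V a)) 2 (P 0) := memLp_condMean_comp hV hℓ2
  have hdiff2 : MemLp (fun a => M (V a) - m (V a)) 2 (P 0) :=
    (memLp_two_iff_lintegral_enorm_sq (hMV.sub hmV).aestronglyMeasurable).2 hM
  have hM2 : MemLp (fun a => M (V a)) 2 (P 0) := by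
    convert! hdiff2.add hm2 using 1
    ext a
    simp
  have hM2' : MemLp (fun a => M (V a)) 2 (P 1) := hdom.memLp hV hMm hM2
  have hm2' : MemLp (fun a => m (V a)) 2 (P 1) := hdom.memLp hV hmm hm2
  have hp1 : ∀ᵐ a ∂(P 0), |p (V a)| ≤ C := by
    filter_upwards [hdom.densityRatio_le hC hV] with a ha
    exact (abs_of_nonneg (densityRatio_nonneg _)).trans_le ha
  have hT2 : MemLp (fun a => D (q (V a)) * M (V a)) 2 (P 1) :=
    memLp_two_bdd_mul hDV (fun a => hD _) hM2'
  have hS2 : MemLp (fun a => D (q (V a)) * (ℓ a - M (V a)) * R (V a)) 2 (P 0) := by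
    have := memLp_two_bdd_mul hRV (fun a => hR _)
      (memLp_two_bdd_mul hDV (fun a => hD _) (hℓ2.sub hM2))
    refine this.ae_eq (ae_of_all _ fun a => ?_)
    simp only [Pi.sub_apply]
    ring
  refine ⟨hT2, hS2, ?_⟩
  have hB0 : 0 ≤ B := by
    obtain ⟨a⟩ := ‹Nonempty α›
    exact (abs_nonneg _).trans (hD (q (V a)))
  -- the residual of the true outcome model has conditional mean zero
  have hDR : ∀ v, |D (q v) * R v| ≤ B * B := fun v => by
    rw [abs_mul]
    exact mul_le_mul (hD _) (hR _) (abs_nonneg _) hB0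
  have hDRm : Measurable fun v => D (q v) * R v := (hDm.comp hq).mul hRm
  have hresid : ∫ a, D (q (V a)) * (ℓ a - m (V a)) * R (V a) ∂(P 0) = 0 := by
    have hl1 : Integrable (fun a => D (q (V a)) * R (V a) * ℓ a) (P 0) :=
      (memLp_two_bdd_mul (hDRm.comp hV) (fun a => hDR _) hℓ2).integrable one_le_two
    have hm1 : Integrable (fun a => D (q (V a)) * R (V a) * m (V a)) (P 0) :=
      (memLp_two_bdd_mul (hDRm.comp hV) (fun a => hDR _) hm2).integrable one_le_two
    have := integral_mul_condMean_comp (P := P 0) hV (hℓ2.integrable one_le_two) hDRm hl1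
    rw [← sub_eq_zero, ← integral_sub hm1 hl1] at this
    rw [← neg_eq_zero, ← integral_neg, ← this]
    refine integral_congr_ae (ae_of_all _ fun a => ?_)
    ring
  -- `D` depends on `V` only through `q`, so `m` can be replaced by its target mean given `q ∘ V`.
  have hpart : ∫ a, D (q (V a)) * condMean (P 1) (fun a => q (V a)) (fun a => m (V a)) (q (V a)) ∂(P 1)
      = ∫ a, D (q (V a)) * m (V a) ∂(P 1) :=
    integral_mul_condMean_comp hqV (hm2'.integrable one_le_two) hDm
      ((memLp_two_bdd_mul hDV (fun a => hD _) hm2').integrable one_le_two)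
  have hweight : ∫ a, D (q (V a)) * (m (V a) - M (V a)) * p (V a) ∂(P 0)
      = ∫ a, D (q (V a)) * (m (V a) - M (V a)) ∂(P 1) :=
    integral_mul_densityRatio hdom.absolutelyContinuous hV
      (f := fun v => D (q v) * (m v - M v)) ((hDm.comp hq).mul (hmm.sub hMm))
  have hDm1 : Integrable (fun a => D (q (V a)) * (m (V a) - M (V a))) (P 0) :=
    (memLp_two_bdd_mul hDV (fun a => hD _) (hm2.sub hM2)).integrable one_le_two
  have hi1 : Integrable (fun a => D (q (V a)) * (m (V a) - M (V a)) * R (V a)) (P 0) :=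
    hDm1.mul_bdd (c := B) hRV.aestronglyMeasurable (ae_of_all _ fun a => hR _)
  have hi2 : Integrable (fun a => D (q (V a)) * (m (V a) - M (V a)) * p (V a)) (P 0) :=
    hDm1.mul_bdd (c := C) hpV.aestronglyMeasurable hp1
  have hi3 : Integrable (fun a => D (q (V a)) * (ℓ a - m (V a)) * R (V a)) (P 0) :=
    ((memLp_two_bdd_mul hDV (fun a => hD _) (hℓ2.sub hm2)).integrable one_le_two).mul_bdd (c := B)
      hRV.aestronglyMeasurable (ae_of_all _ fun a => hR _)
  -- The error `m - M` enters with weight `R` in the source average and, once the target average is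
  -- moved to the source, with weight `-p`.
  have hkey : ∫ a, D (q (V a)) * M (V a) ∂(P 1)
        + ∫ a, D (q (V a)) * (ℓ a - M (V a)) * R (V a) ∂(P 0)
        - ∫ a, D (q (V a)) * m (V a) ∂(P 1)
      = ∫ a, D (q (V a)) * ((m (V a) - M (V a)) * (R (V a) - p (V a))) ∂(P 0) := by
    have e1 : ∫ a, D (q (V a)) * (ℓ a - M (V a)) * R (V a) ∂(P 0)
        = ∫ a, D (q (V a)) * (m (V a) - M (V a)) * R (V a) ∂(P 0) := by
      rw [← zero_add (∫ a, D (q (V a)) * (m (V a) - M (V a)) * R (V a) ∂(P 0)), ← hresid,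
        ← integral_add hi3 hi1]
      refine integral_congr_ae (ae_of_all _ fun a => ?_)
      ring
    have e2 : ∫ a, D (q (V a)) * (m (V a) - M (V a)) ∂(P 1)
        = ∫ a, D (q (V a)) * m (V a) ∂(P 1) - ∫ a, D (q (V a)) * M (V a) ∂(P 1) := by
      rw [← integral_sub ((memLp_two_bdd_mul hDV (fun a => hD _) hm2').integrable one_le_two)
        (hT2.integrable one_le_two)]
      refine integral_congr_ae (ae_of_all _ fun a => ?_)
      ring
    have e3 : ∫ a, D (q (V a)) * ((m (V a) - M (V a)) * (R (V a) - p (V a))) ∂(P 0)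
        = ∫ a, D (q (V a)) * (m (V a) - M (V a)) * R (V a) ∂(P 0)
          - ∫ a, D (q (V a)) * (m (V a) - M (V a)) * p (V a) ∂(P 0) := by
      rw [← integral_sub hi1 hi2]
      refine integral_congr_ae (ae_of_all _ fun a => ?_)
      ring
    rw [e3, hweight, e2, e1]
    ring
  rw [hpart, hkey, ← lintegral_const_mul' _ _ (by finiteness)]
  refine (enorm_integral_le_lintegral_enorm _).trans (lintegral_mono fun a => ?_)
  rw [enorm_mul, Real.enorm_eq_ofReal_abs (D _)]
  gcongr
  exact hD _

end Bias

/-! ### One arm at the true nuisance parameters. -/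

section ArmPopulation

variable {α β γ : Type*} [MeasurableSpace α] [StandardBorelSpace α] [Nonempty α]
  [MeasurableSpace β] [MeasurableSpace γ] {P : Fin 2 → Measure α} [∀ d, IsProbabilityMeasure (P d)]
  {V : α → β} {q : β → γ} {ℓ : α → ℝ} {C B : ℝ} {d : γ → ℝ}

/-- Moments of the outcome model and residual terms at the true nuisance parameters. -/
lemma arm_population (hV : Measurable V) (hq : Measurable q) (hdom : IsDominated P V C)
    (hC : 0 ≤ C) (hℓ : Measurable ℓ) (hℓ2 : MemLp ℓ 2 (P 0)) (hdm : Measurable d)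
    (hd : ∀ᵐ a ∂(P 1), |d (q (V a))| ≤ B) :
    MemLp (fun a => d (q (V a)) * condMean (P 0) V ℓ (V a)) 2 (P 1) ∧
    ∫ a, d (q (V a)) * condMean (P 0) V ℓ (V a) ∂(P 1)
      = ∫ a, d (q (V a)) * condMean (P 1) (fun a => q (V a))
            (fun a => condMean (P 0) V ℓ (V a)) (q (V a)) ∂(P 1) ∧
    MemLp (fun a => d (q (V a)) * (ℓ a - condMean (P 0) V ℓ (V a)) * densityRatio P V (V a)) 2
      (P 0) ∧
    ∫ a, d (q (V a)) * (ℓ a - condMean (P 0) V ℓ (V a)) * densityRatio P V (V a) ∂(P 0) = 0 := by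
  have hB0 : 0 ≤ B := by
    obtain ⟨a, ha⟩ := hd.exists
    exact (abs_nonneg _).trans ha
  have hset : MeasurableSet {w | |d w| ≤ B} := measurableSet_le hdm.abs measurable_const
  have hset' : MeasurableSet {v | densityRatio P V v ≤ C} :=
    measurableSet_le measurable_densityRatio measurable_const
  -- The true contrast and ratio are bounded almost surely, while `enorm_arm_bias_le` asks for
  -- bounds everywhere; both are set to zero where the bound fails.
  set D : γ → ℝ := {w | |d w| ≤ B}.indicator d with hDdef
  set R : β → ℝ := {v | densityRatio P V v ≤ C}.indicator (densityRatio P V) with hRdef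
  have hmm : Measurable (condMean (P 0) V ℓ) := measurable_condMean hℓ
  have hD : ∀ w, |D w| ≤ max B C := fun w => by
    by_cases hw : w ∈ {w | |d w| ≤ B}
    · rw [hDdef, Set.indicator_of_mem hw]
      exact le_trans hw (le_max_left _ _)
    · rw [hDdef, Set.indicator_of_notMem hw]
      simp [hB0]
  have hR : ∀ v, |R v| ≤ max B C := fun v => by
    by_cases hv : v ∈ {v | densityRatio P V v ≤ C}
    · rw [hRdef, Set.indicator_of_mem hv, abs_of_nonneg (densityRatio_nonneg _)]
      exact le_trans hv (le_max_right _ _)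
    · rw [hRdef, Set.indicator_of_notMem hv]
      simp [hC]
  have hDd : ∀ᵐ a ∂(P 1), D (q (V a)) = d (q (V a)) := by
    filter_upwards [hd] with a ha
    rw [hDdef, Set.indicator_of_mem (by exact ha)]
  -- `d` is bounded target-almost surely only, but source points where the bound fails have ratio
  -- zero up to a null set, so truncation does not change the product.
  have hprod : ∀ᵐ a ∂(P 0), D (q (V a)) * (ℓ a - condMean (P 0) V ℓ (V a)) * R (V a)
      = d (q (V a)) * (ℓ a - condMean (P 0) V ℓ (V a)) * densityRatio P V (V a) := by
    filter_upwards [hdom.densityRatio_le hC hV,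
      ae_densityRatio_ne_zero hdom.absolutelyContinuous hV (p := fun v => |d (q v)| ≤ B)
        (measurableSet_le (hdm.comp hq).abs measurable_const) hd] with a ha1 ha2
    rw [hRdef, Set.indicator_of_mem (by exact ha1)]
    by_cases h0 : densityRatio P V (V a) = 0
    · rw [h0, mul_zero, mul_zero]
    · rw [hDdef, Set.indicator_of_mem (by exact ha2 h0)]
  -- With `M` the true outcome model the product of errors vanishes, and the bias bound says that
  -- the residual term has mean zero.
  obtain ⟨h1, h2, h3⟩ := enorm_arm_bias_le hV hq hdom hC hℓ hℓ2 hD (hdm.indicator hset) hmm hR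
    (measurable_densityRatio.indicator hset') (by simp)
  have h1' : MemLp (fun a => d (q (V a)) * condMean (P 0) V ℓ (V a)) 2 (P 1) := by
    refine h1.ae_eq ?_
    filter_upwards [hDd] with a ha
    rw [ha]
  have hpart : ∫ a, d (q (V a)) * condMean (P 0) V ℓ (V a) ∂(P 1)
      = ∫ a, d (q (V a)) * condMean (P 1) (fun a => q (V a))
            (fun a => condMean (P 0) V ℓ (V a)) (q (V a)) ∂(P 1) :=
    (integral_mul_condMean_comp (hq.comp hV)
      ((hdom.memLp hV hmm (memLp_condMean_comp hV hℓ2)).integrable one_le_two) hdm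
      (h1'.integrable one_le_two)).symm
  refine ⟨h1', hpart, h2.ae_eq hprod, ?_⟩
  have e1 : ∫ a, D (q (V a)) * condMean (P 0) V ℓ (V a) ∂(P 1)
      = ∫ a, d (q (V a)) * condMean (P 0) V ℓ (V a) ∂(P 1) := by
    refine integral_congr_ae ?_
    filter_upwards [hDd] with a ha
    rw [ha]
  have e2 : ∫ a, D (q (V a)) * condMean (P 1) (fun a => q (V a))
            (fun a => condMean (P 0) V ℓ (V a)) (q (V a)) ∂(P 1)
      = ∫ a, d (q (V a)) * condMean (P 1) (fun a => q (V a))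
            (fun a => condMean (P 0) V ℓ (V a)) (q (V a)) ∂(P 1) := by
    refine integral_congr_ae ?_
    filter_upwards [hDd] with a ha
    rw [ha]
  rw [integral_congr_ae hprod, e1, e2, hpart, add_sub_cancel_left] at h3
  simpa using h3

end ArmPopulation

/-! ### The numerator as a square and two arms. -/

section Numerator

variable {m₁ m₂ : ℕ} {𝒴 : Type*}

/-- The contrast `μ_{·s0} - μ_{·10}`. -/
def contrast (η : Nuisance m₁ m₂) (s : Finset (Fin m₂)) (w : Fin m₁ → ℝ) : ℝ :=
  η.muPart s w - η.muTarget w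

/-- With `d` the contrast, `d² - 2 d μ_{·s0} + 2 d μ_{·10} = -d²`; what remains are the target
halves of two arms of the same shape. -/
lemma targetTerm_eq (η : Nuisance m₁ m₂) (s : Finset (Fin m₂)) (o : Obs m₁ m₂ 𝒴) :
    targetTerm η s o = -contrast η s (getW o) ^ 2
      + 2 * (contrast η s (getW o) * η.muSub s (getWZs s o))
      - 2 * (contrast η s (getW o) * η.muFull (getWZ o)) := by
  unfold targetTerm contrast
  ring

lemma sourceTerm_eq (ℓ : Obs m₁ m₂ 𝒴 → ℝ) (η : Nuisance m₁ m₂) (s : Finset (Fin m₂))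
    (o : Obs m₁ m₂ 𝒴) :
    sourceTerm ℓ η s o
      = 2 * (contrast η s (getW o) * (ℓ o - η.muSub s (getWZs s o)) * η.piSub s (getWZs s o))
        - 2 * (contrast η s (getW o) * (ℓ o - η.muFull (getWZ o)) * η.piFull (getWZ o)) := by
  unfold sourceTerm contrast
  ring

variable [MeasurableSpace 𝒴]

lemma measurable_getW : Measurable (getW : Obs m₁ m₂ 𝒴 → _) := measurable_fst

lemma measurable_getWZ : Measurable (getWZ : Obs m₁ m₂ 𝒴 → _) :=
  measurable_fst.prodMk (measurable_fst.comp measurable_snd)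

lemma measurable_getWZs (s : Finset (Fin m₂)) : Measurable (getWZs s : Obs m₁ m₂ 𝒴 → _) :=
  measurable_fst.prodMk (measurable_pi_lambda _ fun i =>
    (measurable_pi_apply (i : Fin m₂)).comp (measurable_fst.comp measurable_snd))

lemma isDominated_getWZs {P : Fin 2 → Measure (Obs m₁ m₂ 𝒴)} {C : ℝ}
    (hdom : IsDominated P getWZ C) (s : Finset (Fin m₂)) :
    IsDominated P (getWZs s) C :=
  hdom.comp (q := fun v : (Fin m₁ → ℝ) × (Fin m₂ → ℝ) => (v.1, fun i : s => v.2 i))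
    measurable_getWZ (measurable_fst.prodMk (measurable_pi_lambda _ fun i =>
      (measurable_pi_apply (i : Fin m₂)).comp measurable_snd))

variable [StandardBorelSpace 𝒴] [Nonempty 𝒴] {P : Fin 2 → Measure (Obs m₁ m₂ 𝒴)}
  [∀ d, IsProbabilityMeasure (P d)] {ℓ : Obs m₁ m₂ 𝒴 → ℝ} {s : Finset (Fin m₂)} {B C : ℝ}

/-- The baseline mean `μ_{·00}` cancels in the difference of the two gaps. -/
lemma vNum_eq (s : Finset (Fin m₂)) :
    vNum P ℓ s = ∫ o, contrast (trueNuisance P ℓ) s (getW o) ^ 2 ∂(P 1) := by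
  unfold vNum gapPart gapFull contrast
  congr 1
  ext o
  ring

lemma measurable_contrast_trueNuisance (hℓ : Measurable ℓ) :
    Measurable (contrast (trueNuisance P ℓ) s) :=
  (measurable_condMean ((measurable_condMean hℓ).comp (measurable_getWZs s))).sub
    (measurable_condMean ((measurable_condMean hℓ).comp measurable_getWZ))

/-- Moments of the two parts of the uncentred influence function of the numerator. -/
lemma numerator_population (hdom : IsDominated P getWZ C) (hC : 0 ≤ C) (hℓ : Measurable ℓ)
    (hℓ2 : MemLp ℓ 2 (P 0))
    (hd : ∀ᵐ o ∂(P 1), |contrast (trueNuisance P ℓ) s (getW o)| ≤ B) :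
    MemLp (targetTerm (trueNuisance P ℓ) s) 2 (P 1) ∧
    ∫ o, targetTerm (trueNuisance P ℓ) s o ∂(P 1) = vNum P ℓ s ∧
    MemLp (sourceTerm ℓ (trueNuisance P ℓ) s) 2 (P 0) ∧
    ∫ o, sourceTerm ℓ (trueNuisance P ℓ) s o ∂(P 0) = 0 := by
  have hdm := measurable_contrast_trueNuisance (P := P) (s := s) hℓ
  obtain ⟨hs1, hs2, hs3, hs4⟩ := arm_population (q := Prod.fst) (measurable_getWZs s)
    measurable_fst (isDominated_getWZs hdom s) hC hℓ hℓ2 hdm hd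
  obtain ⟨hf1, hf2, hf3, hf4⟩ := arm_population (q := Prod.fst) measurable_getWZ
    measurable_fst hdom hC hℓ hℓ2 hdm hd
  have hdW : Measurable fun o : Obs m₁ m₂ 𝒴 => contrast (trueNuisance P ℓ) s (getW o) :=
    hdm.comp measurable_getW
  have hsq : MemLp (fun o => -contrast (trueNuisance P ℓ) s (getW o) ^ 2) 2 (P 1) := by
    refine MemLp.of_bound (hdW.pow_const 2).neg.aestronglyMeasurable (B ^ 2) ?_
    filter_upwards [hd] with o ho
    rw [norm_neg, Real.norm_eq_abs, abs_of_nonneg (sq_nonneg _)]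
    exact sq_le_sq_of_abs_le ho
  have hpartW : MemLp (fun o => (trueNuisance P ℓ).muPart s (getW o)) 2 (P 1) :=
    memLp_condMean_comp measurable_getW ((isDominated_getWZs hdom s).memLp (measurable_getWZs s)
      (measurable_condMean hℓ) (memLp_condMean_comp (measurable_getWZs s) hℓ2))
  have htgtW : MemLp (fun o => (trueNuisance P ℓ).muTarget (getW o)) 2 (P 1) :=
    memLp_condMean_comp measurable_getW (hdom.memLp measurable_getWZ
      (measurable_condMean hℓ) (memLp_condMean_comp measurable_getWZ hℓ2))
  have hcW : MemLp (fun o => contrast (trueNuisance P ℓ) s (getW o)) 2 (P 1) :=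
    hpartW.sub htgtW
  have ht : targetTerm (trueNuisance P ℓ) s = fun o : Obs m₁ m₂ 𝒴 => _ :=
    funext fun o => targetTerm_eq (trueNuisance P ℓ) s o
  have hsrc : sourceTerm ℓ (trueNuisance P ℓ) s = fun o : Obs m₁ m₂ 𝒴 => _ :=
    funext fun o => sourceTerm_eq ℓ (trueNuisance P ℓ) s o
  rw [ht, hsrc]
  have hs1' := hs1.const_mul 2
  have hf1' := hf1.const_mul 2
  have hs3' := hs3.const_mul 2
  have hf3' := hf3.const_mul 2
  refine ⟨(hsq.add hs1').sub hf1', ?_, hs3'.sub hf3', ?_⟩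
  · have i1 := hsq.integrable one_le_two
    have i2 := hs1'.integrable one_le_two
    have i3 := hf1'.integrable one_le_two
    have e1 := integral_sub (i1.add i2) i3
    have e2 := integral_add i1 i2
    simp only [Pi.add_apply] at e1
    refine e1.trans ?_
    rw [e2, integral_const_mul, integral_const_mul, integral_neg, vNum_eq]
    rw [hs2, hf2]
    have j1 := (hcW.integrable_mul hpartW)
    have j2 := (hcW.integrable_mul htgtW)
    -- The arms contribute `2 E₁[d²]`; with `-E₁[d²]` exactly `v_Z^num(s)` remains.
    have e3 : ∫ o, contrast (trueNuisance P ℓ) s (getW o) ^ 2 ∂(P 1)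
        = ∫ o, contrast (trueNuisance P ℓ) s (getW o) * (trueNuisance P ℓ).muPart s (getW o) ∂(P 1)
          - ∫ o, contrast (trueNuisance P ℓ) s (getW o) * (trueNuisance P ℓ).muTarget (getW o)
              ∂(P 1) := by
      rw [← integral_sub (by exact j1) (by exact j2)]
      refine integral_congr_ae (ae_of_all _ fun o => ?_)
      simp only [contrast]
      ring
    -- The first components of `getWZs` and `getWZ` unfold to `getW`, and the conditional means to
    -- fields of `trueNuisance`.
    change -∫ o, contrast (trueNuisance P ℓ) s (getW o) ^ 2 ∂(P 1)
      + 2 * ∫ o, contrast (trueNuisance P ℓ) s (getW o) * (trueNuisance P ℓ).muPart s (getW o) ∂(P 1)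
      - 2 * ∫ o, contrast (trueNuisance P ℓ) s (getW o) * (trueNuisance P ℓ).muTarget (getW o)
          ∂(P 1) = _
    linarith
  · have i3 := hs3'.integrable one_le_two
    have i4 := hf3'.integrable one_le_two
    refine (integral_sub i3 i4).trans ?_
    rw [integral_const_mul, integral_const_mul]
    change 2 * ∫ o, contrast (trueNuisance P ℓ) s (getWZs s o).1 * _ * _ ∂(P 0)
      - 2 * ∫ o, contrast (trueNuisance P ℓ) s (getWZ o).1 * _ * _ ∂(P 0) = 0
    refine (congrArg₂ (fun x y => 2 * x - 2 * y) hs4 hf4).trans ?_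
    norm_num

/-- The bias of the one-step numerator is of second order. -/
lemma enorm_numerator_bias_le (hdom : IsDominated P getWZ C) (hC : 0 ≤ C) (hℓ : Measurable ℓ)
    (hℓ2 : MemLp ℓ 2 (P 0)) {η : Nuisance m₁ m₂} (hc : ∀ w, |contrast η s w| ≤ B)
    (hcm : Measurable (contrast η s)) (hsub : Measurable (η.muSub s)) (hfull : Measurable η.muFull)
    (hps : Measurable (η.piSub s)) (hpf : Measurable η.piFull)
    (hpsB : ∀ v, |η.piSub s v| ≤ B) (hpfB : ∀ v, |η.piFull v| ≤ B)
    (h1 : ∫⁻ o, ‖η.muSub s (getWZs s o) - (trueNuisance P ℓ).muSub s (getWZs s o)‖ₑ ^ 2 ∂(P 0) < ∞)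
    (h2 : ∫⁻ o, ‖η.muFull (getWZ o) - (trueNuisance P ℓ).muFull (getWZ o)‖ₑ ^ 2 ∂(P 0) < ∞) :
    Integrable (targetTerm η s) (P 1) ∧ Integrable (sourceTerm ℓ η s) (P 0) ∧
    ‖∫ o, targetTerm η s o ∂(P 1) + ∫ o, sourceTerm ℓ η s o ∂(P 0) - vNum P ℓ s‖ₑ
      ≤ ∫⁻ o, ‖contrast η s (getW o) - contrast (trueNuisance P ℓ) s (getW o)‖ₑ ^ 2 ∂(P 1)
        + ENNReal.ofReal (2 * B) * ∫⁻ o,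
          ‖((trueNuisance P ℓ).muSub s (getWZs s o) - η.muSub s (getWZs s o))
            * (η.piSub s (getWZs s o) - (trueNuisance P ℓ).piSub s (getWZs s o))‖ₑ ∂(P 0)
        + ENNReal.ofReal (2 * B) * ∫⁻ o,
          ‖((trueNuisance P ℓ).muFull (getWZ o) - η.muFull (getWZ o))
            * (η.piFull (getWZ o) - (trueNuisance P ℓ).piFull (getWZ o))‖ₑ ∂(P 0) := by
  obtain ⟨hs1, hs2, hs3⟩ := enorm_arm_bias_le (q := Prod.fst) (measurable_getWZs s)
    measurable_fst (isDominated_getWZs hdom s) hC hℓ hℓ2 hc hcm hsub hpsB hps h1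
  obtain ⟨hf1, hf2, hf3⟩ := enorm_arm_bias_le (q := Prod.fst) measurable_getWZ
    measurable_fst hdom hC hℓ hℓ2 hc hcm hfull hpfB hpf h2
  have hB0 : 0 ≤ B := (abs_nonneg _).trans (hc 0)
  have hcWm : Measurable fun o : Obs m₁ m₂ 𝒴 => contrast η s (getW o) :=
    hcm.comp measurable_getW
  have hdWm : Measurable fun o : Obs m₁ m₂ 𝒴 => contrast (trueNuisance P ℓ) s (getW o) :=
    (measurable_contrast_trueNuisance hℓ).comp measurable_getW
  have hpartW : MemLp (fun o => (trueNuisance P ℓ).muPart s (getW o)) 2 (P 1) :=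
    memLp_condMean_comp measurable_getW ((isDominated_getWZs hdom s).memLp (measurable_getWZs s)
      (measurable_condMean hℓ) (memLp_condMean_comp (measurable_getWZs s) hℓ2))
  have htgtW : MemLp (fun o => (trueNuisance P ℓ).muTarget (getW o)) 2 (P 1) :=
    memLp_condMean_comp measurable_getW (hdom.memLp measurable_getWZ
      (measurable_condMean hℓ) (memLp_condMean_comp measurable_getWZ hℓ2))
  have hdW : MemLp (fun o => contrast (trueNuisance P ℓ) s (getW o)) 2 (P 1) :=
    hpartW.sub htgtW
  have hcW : MemLp (fun o => contrast η s (getW o)) 2 (P 1) :=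
    MemLp.of_bound hcWm.aestronglyMeasurable B (ae_of_all _ fun o => hc _)
  have ht : targetTerm η s = fun o : Obs m₁ m₂ 𝒴 => _ := funext fun o => targetTerm_eq η s o
  have hsrc : sourceTerm ℓ η s = fun o : Obs m₁ m₂ 𝒴 => _ :=
    funext fun o => sourceTerm_eq ℓ η s o
  have i1 : Integrable (fun o => -contrast η s (getW o) ^ 2) (P 1) := hcW.integrable_sq.neg
  have i2 := (hs1.const_mul 2).integrable one_le_two
  have i3 := (hf1.const_mul 2).integrable one_le_two
  have i4 := (hs2.const_mul 2).integrable one_le_two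
  have i5 := (hf2.const_mul 2).integrable one_le_two
  have it : Integrable (targetTerm η s) (P 1) := by
    rw [ht]
    exact (i1.add i2).sub i3
  have is : Integrable (sourceTerm ℓ η s) (P 0) := by
    rw [hsrc]
    exact i4.sub i5
  refine ⟨it, is, ?_⟩
  -- `es` and `ef` are the biases of the two arms, read off from `hs3` and `hf3` by unification.
  set es : ℝ := _ with hes
  change ‖es‖ₑ ≤ _ at hs3
  set ef : ℝ := _ with hef
  change ‖ef‖ₑ ≤ _ at hf3
  have e1 : ∫ o, targetTerm η s o ∂(P 1) = -∫ o, contrast η s (getW o) ^ 2 ∂(P 1)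
      + 2 * ∫ o, contrast η s (getWZs s o).1 * η.muSub s (getWZs s o) ∂(P 1)
      - 2 * ∫ o, contrast η s (getWZ o).1 * η.muFull (getWZ o) ∂(P 1) := by
    rw [ht]
    refine (integral_sub (i1.add i2) i3).trans ?_
    rw [← integral_neg, ← integral_const_mul, ← integral_const_mul]
    congr 1
    exact integral_add i1 i2
  have e2 : ∫ o, sourceTerm ℓ η s o ∂(P 0)
      = 2 * ∫ o, contrast η s (getWZs s o).1 * (ℓ o - η.muSub s (getWZs s o))
            * η.piSub s (getWZs s o) ∂(P 0)
        - 2 * ∫ o, contrast η s (getWZ o).1 * (ℓ o - η.muFull (getWZ o))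
            * η.piFull (getWZ o) ∂(P 0) := by
    rw [hsrc, ← integral_const_mul, ← integral_const_mul]
    exact integral_sub i4 i5
  -- The cross term `-2 d̂ d` supplies the means of `d̂ μ_{·s0}` and `d̂ μ_{·10}` that the two arms
  -- estimate.
  have e3 : ∫ o, (contrast η s (getW o) - contrast (trueNuisance P ℓ) s (getW o)) ^ 2 ∂(P 1)
      = ∫ o, contrast η s (getW o) ^ 2 ∂(P 1) + vNum P ℓ s
        - 2 * ∫ o, contrast η s (getW o) * (trueNuisance P ℓ).muPart s (getW o) ∂(P 1)
        + 2 * ∫ o, contrast η s (getW o) * (trueNuisance P ℓ).muTarget (getW o) ∂(P 1) := by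
    have j1 : Integrable (fun o => contrast η s (getW o) ^ 2) (P 1) := hcW.integrable_sq
    have j2 : Integrable (fun o => contrast (trueNuisance P ℓ) s (getW o) ^ 2) (P 1) :=
      hdW.integrable_sq
    have j3 : Integrable
        (fun o => 2 * (contrast η s (getW o) * (trueNuisance P ℓ).muPart s (getW o))) (P 1) :=
      (hcW.integrable_mul hpartW).const_mul 2
    have j4 : Integrable
        (fun o => 2 * (contrast η s (getW o) * (trueNuisance P ℓ).muTarget (getW o))) (P 1) :=
      (hcW.integrable_mul htgtW).const_mul 2
    rw [vNum_eq, ← integral_const_mul, ← integral_const_mul, ← integral_add j1 j2,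
      ← integral_sub (by exact j1.add j2) j3, ← integral_add (by exact (j1.add j2).sub j3) j4]
    refine integral_congr_ae (ae_of_all _ fun o => ?_)
    simp only [contrast]
    ring
  have key : ∫ o, targetTerm η s o ∂(P 1) + ∫ o, sourceTerm ℓ η s o ∂(P 0) - vNum P ℓ s
      = -∫ o, (contrast η s (getW o) - contrast (trueNuisance P ℓ) s (getW o)) ^ 2 ∂(P 1)
        + 2 * es - 2 * ef := by
    rw [e1, e2, e3, hes, hef]
    change _ = -(_ + vNum P ℓ s
        - 2 * ∫ o, contrast η s (getWZs s o).1 * condMean (P 1) (fun o => (getWZs s o).1)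
            (fun o => condMean (P 0) (getWZs s) ℓ (getWZs s o)) (getWZs s o).1 ∂(P 1)
        + 2 * ∫ o, contrast η s (getWZ o).1 * condMean (P 1) (fun o => (getWZ o).1)
            (fun o => condMean (P 0) getWZ ℓ (getWZ o)) (getWZ o).1 ∂(P 1)) + _ - _
    ring
  rw [key]
  refine (enorm_sub_le.trans (add_le_add (enorm_add_le _ _) le_rfl)).trans ?_
  refine add_le_add (add_le_add ?_ ?_) ?_
  · rw [enorm_neg]
    refine (enorm_integral_le_lintegral_enorm _).trans (lintegral_mono fun o => ?_)
    rw [enorm_pow]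
  · rw [ENNReal.ofReal_mul (by norm_num), mul_assoc, enorm_mul]
    exact mul_le_mul' (by simp [Real.enorm_eq_ofReal_abs]) hs3
  · rw [ENNReal.ofReal_mul (by norm_num), mul_assoc, enorm_mul]
    exact mul_le_mul' (by simp [Real.enorm_eq_ofReal_abs]) hf3

end Numerator

/-! ### Linear combinations of mean square errors. -/

section SquaredErrors

variable {Ω : ℕ → Type*} [∀ k, MeasurableSpace (Ω k)] {μ : (k : ℕ) → Measure (Ω k)}
  {α : Type*} [MeasurableSpace α] {ν : Measure α} {f g : (k : ℕ) → Ω k → α → ℝ} {a : ℕ → ℝ}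

lemma IsLittleOP.lintegral_sq_const_mul
    (hf : IsLittleOP μ (fun k ω => ∫⁻ x, ‖f k ω x‖ₑ ^ 2 ∂ν) a) (c : ℝ) :
    IsLittleOP μ (fun k ω => ∫⁻ x, ‖c * f k ω x‖ₑ ^ 2 ∂ν) a := by
  refine (hf.const_mul (sq_nonneg c)).mono (Eventually.of_forall fun k ω => ?_)
  rw [← lintegral_const_mul' _ _ (by finiteness)]
  refine lintegral_mono fun x => le_of_eq ?_
  rw [enorm_mul, mul_pow, enorm_sq_eq_ofReal c]

lemma IsLittleOP.lintegral_sq_add (hfm : ∀ k ω, Measurable (f k ω))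
    (hf : IsLittleOP μ (fun k ω => ∫⁻ x, ‖f k ω x‖ₑ ^ 2 ∂ν) a)
    (hg : IsLittleOP μ (fun k ω => ∫⁻ x, ‖g k ω x‖ₑ ^ 2 ∂ν) a) :
    IsLittleOP μ (fun k ω => ∫⁻ x, ‖f k ω x + g k ω x‖ₑ ^ 2 ∂ν) a := by
  refine ((hf.const_mul (c := 2) (by norm_num)).add (hg.const_mul (c := 2) (by norm_num))).mono
    (Eventually.of_forall fun k ω => ?_)
  rw [← lintegral_const_mul' _ _ (by finiteness), ← lintegral_const_mul' _ _ (by finiteness),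
    ← lintegral_add_left (by have := hfm k ω; fun_prop)]
  refine lintegral_mono fun x => ?_
  simp only [enorm_sq_eq_ofReal]
  rw [← ENNReal.ofReal_mul (by norm_num), ← ENNReal.ofReal_mul (by norm_num),
    ← ENNReal.ofReal_add (by positivity) (by positivity)]
  apply ENNReal.ofReal_le_ofReal
  nlinarith [sq_nonneg (f k ω x - g k ω x)]

lemma IsLittleOP.lintegral_sq_sub (hfm : ∀ k ω, Measurable (f k ω))
    (hf : IsLittleOP μ (fun k ω => ∫⁻ x, ‖f k ω x‖ₑ ^ 2 ∂ν) a)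
    (hg : IsLittleOP μ (fun k ω => ∫⁻ x, ‖g k ω x‖ₑ ^ 2 ∂ν) a) :
    IsLittleOP μ (fun k ω => ∫⁻ x, ‖f k ω x - g k ω x‖ₑ ^ 2 ∂ν) a :=
  (hf.lintegral_sq_add hfm (hg.lintegral_sq_const_mul (-1))).mono
    (Eventually.of_forall fun k ω => le_of_eq (by simp [sub_eq_add_neg]))

end SquaredErrors

/-! ### The denominator as the numerator of the empty subset. -/

section EmptySubset

variable {m₁ m₂ : ℕ} {𝒴 : Type*} [MeasurableSpace 𝒴] [StandardBorelSpace 𝒴] [Nonempty 𝒴]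
  {P : Fin 2 → Measure (Obs m₁ m₂ 𝒴)} [∀ d, IsProbabilityMeasure (P d)]
  {ℓ : Obs m₁ m₂ 𝒴 → ℝ} {C : ℝ}

/-- The numerator of the empty subset is the denominator. -/
lemma vNum_empty (hdom : IsDominated P getWZ C) (hℓ : Measurable ℓ) (hℓ2 : MemLp ℓ 2 (P 0)) :
    vNum P ℓ ∅ = vDen P ℓ := by
  have hWm : Measurable (condMean (P 0) getW ℓ) := measurable_condMean hℓ
  have hsm : Measurable (condMean (P 0) (getWZs ∅) ℓ) := measurable_condMean hℓ
  -- `Z_∅` has no coordinates, so `W` determines `(W, Z_∅)`; the witness `r` fills the empty tuple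
  -- vacuously.
  have h0 : ∀ᵐ o ∂(P 0), condMean (P 0) (getWZs ∅) ℓ (getWZs ∅ o)
      = condMean (P 0) getW ℓ (getW o) :=
    condMean_comp_ae_eq_of_leftInverse (q := Prod.fst)
      (r := fun w => (w, fun i => absurd i.2 (Finset.notMem_empty _)))
      (measurable_getWZs ∅) (hℓ2.integrable one_le_two) measurable_fst
      (measurable_id.prodMk (measurable_pi_lambda _ fun i => absurd i.2 (Finset.notMem_empty _)))
      (fun o => Prod.ext rfl (funext fun i => absurd i.2 (Finset.notMem_empty _)))
  have h1 : ∀ᵐ o ∂(P 1), condMean (P 0) (getWZs ∅) ℓ (getWZs ∅ o)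
      = condMean (P 0) getW ℓ (getW o) :=
    (isDominated_getWZs hdom ∅).ae_of_ae (measurable_getWZs ∅)
      (p := fun v => condMean (P 0) (getWZs ∅) ℓ v = condMean (P 0) getW ℓ v.1)
      (measurableSet_eq_fun hsm (hWm.comp measurable_fst)) h0
  have hint : Integrable (fun o => condMean (P 0) (getWZs ∅) ℓ (getWZs ∅ o)) (P 1) :=
    ((isDominated_getWZs hdom ∅).memLp (measurable_getWZs ∅) hsm
      (memLp_condMean_comp (measurable_getWZs ∅) hℓ2)).integrable one_le_two
  have hint' : Integrable (fun o => condMean (P 0) getW ℓ (getW o)) (P 1) := hint.congr h1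
  -- `μ_{·00}(W)` is a function of `W`, so taking its target mean given `W` leaves it unchanged.
  have h2 : ∀ᵐ o ∂(P 1), (trueNuisance P ℓ).muPart ∅ (getW o) = condMean (P 0) getW ℓ (getW o) :=
    ((condMean_comp_ae_eq measurable_getW hint).symm.trans (condExp_congr_ae h1)).trans
      ((condMean_comp_ae_eq measurable_getW hint').trans
        (condMean_comp_self_ae_eq measurable_getW hWm hint'))
  rw [vNum_eq, vDen]
  refine integral_congr_ae ?_
  filter_upwards [h2] with o ho
  rw [contrast, gapFull, ho]
  ring

end EmptySubset

/-! ### Asymptotic equivalence of the estimated numerator and its oracle version. -/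

section Expansion

variable {m₁ m₂ : ℕ} {𝒴 : Type*} [MeasurableSpace 𝒴]
  {Ω : ℕ → Type*} [∀ k, MeasurableSpace (Ω k)] {μ : (k : ℕ) → Measure (Ω k)}
  {P : Fin 2 → Measure (Obs m₁ m₂ 𝒴)} {ℓ : Obs m₁ m₂ 𝒴 → ℝ} {s : Finset (Fin m₂)} {C : ℝ}
  {𝒯 : ℕ → Type*} [∀ k, MeasurableSpace (𝒯 k)] {ηhat : (k : ℕ) → 𝒯 k → Nuisance m₁ m₂}

lemma measurable_targetTerm {τ : Type*} [MeasurableSpace τ] {η : τ → Nuisance m₁ m₂}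
    (h1 : Measurable fun p : τ × (Fin m₁ → ℝ) => (η p.1).muPart s p.2)
    (h2 : Measurable fun p : τ × (Fin m₁ → ℝ) => (η p.1).muTarget p.2)
    (h3 : Measurable fun p : τ × ((Fin m₁ → ℝ) × (s → ℝ)) => (η p.1).muSub s p.2)
    (h4 : Measurable fun p : τ × ((Fin m₁ → ℝ) × (Fin m₂ → ℝ)) => (η p.1).muFull p.2) :
    Measurable fun p : τ × Obs m₁ m₂ 𝒴 => targetTerm (η p.1) s p.2 := by
  have hW : Measurable fun p : τ × Obs m₁ m₂ 𝒴 => getW p.2 := measurable_getW.comp measurable_snd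
  have hWs : Measurable fun p : τ × Obs m₁ m₂ 𝒴 => getWZs s p.2 :=
    (measurable_getWZs s).comp measurable_snd
  have hWZ : Measurable fun p : τ × Obs m₁ m₂ 𝒴 => getWZ p.2 := measurable_getWZ.comp measurable_snd
  have h1' := h1.comp (measurable_fst.prodMk hW)
  have h2' := h2.comp (measurable_fst.prodMk hW)
  have h3' := h3.comp (measurable_fst.prodMk hWs)
  have h4' := h4.comp (measurable_fst.prodMk hWZ)
  simp only [Function.comp_def] at h1' h2' h3' h4'
  unfold targetTerm
  fun_prop

lemma measurable_sourceTerm {τ : Type*} [MeasurableSpace τ] {η : τ → Nuisance m₁ m₂}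
    (hℓ : Measurable ℓ)
    (h1 : Measurable fun p : τ × (Fin m₁ → ℝ) => (η p.1).muPart s p.2)
    (h2 : Measurable fun p : τ × (Fin m₁ → ℝ) => (η p.1).muTarget p.2)
    (h3 : Measurable fun p : τ × ((Fin m₁ → ℝ) × (s → ℝ)) => (η p.1).muSub s p.2)
    (h4 : Measurable fun p : τ × ((Fin m₁ → ℝ) × (Fin m₂ → ℝ)) => (η p.1).muFull p.2)
    (h5 : Measurable fun p : τ × ((Fin m₁ → ℝ) × (s → ℝ)) => (η p.1).piSub s p.2)
    (h6 : Measurable fun p : τ × ((Fin m₁ → ℝ) × (Fin m₂ → ℝ)) => (η p.1).piFull p.2) :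
    Measurable fun p : τ × Obs m₁ m₂ 𝒴 => sourceTerm ℓ (η p.1) s p.2 := by
  have hW : Measurable fun p : τ × Obs m₁ m₂ 𝒴 => getW p.2 := measurable_getW.comp measurable_snd
  have hWs : Measurable fun p : τ × Obs m₁ m₂ 𝒴 => getWZs s p.2 :=
    (measurable_getWZs s).comp measurable_snd
  have hWZ : Measurable fun p : τ × Obs m₁ m₂ 𝒴 => getWZ p.2 := measurable_getWZ.comp measurable_snd
  have h1' := h1.comp (measurable_fst.prodMk hW)
  have h2' := h2.comp (measurable_fst.prodMk hW)
  have h3' := h3.comp (measurable_fst.prodMk hWs)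
  have h4' := h4.comp (measurable_fst.prodMk hWZ)
  have h5' := h5.comp (measurable_fst.prodMk hWs)
  have h6' := h6.comp (measurable_fst.prodMk hWZ)
  simp only [Function.comp_def] at h1' h2' h3' h4' h5' h6'
  unfold sourceTerm
  fun_prop

variable [StandardBorelSpace 𝒴] [Nonempty 𝒴] [∀ d, IsProbabilityMeasure (P d)]

lemma measurable_targetTerm_trueNuisance (hℓ : Measurable ℓ) :
    Measurable (targetTerm (trueNuisance P ℓ) s : Obs m₁ m₂ 𝒴 → ℝ) := by
  have hsub : Measurable ((trueNuisance P ℓ).muSub s) := measurable_condMean hℓ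
  have hfull : Measurable (trueNuisance P ℓ).muFull := measurable_condMean hℓ
  have hpart : Measurable ((trueNuisance P ℓ).muPart s) :=
    measurable_condMean (hsub.comp (measurable_getWZs s))
  have htgt : Measurable (trueNuisance P ℓ).muTarget :=
    measurable_condMean (hfull.comp measurable_getWZ)
  have h1 := hpart.comp (measurable_getW (𝒴 := 𝒴) (m₂ := m₂))
  have h2 := htgt.comp (measurable_getW (𝒴 := 𝒴) (m₂ := m₂))
  have h3 := hsub.comp (measurable_getWZs (m₁ := m₁) (𝒴 := 𝒴) s)
  have h4 := hfull.comp (measurable_getWZ (𝒴 := 𝒴))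
  simp only [Function.comp_def] at h1 h2 h3 h4
  unfold targetTerm
  fun_prop

lemma measurable_sourceTerm_trueNuisance (hℓ : Measurable ℓ) :
    Measurable (sourceTerm ℓ (trueNuisance P ℓ) s) := by
  have hsub : Measurable ((trueNuisance P ℓ).muSub s) := measurable_condMean hℓ
  have hfull : Measurable (trueNuisance P ℓ).muFull := measurable_condMean hℓ
  have hpart : Measurable ((trueNuisance P ℓ).muPart s) :=
    measurable_condMean (hsub.comp (measurable_getWZs s))
  have htgt : Measurable (trueNuisance P ℓ).muTarget :=
    measurable_condMean (hfull.comp measurable_getWZ)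
  have := measurable_sourceTerm (τ := Unit) (η := fun _ => trueNuisance P ℓ) (s := s) hℓ
    (hpart.comp measurable_snd) (htgt.comp measurable_snd)
    (hsub.comp measurable_snd) (hfull.comp measurable_snd)
    (measurable_densityRatio.comp measurable_snd) (measurable_densityRatio.comp measurable_snd)
  exact this.comp (measurable_const (a := ()) |>.prodMk measurable_id)

lemma eventually_rpow_le_one {N : ℕ → ℕ} (hN : Tendsto N atTop atTop) {x : ℝ} (hx : x ≤ 0) :
    ∀ᶠ k in atTop, (N k : ℝ) ^ x ≤ 1 := by
  filter_upwards [hN.eventually_ge_atTop 1] with k hk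
  exact Real.rpow_le_one_of_one_le_of_nonpos (by exact_mod_cast hk) hx

/-- The estimated contrast is consistent in mean square at the rate of its two components. -/
lemma NuisanceRates.contrast {N : ℕ → ℕ} {η : (k : ℕ) → Ω k → Nuisance m₁ m₂}
    (hrate : NuisanceRates μ P ℓ s N η)
    (hm1 : ∀ k ω, Measurable ((η k ω).muPart s)) (hℓ : Measurable ℓ) :
    IsLittleOP μ (fun k ω => ∫⁻ o,
      ‖contrast (η k ω) s (getW o) - contrast (trueNuisance P ℓ) s (getW o)‖ₑ ^ 2 ∂(P 1))
      (fun k => (N k : ℝ) ^ (-(1 / 2) : ℝ)) := by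
  have hpart : Measurable ((trueNuisance P ℓ).muPart s) :=
    measurable_condMean ((measurable_condMean hℓ).comp (measurable_getWZs s))
  refine (hrate.rate_part.lintegral_sq_sub (fun k ω => ?_) hrate.rate_target).mono
    (Eventually.of_forall fun k ω => le_of_eq ?_)
  · exact ((hm1 k ω).comp measurable_getW).sub (hpart.comp measurable_getW)
  · refine lintegral_congr fun o => ?_
    congr 2
    simp only [CondCovShift.contrast]
    ring

lemma Regular.exists_bound (hreg : Regular s ηhat) :
    ∃ B : ℝ, ∀ k t, (∀ w, |contrast (ηhat k t) s w| ≤ B) ∧ (∀ v, |(ηhat k t).piSub s v| ≤ B) ∧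
      ∀ v, |(ηhat k t).piFull v| ≤ B := by
  obtain ⟨C, hC⟩ := hreg.bdd
  refine ⟨max (C + C) C, fun k t => ⟨fun w => ?_, fun v => ?_, fun v => ?_⟩⟩
  · exact (abs_sub_le_add_of_abs_le ((hC k t).1 w) ((hC k t).2.1 w)).trans (le_max_left _ _)
  · exact ((hC k t).2.2.1 v).trans (le_max_right _ _)
  · exact ((hC k t).2.2.2 v).trans (le_max_right _ _)

lemma Regular.meas_contrast (hreg : Regular s ηhat) (k : ℕ) (t : 𝒯 k) :
    Measurable (contrast (ηhat k t) s) :=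
  ((hreg.meas_muPart k).comp measurable_prodMk_left).sub
    ((hreg.meas_muTarget k).comp measurable_prodMk_left)

/-- The true contrast inherits the uniform bound of its estimates. -/
lemma ae_abs_contrast_le [∀ k, IsProbabilityMeasure (μ k)] {T : (k : ℕ) → Ω k → 𝒯 k} {N : ℕ → ℕ}
    (hN : Tendsto N atTop atTop) (hreg : Regular s ηhat) (hℓ : Measurable ℓ)
    (hrate : NuisanceRates μ P ℓ s N fun k ω => ηhat k (T k ω)) {B : ℝ}
    (hB : ∀ k t w, |contrast (ηhat k t) s w| ≤ B) :
    ∀ᵐ o ∂(P 1), |contrast (trueNuisance P ℓ) s (getW o)| ≤ B := by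
  have hcons := (hrate.contrast (fun k ω => (hreg.meas_muPart k).comp measurable_prodMk_left)
    hℓ).rate_mono (eventually_rpow_le_one hN (by norm_num))
  exact IsLittleOP.ae_abs_le (F := fun k ω o => contrast (ηhat k (T k ω)) s (getW o))
    ((measurable_contrast_trueNuisance hℓ).comp measurable_getW) (fun k ω o => hB k _ _) hcons

/-- The one-step numerator estimator is equivalent to the average of the uncentred influence
function at the true nuisance parameters. -/
lemma numHat_sub_oracle [∀ k, IsProbabilityMeasure (μ k)]
    (hdom : IsDominated P getWZ C) (hC : 0 ≤ C) (hℓ : Measurable ℓ) (hℓ2 : MemLp ℓ 2 (P 0))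
    {T : (k : ℕ) → Ω k → 𝒯 k} (hT : ∀ k, Measurable (T k)) {n : ℕ → Fin 2 → ℕ}
    {X : (k : ℕ) → (d : Fin 2) → Fin (n k d) → Ω k → Obs m₁ m₂ 𝒴}
    (hlaw : ∀ k d i, HasLaw (X k d i) (P d) (μ k))
    (hindep : ∀ k d, iIndepFun (X k d) (μ k))
    (hsplit : ∀ k d, IndepFun (T k) (fun ω i => X k d i ω) (μ k))
    {N : ℕ → ℕ} (hN : Tendsto N atTop atTop) {r : Fin 2 → ℝ} (hr : ∀ d, 0 < r d)
    (hfrac : ∀ d, Tendsto (fun k => (n k d : ℝ) / (N k : ℝ)) atTop (𝓝 (r d)))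
    (hreg : Regular s ηhat)
    (hrate : NuisanceRates μ P ℓ s N fun k ω => ηhat k (T k ω)) :
    IsLittleOP μ (fun k ω => ‖numHat ℓ (ηhat k (T k ω)) s (fun d i => X k d i ω)
      - (empMean (fun i => X k 1 i ω) (targetTerm (trueNuisance P ℓ) s)
        + empMean (fun i => X k 0 i ω) (sourceTerm ℓ (trueNuisance P ℓ) s))‖ₑ)
      (fun k => (N k : ℝ) ^ (-(1 / 2) : ℝ)) := by
  obtain ⟨B, hB⟩ := hreg.exists_bound
  have hd := ae_abs_contrast_le hN hreg hℓ hrate (fun k t w => (hB k t).1 w)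
  have hdm : Measurable (contrast (trueNuisance P ℓ) s) := measurable_contrast_trueNuisance hℓ
  obtain ⟨hpop1, hpop2, hpop3, hpop4⟩ := numerator_population hdom hC hℓ hℓ2 hd
  have hdomS := isDominated_getWZs hdom s
  have hcm : ∀ k t, Measurable (contrast (ηhat k t) s) := hreg.meas_contrast
  have hsub : ∀ k t, Measurable ((ηhat k t).muSub s) := fun k t =>
    (hreg.meas_muSub k).comp measurable_prodMk_left
  have hfull : ∀ k t, Measurable (ηhat k t).muFull := fun k t =>
    (hreg.meas_muFull k).comp measurable_prodMk_left
  have hps : ∀ k t, Measurable ((ηhat k t).piSub s) := fun k t =>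
    (hreg.meas_piSub k).comp measurable_prodMk_left
  have hpf : ∀ k t, Measurable (ηhat k t).piFull := fun k t =>
    (hreg.meas_piFull k).comp measurable_prodMk_left
  have hsub0 : Measurable ((trueNuisance P ℓ).muSub s) := measurable_condMean hℓ
  have hfull0 : Measurable (trueNuisance P ℓ).muFull := measurable_condMean hℓ
  have hcrate := hrate.contrast (fun k ω => (hreg.meas_muPart k).comp measurable_prodMk_left) hℓ
  have hcons := hcrate.rate_mono (eventually_rpow_le_one hN (by norm_num))
  have hsubL2 : MemLp (fun o => (trueNuisance P ℓ).muSub s (getWZs s o)) 2 (P 0) :=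
    memLp_condMean_comp (measurable_getWZs s) hℓ2
  have hfullL2 : MemLp (fun o => (trueNuisance P ℓ).muFull (getWZ o)) 2 (P 0) :=
    memLp_condMean_comp measurable_getWZ hℓ2
  have hW : Measurable (getW : Obs m₁ m₂ 𝒴 → _) := measurable_getW
  have hWs : Measurable (getWZs s : Obs m₁ m₂ 𝒴 → _) := measurable_getWZs s
  have hWZ : Measurable (getWZ : Obs m₁ m₂ 𝒴 → _) := measurable_getWZ
  -- mean square consistency of the summands
  have htarget : IsLittleOP μ (fun k ω => ∫⁻ o, ‖targetTerm (ηhat k (T k ω)) s o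
      - targetTerm (trueNuisance P ℓ) s o‖ₑ ^ 2 ∂(P 1)) fun _ => 1 := by
    have a1 := isLittleOP_sq_sub_sq (F := fun k ω o => contrast (ηhat k (T k ω)) s (getW o))
      (fun k ω o => (hB k _).1 _) hd hcons
    have a2 := isLittleOP_target_arm (V := getWZs s) (q := Prod.fst) (μ := μ)
      (D := fun k ω => contrast (ηhat k (T k ω)) s) (M := fun k ω => (ηhat k (T k ω)).muSub s)
      hWs measurable_fst hdomS hC (fun k ω w => (hB k _).1 w) (fun k ω => hcm k _) hd hdm
      (fun k ω => hsub k _) hsub0 (hdomS.memLp hWs hsub0 hsubL2) hcons hrate.cons_muSub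
    have a3 := isLittleOP_target_arm (V := getWZ) (q := Prod.fst) (μ := μ)
      (D := fun k ω => contrast (ηhat k (T k ω)) s) (M := fun k ω => (ηhat k (T k ω)).muFull)
      hWZ measurable_fst hdom hC (fun k ω w => (hB k _).1 w) (fun k ω => hcm k _) hd hdm
      (fun k ω => hfull k _) hfull0 (hdom.memLp hWZ hfull0 hfullL2) hcons hrate.cons_muFull
    refine (((a1.lintegral_sq_const_mul (-1)).lintegral_sq_add (fun k ω => ?_)
      (a2.lintegral_sq_const_mul 2)).lintegral_sq_sub (fun k ω => ?_)
      (a3.lintegral_sq_const_mul 2)).mono (Eventually.of_forall fun k ω => le_of_eq ?_)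
    · have h1 := (hcm k (T k ω)).comp hW
      have h2 := hdm.comp hW
      simp only [Function.comp_def] at h1 h2
      fun_prop
    · have h1 := (hcm k (T k ω)).comp hW
      have h2 := hdm.comp hW
      have h3 := (hsub k (T k ω)).comp hWs
      have h4 := hsub0.comp hWs
      have h5 := (hcm k (T k ω)).comp (measurable_fst.comp hWs)
      have h6 := hdm.comp (measurable_fst.comp hWs)
      simp only [Function.comp_def] at h1 h2 h3 h4 h5 h6
      fun_prop
    · refine lintegral_congr fun o => ?_
      rw [targetTerm_eq, targetTerm_eq]
      congr 2
      change _ = -1 * (contrast (ηhat k (T k ω)) s (getW o) ^ 2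
          - contrast (trueNuisance P ℓ) s (getW o) ^ 2)
        + 2 * (contrast (ηhat k (T k ω)) s (getW o) * (ηhat k (T k ω)).muSub s (getWZs s o)
          - contrast (trueNuisance P ℓ) s (getW o) * (trueNuisance P ℓ).muSub s (getWZs s o))
        - 2 * (contrast (ηhat k (T k ω)) s (getW o) * (ηhat k (T k ω)).muFull (getWZ o)
          - contrast (trueNuisance P ℓ) s (getW o) * (trueNuisance P ℓ).muFull (getWZ o))
      ring
  have hsource : IsLittleOP μ (fun k ω => ∫⁻ o, ‖sourceTerm ℓ (ηhat k (T k ω)) s o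
      - sourceTerm ℓ (trueNuisance P ℓ) s o‖ₑ ^ 2 ∂(P 0)) fun _ => 1 := by
    have a2 := isLittleOP_source_arm (V := getWZs s) (q := Prod.fst) (μ := μ)
      (D := fun k ω => contrast (ηhat k (T k ω)) s) (M := fun k ω => (ηhat k (T k ω)).muSub s)
      (R := fun k ω => (ηhat k (T k ω)).piSub s)
      hWs measurable_fst hdomS hC (fun k ω w => (hB k _).1 w) (fun k ω => hcm k _) hd hdm
      (fun k ω => hsub k _) hsub0 hsubL2 (fun k ω v => (hB k _).2.1 v) (fun k ω => hps k _)
      hℓ hℓ2 hcons hrate.cons_muSub hrate.cons_piSub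
    have a3 := isLittleOP_source_arm (V := getWZ) (q := Prod.fst) (μ := μ)
      (D := fun k ω => contrast (ηhat k (T k ω)) s) (M := fun k ω => (ηhat k (T k ω)).muFull)
      (R := fun k ω => (ηhat k (T k ω)).piFull)
      hWZ measurable_fst hdom hC (fun k ω w => (hB k _).1 w) (fun k ω => hcm k _) hd hdm
      (fun k ω => hfull k _) hfull0 hfullL2 (fun k ω v => (hB k _).2.2 v) (fun k ω => hpf k _)
      hℓ hℓ2 hcons hrate.cons_muFull hrate.cons_piFull
    refine ((a2.lintegral_sq_const_mul 2).lintegral_sq_sub (fun k ω => ?_)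
      (a3.lintegral_sq_const_mul 2)).mono (Eventually.of_forall fun k ω => le_of_eq ?_)
    · have h3 := (hsub k (T k ω)).comp hWs
      have h4 := hsub0.comp hWs
      have h5 := (hcm k (T k ω)).comp (measurable_fst.comp hWs)
      have h6 := hdm.comp (measurable_fst.comp hWs)
      have h7 := (hps k (T k ω)).comp hWs
      have h8 := measurable_densityRatio_comp (P := P) hWs
      simp only [Function.comp_def] at h3 h4 h5 h6 h7 h8
      fun_prop
    · refine lintegral_congr fun o => ?_
      rw [sourceTerm_eq, sourceTerm_eq]
      congr 2
      change _ = 2 * (contrast (ηhat k (T k ω)) s (getW o)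
            * (ℓ o - (ηhat k (T k ω)).muSub s (getWZs s o)) * (ηhat k (T k ω)).piSub s (getWZs s o)
          - contrast (trueNuisance P ℓ) s (getW o)
            * (ℓ o - (trueNuisance P ℓ).muSub s (getWZs s o))
            * (trueNuisance P ℓ).piSub s (getWZs s o))
        - 2 * (contrast (ηhat k (T k ω)) s (getW o)
            * (ℓ o - (ηhat k (T k ω)).muFull (getWZ o)) * (ηhat k (T k ω)).piFull (getWZ o)
          - contrast (trueNuisance P ℓ) s (getW o)
            * (ℓ o - (trueNuisance P ℓ).muFull (getWZ o)) * (trueNuisance P ℓ).piFull (getWZ o))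
      ring
  -- the two empirical processes
  have hemp1 := IsLittleOP.empMean_sub_integral (c := fun _ => 1) hT (fun k i => hlaw k 1 i)
    (fun k => hindep k 1) (fun k => hsplit k 1) (hr 1) hN (hfrac 1)
    (g := fun k t o => targetTerm (ηhat k t) s o - targetTerm (trueNuisance P ℓ) s o)
    (fun k => (measurable_targetTerm (hreg.meas_muPart k) (hreg.meas_muTarget k)
      (hreg.meas_muSub k) (hreg.meas_muFull k)).sub
        ((measurable_targetTerm_trueNuisance hℓ).comp measurable_snd))
    (Eventually.of_forall fun _ => one_pos) (by simpa using htarget)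
  have hemp0 := IsLittleOP.empMean_sub_integral (c := fun _ => 1) hT (fun k i => hlaw k 0 i)
    (fun k => hindep k 0) (fun k => hsplit k 0) (hr 0) hN (hfrac 0)
    (g := fun k t o => sourceTerm ℓ (ηhat k t) s o - sourceTerm ℓ (trueNuisance P ℓ) s o)
    (fun k => (measurable_sourceTerm hℓ (hreg.meas_muPart k) (hreg.meas_muTarget k)
      (hreg.meas_muSub k) (hreg.meas_muFull k) (hreg.meas_piSub k) (hreg.meas_piFull k)).sub
        ((measurable_sourceTerm_trueNuisance hℓ).comp measurable_snd))
    (Eventually.of_forall fun _ => one_pos) (by simpa using hsource)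
  simp only [one_mul] at hemp1 hemp0
  -- the bias
  have hbias : IsLittleOP μ (fun k ω =>
      ‖∫ o, (targetTerm (ηhat k (T k ω)) s o - targetTerm (trueNuisance P ℓ) s o) ∂(P 1)
        + ∫ o, (sourceTerm ℓ (ηhat k (T k ω)) s o - sourceTerm ℓ (trueNuisance P ℓ) s o) ∂(P 0)‖ₑ)
      (fun k => (N k : ℝ) ^ (-(1 / 2) : ℝ)) := by
    have hB0 : 0 ≤ B := by
      obtain ⟨ω⟩ := (μ 0).nonempty_of_neZero
      exact (abs_nonneg _).trans ((hB 0 (T 0 ω)).1 0)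
    -- The bias bound needs finite mean square errors of the outcome models. This holds where the
    -- two errors sum to at most one, an event whose probability tends to one.
    refine ((hcrate.add (hrate.prod_sub.const_mul (c := 2 * B) (by positivity))).add
      (hrate.prod_full.const_mul (c := 2 * B) (by positivity))).mono_of_le_one
      (hrate.cons_muSub.add hrate.cons_muFull) (Eventually.of_forall fun k ω hω => ?_)
    obtain ⟨hi1, hi2, hle⟩ := enorm_numerator_bias_le hdom hC hℓ hℓ2 (hB k (T k ω)).1
      (hcm k _) (hsub k _) (hfull k _) (hps k _) (hpf k _) (hB k _).2.1 (hB k _).2.2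
      ((le_self_add.trans hω).trans_lt ENNReal.one_lt_top)
      ((le_add_self.trans hω).trans_lt ENNReal.one_lt_top)
    refine le_trans (le_of_eq ?_) hle
    rw [integral_sub hi1 (hpop1.integrable one_le_two),
      integral_sub hi2 (hpop3.integrable one_le_two), hpop2, hpop4]
    congr 1
    ring
  -- The two centred empirical processes plus the bias add up to the whole difference.
  refine ((hemp1.add hemp0).add hbias).mono (Eventually.of_forall fun k ω => ?_)
  refine le_trans (le_of_eq ?_) ((enorm_add_le _ _).trans (add_le_add (enorm_add_le _ _) le_rfl))
  congr 1
  simp only [numHat, empMean, Finset.sum_sub_distrib, sub_div]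
  ring

end Expansion

/-! ### Slutsky's lemma through characteristic functions. -/

section Slutsky

variable {Ω : ℕ → Type*} [∀ k, MeasurableSpace (Ω k)] {μ : (k : ℕ) → Measure (Ω k)}
  [∀ k, IsProbabilityMeasure (μ k)] {Ω' : Type*} [MeasurableSpace Ω'] {μ' : Measure Ω'}
  [IsProbabilityMeasure μ'] {Y Y' : (k : ℕ) → Ω k → ℝ} {Z : Ω' → ℝ}

/-- The map `x ↦ exp(i t x)` is `|t|`-Lipschitz and of modulus one: close values contribute at most
`|t| ε`, distant ones at most twice their probability. -/
lemma enorm_charFun_map_sub_le {α : Type*} [MeasurableSpace α] {ν : Measure α}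
    [IsProbabilityMeasure ν] {f g : α → ℝ} (hf : AEMeasurable f ν) (hg : AEMeasurable g ν)
    (t : ℝ) {ε : ℝ} (hε : 0 ≤ ε) :
    ‖charFun (ν.map f) t - charFun (ν.map g) t‖ₑ
      ≤ ENNReal.ofReal (|t| * ε) + 2 * ν {x | ENNReal.ofReal ε < ‖f x - g x‖ₑ} := by
  have hexp : ∀ x : ℝ, ‖Complex.exp (t * x * Complex.I)‖ = 1 := fun x => by
    rw [← Complex.ofReal_mul, Complex.norm_exp_ofReal_mul_I]
  have hcont : Continuous fun x : ℝ => Complex.exp (t * x * Complex.I) := by fun_prop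
  have hfi : Integrable (fun x => Complex.exp (t * f x * Complex.I)) ν :=
    Integrable.of_bound (hcont.measurable.comp_aemeasurable hf).aestronglyMeasurable 1
      (ae_of_all _ fun x => (hexp _).le)
  have hgi : Integrable (fun x => Complex.exp (t * g x * Complex.I)) ν :=
    Integrable.of_bound (hcont.measurable.comp_aemeasurable hg).aestronglyMeasurable 1
      (ae_of_all _ fun x => (hexp _).le)
  rw [charFun_apply_real, charFun_apply_real,
    integral_map hf hcont.aestronglyMeasurable, integral_map hg hcont.aestronglyMeasurable,
    ← integral_sub hfi hgi]
  refine (enorm_integral_le_lintegral_enorm _).trans ?_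
  have hS : NullMeasurableSet {x | ENNReal.ofReal ε < ‖f x - g x‖ₑ} ν :=
    nullMeasurableSet_lt aemeasurable_const (hf.sub hg).enorm
  calc ∫⁻ x, ‖Complex.exp (t * f x * Complex.I) - Complex.exp (t * g x * Complex.I)‖ₑ ∂ν
      ≤ ∫⁻ x, ENNReal.ofReal (|t| * ε)
          + 2 * {x | ENNReal.ofReal ε < ‖f x - g x‖ₑ}.indicator 1 x ∂ν := by
        refine lintegral_mono fun x => ?_
        by_cases hx : ENNReal.ofReal ε < ‖f x - g x‖ₑ
        · refine le_trans ?_ le_add_self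
          rw [Set.indicator_of_mem (by exact hx), Pi.one_apply, mul_one]
          refine enorm_sub_le.trans (le_of_eq ?_)
          rw [← ofReal_norm, ← ofReal_norm, hexp, hexp, ENNReal.ofReal_one]
          norm_num
        · refine le_trans ?_ le_self_add
          rw [← ofReal_norm]
          apply ENNReal.ofReal_le_ofReal
          have hle : |f x - g x| ≤ ε := by
            rwa [not_lt, Real.enorm_eq_ofReal_abs, ENNReal.ofReal_le_ofReal_iff hε] at hx
          have hfac : Complex.exp (t * f x * Complex.I) - Complex.exp (t * g x * Complex.I)
              = Complex.exp (t * g x * Complex.I)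
                * (Complex.exp (Complex.I * ((t * (f x - g x) : ℝ) : ℂ)) - 1) := by
            rw [mul_sub, mul_one, ← Complex.exp_add]
            congr 2
            push_cast
            ring
          rw [hfac, norm_mul, hexp, one_mul]
          refine (Real.norm_exp_I_mul_ofReal_sub_one_le).trans ?_
          rw [norm_mul]
          exact mul_le_mul_of_nonneg_left hle (abs_nonneg _)
    _ = _ := by
        rw [lintegral_add_left measurable_const, lintegral_const, measure_univ, mul_one,
          lintegral_const_mul' _ _ (by finiteness), lintegral_indicator_one₀ hS]

/-- Slutsky's lemma for random variables on varying probability spaces. -/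
lemma tendstoInDistribution_of_isLittleOP (h : TendstoInDistribution Y atTop Z μ μ')
    (hY' : ∀ k, AEMeasurable (Y' k) (μ k))
    (hd : IsLittleOP μ (fun k ω => ‖Y' k ω - Y k ω‖ₑ) fun _ => 1) :
    TendstoInDistribution Y' atTop Z μ μ' where
  forall_aemeasurable := hY'
  aemeasurable_limit := h.aemeasurable_limit
  tendsto := by
    have hY := h.forall_aemeasurable
    refine ProbabilityMeasure.tendsto_iff_tendsto_charFun.2 fun t => ?_
    change Tendsto (fun k => charFun ((μ k).map (Y' k)) t) atTop (𝓝 (charFun (μ'.map Z) t))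
    have hlim : Tendsto (fun k => charFun ((μ k).map (Y k)) t) atTop (𝓝 (charFun (μ'.map Z) t)) :=
      (ProbabilityMeasure.tendsto_iff_tendsto_charFun.1 h.tendsto) t
    have hdiff : Tendsto (fun k => charFun ((μ k).map (Y' k)) t - charFun ((μ k).map (Y k)) t)
        atTop (𝓝 0) := by
      rw [tendsto_zero_iff_norm_tendsto_zero]
      have : Tendsto (fun k => ‖charFun ((μ k).map (Y' k)) t - charFun ((μ k).map (Y k)) t‖ₑ)
          atTop (𝓝 0) := by
        rw [ENNReal.tendsto_nhds_zero]
        intro δ hδ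
        obtain ⟨δ', hδ'0, hδ'⟩ : ∃ δ' : ℝ, 0 < δ' ∧ ENNReal.ofReal δ' ≤ δ / 2 := by
          rcases eq_or_ne δ ∞ with rfl | hδt
          · exact ⟨1, one_pos, by simp [ENNReal.top_div]⟩
          · refine ⟨(δ / 2).toReal, ENNReal.toReal_pos (by simpa using hδ.ne') (by finiteness), ?_⟩
            rw [ENNReal.ofReal_toReal (by finiteness)]
        have hε : 0 < δ' / (|t| + 1) := by positivity
        have h2 := ENNReal.Tendsto.const_mul (a := 2) (hd _ hε) (Or.inr (by finiteness))
        rw [mul_zero] at h2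
        filter_upwards [(ENNReal.tendsto_nhds_zero.1 h2) (δ / 2) (by simpa using hδ.ne')] with k hk
        refine (enorm_charFun_map_sub_le (hY' k) (hY k) t hε.le).trans
          ((add_le_add ?_ (by simpa using hk)).trans (ENNReal.add_halves δ).le)
        refine (ENNReal.ofReal_le_ofReal ?_).trans hδ'
        rw [mul_div_left_comm]
        exact mul_le_of_le_one_right hδ'0.le ((div_le_one (by positivity)).2 (by linarith))
      have := (ENNReal.tendsto_toReal (by simp : (0 : ℝ≥0∞) ≠ ∞)).comp this
      simpa [Function.comp_def] using this
    simpa using hdiff.add hlim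

end Slutsky

/-! ### Central limit theorem for two independent samples. -/

section CentralLimit

/-- The central limit theorem in terms of characteristic functions, without normalization. -/
lemma tendsto_charFun_map_inv_sqrt_mul_pow {α : Type*} [MeasurableSpace α] {P : Measure α}
    [IsProbabilityMeasure P] {h : α → ℝ} (hh : MemLp h 2 P) (h0 : ∫ x, h x ∂P = 0) (t : ℝ) :
    Tendsto (fun n : ℕ => charFun (P.map h) ((√n)⁻¹ * t) ^ n) atTop
      (𝓝 (Complex.exp (-((∫ x, h x ^ 2 ∂P : ℝ) * t ^ 2) / 2))) := by
  have hm : AEMeasurable h P := hh.1.aemeasurable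
  set v : ℝ := ∫ x, h x ^ 2 ∂P with hv
  have hv0 : 0 ≤ v := integral_nonneg fun x => sq_nonneg _
  -- With zero variance `h` cannot be normalized, but it vanishes almost surely and both sides are
  -- one.
  rcases hv0.eq_or_lt with hvz | hvpos
  · have hz : h =ᵐ[P] fun _ => 0 := by
      have := (integral_eq_zero_iff_of_nonneg (fun x => sq_nonneg (h x)) hh.integrable_sq).1
        (hv.symm.trans hvz.symm)
      filter_upwards [this] with x hx
      simpa using hx
    rw [Measure.map_congr hz, ← hvz]
    simp
  · have hmean : P[fun x => h x / √v] = 0 := by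
      rw [integral_div, h0, zero_div]
    have hvar : P[(fun x => h x / √v) ^ 2] = 1 := by
      simp only [Pi.pow_apply, div_pow]
      rw [integral_div, Real.sq_sqrt hv0, ← hv, div_self hvpos.ne']
    -- The argument `√v * t` undoes the normalization of `h` by `√v`.
    have hlim := tendsto_charFun_inv_sqrt_mul_pow (hm.div_const (√v)) hmean hvar (√v * t)
    have hcongr : ∀ n : ℕ, charFun (P.map fun x => h x / √v) ((√n)⁻¹ * (√v * t))
        = charFun (P.map h) ((√n)⁻¹ * t) := fun n => by
      simp only [div_eq_inv_mul]
      rw [charFun_map_mul_comp hm]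
      congr 1
      have : √v ≠ 0 := (Real.sqrt_pos.2 hvpos).ne'
      field_simp
    simp only [hcongr] at hlim
    convert hlim using 3
    rw [← Complex.ofReal_pow (√v * t), mul_pow, Real.sq_sqrt hv0]
    push_cast
    ring

variable {Ω : ℕ → Type*} [∀ k, MeasurableSpace (Ω k)] {μ : (k : ℕ) → Measure (Ω k)}
  [∀ k, IsProbabilityMeasure (μ k)] {α : Type*} [MeasurableSpace α] {P : Fin 2 → Measure α}
  [∀ d, IsProbabilityMeasure (P d)]

/-- The central limit theorem for a weighted sum of two independent samples. -/
lemma tendstoInDistribution_two_samples {n : ℕ → Fin 2 → ℕ}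
    {X : (k : ℕ) → (d : Fin 2) → Fin (n k d) → Ω k → α}
    (hlaw : ∀ k d i, HasLaw (X k d i) (P d) (μ k))
    (hindep : ∀ k, iIndepFun (fun p : (Σ d : Fin 2, Fin (n k d)) => X k p.1 p.2) (μ k))
    (hn : ∀ d, Tendsto (fun k => n k d) atTop atTop) {h : Fin 2 → α → ℝ}
    (hm : ∀ d, Measurable (h d)) (hh : ∀ d, MemLp (h d) 2 (P d))
    (h0 : ∀ d, ∫ x, h d x ∂(P d) = 0) (c : Fin 2 → ℝ) :
    TendstoInDistribution
      (fun k ω => ∑ d, ∑ i, c d * (√(n k d))⁻¹ * h d (X k d i ω)) atTop (id : ℝ → ℝ) μ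
      (gaussianReal 0 (∑ d, c d ^ 2 * ∫ x, h d x ^ 2 ∂(P d)).toNNReal) where
  forall_aemeasurable k := by
    refine Finset.aemeasurable_fun_sum _ fun d _ => Finset.aemeasurable_fun_sum _ fun i _ => ?_
    exact ((hm d).comp_aemeasurable (hlaw k d i).aemeasurable).const_mul _
  tendsto := by
    refine ProbabilityMeasure.tendsto_iff_tendsto_charFun.2 fun t => ?_
    change Tendsto (fun k => charFun ((μ k).map _) t) atTop (𝓝 (charFun ((gaussianReal 0 _).map id) t))
    -- Independence over the pooled index factors the characteristic function, and each domain
    -- contributes the `n_d`-th power of a single one.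
    have hchar : ∀ k, charFun ((μ k).map fun ω => ∑ d, ∑ i, c d * (√(n k d))⁻¹ * h d (X k d i ω)) t
        = ∏ d, charFun ((P d).map (h d)) ((√(n k d))⁻¹ * (c d * t)) ^ (n k d) := by
      intro k
      have hsum : (fun ω => ∑ d, ∑ i, c d * (√(n k d))⁻¹ * h d (X k d i ω))
          = fun ω => ∑ p : (Σ d : Fin 2, Fin (n k d)),
            c p.1 * (√(n k p.1))⁻¹ * h p.1 (X k p.1 p.2 ω) := by
        ext ω
        rw [Fintype.sum_sigma]
      have hXm : ∀ p : (Σ d : Fin 2, Fin (n k d)),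
          AEMeasurable (fun ω => h p.1 (X k p.1 p.2 ω)) (μ k) := fun p =>
        (hm p.1).comp_aemeasurable (hlaw k p.1 p.2).aemeasurable
      have hind : iIndepFun (fun (p : (Σ d : Fin 2, Fin (n k d))) ω =>
          c p.1 * (√(n k p.1))⁻¹ * h p.1 (X k p.1 p.2 ω)) (μ k) :=
        (hindep k).comp (fun p x => c p.1 * (√(n k p.1))⁻¹ * h p.1 x)
          fun p => (hm p.1).const_mul _
      rw [hsum, hind.charFun_map_fun_sum_eq_prod fun p => (hXm p).const_mul _]
      rw [Finset.prod_apply, Fintype.prod_sigma]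
      refine Finset.prod_congr rfl fun d _ => ?_
      have hterm : ∀ i : Fin (n k d),
          charFun ((μ k).map fun ω => c d * (√(n k d))⁻¹ * h d (X k d i ω)) t
            = charFun ((P d).map (h d)) ((√(n k d))⁻¹ * (c d * t)) := fun i => by
        rw [charFun_map_mul_comp (hXm ⟨d, i⟩), ← (hlaw k d i).map_eq,
          AEMeasurable.map_map_of_aemeasurable (hm d).aemeasurable (hlaw k d i).aemeasurable]
        congr 1
        ring
      rw [Finset.prod_congr rfl fun i _ => hterm i]
      simp
    have hv0 : 0 ≤ ∑ d, c d ^ 2 * ∫ x, h d x ^ 2 ∂(P d) :=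
      Finset.sum_nonneg fun d _ => mul_nonneg (sq_nonneg _) (integral_nonneg fun x => sq_nonneg _)
    have hlim := tendsto_finsetProd (Finset.univ : Finset (Fin 2)) fun d _ =>
      (tendsto_charFun_map_inv_sqrt_mul_pow (hh d) (h0 d) (c d * t)).comp (hn d)
    simp only [Measure.map_id, charFun_gaussianReal, hchar]
    refine (congrArg (fun z => Tendsto _ atTop (𝓝 z)) ?_).mp hlim
    rw [← Complex.exp_sum, Real.coe_toNNReal _ hv0]
    congr 1
    push_cast
    simp only [Fin.sum_univ_two]
    ring

end CentralLimit

/-! ### Rates for fixed functions and the delta method. -/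

section Rates

variable {Ω : ℕ → Type*} [∀ k, MeasurableSpace (Ω k)] {μ : (k : ℕ) → Measure (Ω k)}

lemma IsLittleOP.seq_mul {f : (k : ℕ) → Ω k → ℝ} {a : ℕ → ℝ}
    (hf : IsLittleOP μ (fun k ω => ‖f k ω‖ₑ) a) {c : ℕ → ℝ} (hc : ∀ k, 0 ≤ c k) :
    IsLittleOP μ (fun k ω => ‖c k * f k ω‖ₑ) (fun k => c k * a k) := by
  refine of_subset_union (fun ε hε => ⟨ε, hε, 1, one_pos,
    Eventually.of_forall fun k ω hω => Or.inl ?_⟩) hf hf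
  by_contra! hR
  refine hω.not_ge ?_
  rw [show ε * (c k * a k) = c k * (ε * a k) by ring, ENNReal.ofReal_mul (hc k), enorm_mul,
    Real.enorm_of_nonneg (hc k)]
  exact mul_le_mul_right hR _

variable [∀ k, IsProbabilityMeasure (μ k)] {α : Type*} [MeasurableSpace α] {P : Measure α}
  [IsProbabilityMeasure P] {𝒯 : ℕ → Type*} [∀ k, MeasurableSpace (𝒯 k)]

/-- Averages of a fixed square-integrable function, scaled by a deterministic sequence. -/
lemma isLittleOP_mul_empMean_sub_integral {T : (k : ℕ) → Ω k → 𝒯 k} (hT : ∀ k, Measurable (T k))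
    {n N : ℕ → ℕ} {X : (k : ℕ) → Fin (n k) → Ω k → α} (hlaw : ∀ k i, HasLaw (X k i) P (μ k))
    (hindep : ∀ k, iIndepFun (X k) (μ k))
    (hsplit : ∀ k, IndepFun (T k) (fun ω i => X k i ω) (μ k))
    {r : ℝ} (hr : 0 < r) (hN : Tendsto N atTop atTop)
    (hfrac : Tendsto (fun k => (n k : ℝ) / (N k : ℝ)) atTop (𝓝 r))
    {h : α → ℝ} (hm : Measurable h) (hh : MemLp h 2 P) {c b : ℕ → ℝ}
    (hb : ∀ᶠ k in atTop, 0 < b k) (hcb : Tendsto (fun k => c k / b k) atTop (𝓝 0)) :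
    IsLittleOP μ (fun k ω => ‖c k * (empMean (fun i => X k i ω) h - ∫ x, h x ∂P)‖ₑ)
      (fun k => b k * (N k : ℝ) ^ (-(1 / 2) : ℝ)) := by
  have hfin := (memLp_two_iff_lintegral_enorm_sq hm.aestronglyMeasurable).1 hh
  -- The function `c k * h` is treated as an estimate that ignores its training data; its second
  -- moment is of smaller order than `b k ^ 2`.
  have hcons : IsLittleOP μ (fun k _ => ∫⁻ x, ‖c k * h x‖ₑ ^ 2 ∂P) fun k => b k ^ 2 := by
    have hrate : IsLittleOP μ
        (fun k _ => ENNReal.ofReal (c k ^ 2 * (∫⁻ x, ‖h x‖ₑ ^ 2 ∂P).toReal)) fun k => b k ^ 2 := by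
      refine IsLittleOP.of_tendsto fun ε hε => ?_
      have hlim := (hcb.pow 2).mul_const (∫⁻ x, ‖h x‖ₑ ^ 2 ∂P).toReal
      rw [zero_pow two_ne_zero, zero_mul] at hlim
      filter_upwards [hb, hlim.eventually (ge_mem_nhds hε)] with k hbk hk
      rwa [div_pow, div_mul_eq_mul_div, div_le_iff₀ (by positivity)] at hk
    refine hrate.mono (Eventually.of_forall fun k _ => le_of_eq ?_)
    rw [ENNReal.ofReal_mul (sq_nonneg _), ENNReal.ofReal_toReal hfin.ne,
      ← lintegral_const_mul' _ _ (by finiteness)]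
    refine lintegral_congr fun x => ?_
    rw [enorm_mul, mul_pow, enorm_sq_eq_ofReal (c k)]
  refine (IsLittleOP.empMean_sub_integral hT hlaw hindep hsplit hr hN hfrac
    (g := fun k _ x => c k * h x) (fun k => (hm.comp measurable_snd).const_mul _) hb hcons).mono
    (Eventually.of_forall fun k ω => le_of_eq ?_)
  rw [integral_const_mul, empMean, empMean, ← Finset.mul_sum]
  congr 1
  ring

/-- The remainder is exactly the linear term times `(v - y) / y`, and `y ≥ v / 2` keeps the
denominator away from zero. -/
lemma abs_ratio_sub_linear_le {x y u v : ℝ} (hv : 0 < v) (hy : |y - v| ≤ v / 2) :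
    |x / y - u / v - (1 / v * (x - u) - u / v ^ 2 * (y - v))|
      ≤ 2 / v * (|1 / v * (x - u) - u / v ^ 2 * (y - v)| * |y - v|) := by
  have hyv : v / 2 ≤ y := by linarith [(abs_le.1 hy).1]
  have hy0 : 0 < y := by linarith
  have hid : x / y - u / v - (1 / v * (x - u) - u / v ^ 2 * (y - v))
      = (1 / v * (x - u) - u / v ^ 2 * (y - v)) * (v - y) / y := by
    field_simp
    ring
  rw [hid, abs_div, abs_mul, abs_of_pos hy0, abs_sub_comm v y, div_le_iff₀ hy0]
  have h1 : 1 ≤ 2 / v * y := by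
    rw [div_mul_eq_mul_div, le_div_iff₀ hv]
    linarith
  have h2 : 0 ≤ |1 / v * (x - u) - u / v ^ 2 * (y - v)| * |y - v| := by positivity
  nlinarith [mul_le_mul_of_nonneg_left h1 h2]

end Rates

/-! ### Integrals under the mixture of the two domains. -/

section JointLaw

variable {m₁ m₂ : ℕ} {𝒴 : Type*} [MeasurableSpace 𝒴] {P : Fin 2 → Measure (Obs m₁ m₂ 𝒴)} {ρ : ℝ}

lemma lintegral_jointLaw {f : Fin 2 × Obs m₁ m₂ 𝒴 → ℝ≥0∞} (hf : Measurable f) :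
    ∫⁻ q, f q ∂(jointLaw P ρ) = ENNReal.ofReal (1 - ρ) * ∫⁻ o, f (0, o) ∂(P 0)
      + ENNReal.ofReal ρ * ∫⁻ o, f (1, o) ∂(P 1) := by
  rw [jointLaw, lintegral_add_measure, lintegral_smul_measure, lintegral_smul_measure,
    lintegral_map hf measurable_prodMk_left, lintegral_map hf measurable_prodMk_left]
  rfl

lemma integral_jointLaw (hρ0 : 0 ≤ ρ) (hρ1 : ρ ≤ 1) {f : Fin 2 × Obs m₁ m₂ 𝒴 → ℝ}
    (hf : Measurable f) (hi : ∀ d, Integrable (fun o => f (d, o)) (P d)) :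
    ∫ q, f q ∂(jointLaw P ρ)
      = (1 - ρ) * ∫ o, f (0, o) ∂(P 0) + ρ * ∫ o, f (1, o) ∂(P 1) := by
  have hi' : ∀ d : Fin 2, Integrable f ((P d).map fun o => (d, o)) := fun d =>
    (integrable_map_measure hf.aestronglyMeasurable measurable_prodMk_left.aemeasurable).2 (hi d)
  rw [jointLaw, integral_add_measure ((hi' 0).smul_measure (by simp))
    ((hi' 1).smul_measure (by simp)), integral_smul_measure, integral_smul_measure,
    integral_map measurable_prodMk_left.aemeasurable hf.aestronglyMeasurable,
    integral_map measurable_prodMk_left.aemeasurable hf.aestronglyMeasurable,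
    ENNReal.toReal_ofReal (by linarith), ENNReal.toReal_ofReal hρ0, smul_eq_mul, smul_eq_mul]

lemma memLp_two_jointLaw {f : Fin 2 × Obs m₁ m₂ 𝒴 → ℝ} (hf : Measurable f)
    (hi : ∀ d, MemLp (fun o => f (d, o)) 2 (P d)) : MemLp f 2 (jointLaw P ρ) := by
  have hfin : ∀ d, ∫⁻ o, ‖f (d, o)‖ₑ ^ 2 ∂(P d) < ∞ := fun d =>
    (memLp_two_iff_lintegral_enorm_sq (hi d).1).1 (hi d)
  rw [memLp_two_iff_lintegral_enorm_sq hf.aestronglyMeasurable,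
    lintegral_jointLaw (f := fun q => ‖f q‖ₑ ^ 2) (by fun_prop)]
  exact ENNReal.add_lt_top.2 ⟨ENNReal.mul_lt_top (by simp) (hfin 0),
    ENNReal.mul_lt_top (by simp) (hfin 1)⟩

end JointLaw

/-! ### The influence function within each domain. -/

section InfluenceFunction

variable {m₁ m₂ : ℕ} {𝒴 : Type*} [MeasurableSpace 𝒴] [StandardBorelSpace 𝒴] [Nonempty 𝒴]
  {P : Fin 2 → Measure (Obs m₁ m₂ 𝒴)} [∀ d, IsProbabilityMeasure (P d)]
  {ℓ : Obs m₁ m₂ 𝒴 → ℝ} {ρ : ℝ} {s : Finset (Fin m₂)}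

/-- The centring constants of the two numerators cancel in the influence function of the ratio. -/
lemma psi_source (hden : vDen P ℓ ≠ 0) (hempty : vNum P ℓ ∅ = vDen P ℓ) (o : Obs m₁ m₂ 𝒴) :
    psi P ℓ ρ s (0, o) = (1 / vDen P ℓ * sourceTerm ℓ (trueNuisance P ℓ) s o
      - vNum P ℓ s / vDen P ℓ ^ 2 * sourceTerm ℓ (trueNuisance P ℓ) ∅ o) / (1 - ρ) := by
  simp only [psi, psiNum, hempty]
  simp
  field_simp
  ring

lemma psi_target (hden : vDen P ℓ ≠ 0) (hempty : vNum P ℓ ∅ = vDen P ℓ) (o : Obs m₁ m₂ 𝒴) :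
    psi P ℓ ρ s (1, o) = (1 / vDen P ℓ * targetTerm (trueNuisance P ℓ) s o
      - vNum P ℓ s / vDen P ℓ ^ 2 * targetTerm (trueNuisance P ℓ) ∅ o) / ρ := by
  simp only [psi, psiNum, hempty]
  simp
  field_simp
  ring

lemma measurable_psi (hℓ : Measurable ℓ) : Measurable (psi P ℓ ρ s) := by
  have ht : ∀ r, Measurable fun q : Fin 2 × Obs m₁ m₂ 𝒴 => targetTerm (trueNuisance P ℓ) r q.2 :=
    fun r => (measurable_targetTerm_trueNuisance hℓ).comp measurable_snd
  have hs : ∀ r, Measurable fun q : Fin 2 × Obs m₁ m₂ 𝒴 => sourceTerm ℓ (trueNuisance P ℓ) r q.2 :=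
    fun r => (measurable_sourceTerm_trueNuisance hℓ).comp measurable_snd
  have hi : ∀ d : Fin 2, Measurable fun q : Fin 2 × Obs m₁ m₂ 𝒴 =>
      (if q.1 = d then (1 : ℝ) else 0) := fun d =>
    (measurable_of_finite fun e : Fin 2 => if e = d then (1 : ℝ) else 0).comp measurable_fst
  have hnum : ∀ r, Measurable (psiNum P ℓ ρ r) := fun r =>
    ((((ht r).mul (hi 1)).div_const ρ).add (((hs r).mul (hi 0)).div_const (1 - ρ))).sub_const _
  exact ((hnum s).const_mul _).sub ((hnum ∅).const_mul _)

end InfluenceFunction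

lemma mul_inv_sqrt_eq_sqrt_div (n : ℕ) (x : ℝ) : (√(n : ℝ))⁻¹ * x = √(n : ℝ) * (x / n) := by
  rcases Nat.eq_zero_or_pos n with rfl | hn
  · simp
  · have : (0 : ℝ) < n := by exact_mod_cast hn
    have h2 : √(n : ℝ) ≠ 0 := (Real.sqrt_pos.2 this).ne'
    field_simp
    rw [Real.sq_sqrt this.le, mul_comm]

lemma pooledMean_eq {m₁ m₂ : ℕ} {𝒴 : Type*} {n : Fin 2 → ℕ} (x : (d : Fin 2) → Fin (n d) → Obs m₁ m₂ 𝒴)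
    (g : Fin 2 × Obs m₁ m₂ 𝒴 → ℝ) :
    pooledMean x g
      = ∑ d, (n d : ℝ) / ((n 0 + n 1 : ℕ) : ℝ) * empMean (x d) (fun o => g (d, o)) := by
  rw [pooledMean, Finset.sum_div]
  refine Finset.sum_congr rfl fun d _ => ?_
  rw [empMean]
  rcases Nat.eq_zero_or_pos (n d) with h | h
  · have hemp : IsEmpty (Fin (n d)) := by rw [h]; infer_instance
    simp [h]
  · have : (n d : ℝ) ≠ 0 := by exact_mod_cast h.ne'
    field_simp

/-- The estimated numerator is measurable. -/
lemma aemeasurable_numHat {m₁ m₂ : ℕ} {𝒴 : Type*} [MeasurableSpace 𝒴]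
    {P : Fin 2 → Measure (Obs m₁ m₂ 𝒴)} {Ω : ℕ → Type*} [∀ k, MeasurableSpace (Ω k)]
    {μ : (k : ℕ) → Measure (Ω k)} {𝒯 : ℕ → Type*} [∀ k, MeasurableSpace (𝒯 k)]
    {ℓ : Obs m₁ m₂ 𝒴 → ℝ} (hℓ : Measurable ℓ)
    {T : (k : ℕ) → Ω k → 𝒯 k} (hT : ∀ k, Measurable (T k)) {n : ℕ → Fin 2 → ℕ}
    {X : (k : ℕ) → (d : Fin 2) → Fin (n k d) → Ω k → Obs m₁ m₂ 𝒴}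
    (hlaw : ∀ k d i, HasLaw (X k d i) (P d) (μ k)) {ηhat : (k : ℕ) → 𝒯 k → Nuisance m₁ m₂}
    {s : Finset (Fin m₂)} (hreg : Regular s ηhat) (k : ℕ) :
    AEMeasurable (fun ω => numHat ℓ (ηhat k (T k ω)) s fun d i => X k d i ω) (μ k) := by
  have ht := measurable_targetTerm (𝒴 := 𝒴) (hreg.meas_muPart k) (hreg.meas_muTarget k)
    (hreg.meas_muSub k) (hreg.meas_muFull k)
  have hs := measurable_sourceTerm hℓ (hreg.meas_muPart k) (hreg.meas_muTarget k)
    (hreg.meas_muSub k) (hreg.meas_muFull k) (hreg.meas_piSub k) (hreg.meas_piFull k)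
  have h1 : AEMeasurable (fun ω => empMean (fun i => X k 1 i ω) (targetTerm (ηhat k (T k ω)) s))
      (μ k) :=
    AEMeasurable.div_const (Finset.aemeasurable_fun_sum _ fun i _ =>
      ht.comp_aemeasurable ((hT k).aemeasurable.prodMk (hlaw k 1 i).aemeasurable)) _
  have h0 : AEMeasurable (fun ω => empMean (fun i => X k 0 i ω) (sourceTerm ℓ (ηhat k (T k ω)) s))
      (μ k) :=
    AEMeasurable.div_const (Finset.aemeasurable_fun_sum _ fun i _ =>
      hs.comp_aemeasurable ((hT k).aemeasurable.prodMk (hlaw k 0 i).aemeasurable)) _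
  exact h1.add h0

/-! ### Central limit theorem for the pooled sample. -/

section PooledSample

variable {m₁ m₂ : ℕ} {𝒴 : Type*} [MeasurableSpace 𝒴] {P : Fin 2 → Measure (Obs m₁ m₂ 𝒴)}
  [∀ d, IsProbabilityMeasure (P d)] {Ω : ℕ → Type*} [∀ k, MeasurableSpace (Ω k)]
  {μ : (k : ℕ) → Measure (Ω k)} [∀ k, IsProbabilityMeasure (μ k)]
  {𝒯 : ℕ → Type*} [∀ k, MeasurableSpace (𝒯 k)]

/-- The central limit theorem for the average over the pooled sample of a function that is centred
in both domains. -/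
lemma tendstoInDistribution_sqrt_mul_pooledMean {T : (k : ℕ) → Ω k → 𝒯 k}
    (hT : ∀ k, Measurable (T k)) {n : ℕ → Fin 2 → ℕ}
    {X : (k : ℕ) → (d : Fin 2) → Fin (n k d) → Ω k → Obs m₁ m₂ 𝒴}
    (hlaw : ∀ k d i, HasLaw (X k d i) (P d) (μ k))
    (hindep : ∀ k, iIndepFun (fun p : (Σ d : Fin 2, Fin (n k d)) => X k p.1 p.2) (μ k))
    (hindep' : ∀ k d, iIndepFun (X k d) (μ k))
    (hsplit : ∀ k d, IndepFun (T k) (fun ω i => X k d i ω) (μ k))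
    (hN : Tendsto (fun k => n k 0 + n k 1) atTop atTop) {r : Fin 2 → ℝ} (hr : ∀ d, 0 < r d)
    (hfrac : ∀ d, Tendsto (fun k => (n k d : ℝ) / ((n k 0 + n k 1 : ℕ) : ℝ)) atTop (𝓝 (r d)))
    {g : Fin 2 × Obs m₁ m₂ 𝒴 → ℝ} (hgm : Measurable g)
    (hg : ∀ d, MemLp (fun o => g (d, o)) 2 (P d)) (hg0 : ∀ d, ∫ o, g (d, o) ∂(P d) = 0)
    {σ : ℝ} (hσ : σ ^ 2 = 1) :
    TendstoInDistribution
      (fun k ω => √((n k 0 + n k 1 : ℕ) : ℝ) * (σ * pooledMean (fun d i => X k d i ω) g))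
      atTop (id : ℝ → ℝ) μ
      (gaussianReal 0 (∑ d, r d * ∫ o, g (d, o) ^ 2 ∂(P d)).toNNReal) := by
  have hgd : ∀ d, Measurable fun o => g (d, o) := fun d => hgm.comp measurable_prodMk_left
  have hNr : Tendsto (fun k => ((n k 0 + n k 1 : ℕ) : ℝ)) atTop atTop :=
    tendsto_natCast_atTop_atTop.comp hN
  have hn : ∀ d, Tendsto (fun k => n k d) atTop atTop := fun d => by
    rw [← tendsto_natCast_atTop_iff (R := ℝ)]
    refine ((hfrac d).pos_mul_atTop (hr d) hNr).congr' ?_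
    filter_upwards [hN.eventually_gt_atTop 0] with k hk
    have : ((n k 0 + n k 1 : ℕ) : ℝ) ≠ 0 := by exact_mod_cast hk.ne'
    field_simp
  -- To first order `√N · n_d / N` is `√(r_d) √(n_d)`, so domain `d` enters its normalized sum with
  -- weight `σ √(r_d)` and adds `r_d E_d[g²]` to the variance.
  have hclt := tendstoInDistribution_two_samples hlaw hindep hn hgd hg hg0 fun d => σ * √(r d)
  simp only [mul_pow, hσ, one_mul, fun d => Real.sq_sqrt (hr d).le] at hclt
  have hdiff : ∀ d, IsLittleOP μ (fun k ω =>
      ‖(σ * (√((n k 0 + n k 1 : ℕ) : ℝ) * ((n k d : ℝ) / ((n k 0 + n k 1 : ℕ) : ℝ))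
          - √(r d) * √(n k d : ℝ)))
        * (empMean (fun i => X k d i ω) (fun o => g (d, o)) - ∫ o, g (d, o) ∂(P d))‖ₑ)
      (fun _ => 1) := fun d => by
    refine (isLittleOP_mul_empMean_sub_integral hT (fun k i => hlaw k d i)
      (fun k => hindep' k d) (fun k => hsplit k d) (hr d) hN (hfrac d) (hgd d) (hg d)
      (b := fun k => √((n k 0 + n k 1 : ℕ) : ℝ)) ?_ ?_).rate_mono ?_
    · filter_upwards [hN.eventually_gt_atTop 0] with k hk
      exact Real.sqrt_pos.2 (by exact_mod_cast hk)
    · have hlim := ((hfrac d).sub (((hfrac d).sqrt).const_mul (√(r d)))).const_mul σ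
      rw [Real.mul_self_sqrt (hr d).le, sub_self, mul_zero] at hlim
      refine hlim.congr' ?_
      filter_upwards [hN.eventually_gt_atTop 0] with k hk
      have hpos : (0 : ℝ) < ((n k 0 + n k 1 : ℕ) : ℝ) := by exact_mod_cast hk
      have hsq : √((n k 0 + n k 1 : ℕ) : ℝ) ≠ 0 := (Real.sqrt_pos.2 hpos).ne'
      rw [Real.sqrt_div (by positivity)]
      field_simp
    · filter_upwards [hN.eventually_gt_atTop 0] with k hk
      have hpos : (0 : ℝ) < ((n k 0 + n k 1 : ℕ) : ℝ) := by exact_mod_cast hk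
      rw [Real.sqrt_eq_rpow, ← Real.rpow_add hpos]
      norm_num
  refine tendstoInDistribution_of_isLittleOP hclt (fun k => ?_)
    (((hdiff 0).add_real (hdiff 1)).mono (Eventually.of_forall fun k ω => le_of_eq ?_))
  · refine AEMeasurable.const_mul (AEMeasurable.const_mul (AEMeasurable.div_const ?_ _) _) _
    refine Finset.aemeasurable_fun_sum _ fun d _ => Finset.aemeasurable_fun_sum _ fun i _ => ?_
    exact (hgd d).comp_aemeasurable (hlaw k d i).aemeasurable
  · have hterm : ∀ d, ∑ i, σ * √(r d) * (√(n k d : ℝ))⁻¹ * g (d, X k d i ω)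
        = σ * √(r d) * √(n k d : ℝ) * empMean (fun i => X k d i ω) (fun o => g (d, o)) := fun d => by
      rw [← Finset.mul_sum, mul_assoc (σ * √(r d)), mul_inv_sqrt_eq_sqrt_div, ← mul_assoc]
      rfl
    rw [pooledMean_eq, Finset.sum_congr rfl fun d _ => hterm d]
    simp only [Fin.sum_univ_two, hg0]
    congr 1
    ring

end PooledSample

end CondCovShift

/-! ### Delta method and conclusion. -/

open CondCovShift
theorem theorem3 {m₁ m₂ : ℕ} {𝒴 : Type*} [MeasurableSpace 𝒴] [StandardBorelSpace 𝒴] [Nonempty 𝒴]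
    -- source law `P 0` and target law `P 1` of `(W, Z, Y)`, and the loss
    (P : Fin 2 → Measure (Obs m₁ m₂ 𝒴)) [∀ d, IsProbabilityMeasure (P d)]
    (ℓ : Obs m₁ m₂ 𝒴 → ℝ) (hℓ : Measurable ℓ) (hℓ2 : MemLp ℓ 2 (P 0))
    -- positivity: the density ratio of `(W, Z)` is well-defined and bounded
    (hac : (P 1).map getWZ ≪ (P 0).map getWZ)
    (hbdd : ∃ C : ℝ, ∀ᵐ v ∂((P 0).map getWZ), densityRatio P getWZ v ≤ C)
    -- the `k`-th data set: training data `T k` and, independent of it, `n k d` IID evaluation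
    -- observations from each domain `d`
    {Ω : ℕ → Type*} [∀ k, MeasurableSpace (Ω k)] (μ : (k : ℕ) → Measure (Ω k))
    [∀ k, IsProbabilityMeasure (μ k)]
    {𝒯 : ℕ → Type*} [∀ k, MeasurableSpace (𝒯 k)]
    (T : (k : ℕ) → Ω k → 𝒯 k) (hT : ∀ k, Measurable (T k))
    (n : ℕ → Fin 2 → ℕ)
    (X : (k : ℕ) → (d : Fin 2) → Fin (n k d) → Ω k → Obs m₁ m₂ 𝒴)
    (hlaw : ∀ k d i, HasLaw (X k d i) (P d) (μ k))
    (hindep : ∀ k, iIndepFun (fun p : (Σ d : Fin 2, Fin (n k d)) => X k p.1 p.2) (μ k))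
    (hsplit : ∀ k, IndepFun (T k)
      (fun ω => fun p : (Σ d : Fin 2, Fin (n k d)) => X k p.1 p.2 ω) (μ k))
    -- the evaluation size tends to infinity, with a fraction `ρ` from the target domain
    (ρ : ℝ) (hρ0 : 0 < ρ) (hρ1 : ρ < 1)
    (hn : Tendsto (fun k => n k 0 + n k 1) atTop atTop)
    (hfrac : Tendsto (fun k => (n k 1 : ℝ) / ((n k 0 + n k 1 : ℕ) : ℝ)) atTop (𝓝 ρ))
    -- nuisance estimates computed from the training data
    (ηhat : (k : ℕ) → 𝒯 k → Nuisance m₁ m₂)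
    (s : Finset (Fin m₂))
    (hreg : Regular s ηhat) (hreg' : Regular ∅ ηhat)
    (hrate : NuisanceRates μ P ℓ s (fun k => n k 0 + n k 1) (fun k ω => ηhat k (T k ω)))
    (hrate' : NuisanceRates μ P ℓ ∅ (fun k => n k 0 + n k 1) (fun k ω => ηhat k (T k ω)))
    (hden : 0 < vDen P ℓ) :
    -- the influence function is square-integrable with mean zero
    MemLp (psi P ℓ ρ s) 2 (jointLaw P ρ) ∧
    ∫ q, psi P ℓ ρ s q ∂(jointLaw P ρ) = 0 ∧
    -- asymptotic linearity
    IsLittleOP μ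
      (fun k ω => ‖ratioHat ℓ (ηhat k (T k ω)) s (fun d i => X k d i ω)
        - vNum P ℓ s / vDen P ℓ - pooledMean (fun d i => X k d i ω) (psi P ℓ ρ s)‖ₑ)
      (fun k => ((n k 0 + n k 1 : ℕ) : ℝ) ^ (-(1 / 2) : ℝ)) ∧
    -- asymptotic normality of the ratio estimator
    TendstoInDistribution
      (fun k ω => √((n k 0 + n k 1 : ℕ) : ℝ) *
        (ratioHat ℓ (ηhat k (T k ω)) s (fun d i => X k d i ω) - vNum P ℓ s / vDen P ℓ))
      atTop (id : ℝ → ℝ) μ (gaussianReal 0 (Var[psi P ℓ ρ s; jointLaw P ρ]).toNNReal) ∧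
    -- the same for the value itself
    TendstoInDistribution
      (fun k ω => √((n k 0 + n k 1 : ℕ) : ℝ) *
        ((1 - ratioHat ℓ (ηhat k (T k ω)) s (fun d i => X k d i ω)) - value P ℓ s))
      atTop (id : ℝ → ℝ) μ (gaussianReal 0 (Var[psi P ℓ ρ s; jointLaw P ρ]).toNNReal) := by
  obtain ⟨C, hC0, hdom⟩ : ∃ C : ℝ, 0 ≤ C ∧ IsDominated P getWZ C := by
    obtain ⟨C, hC⟩ := hbdd
    exact ⟨|C|, abs_nonneg C, isDominated_of_densityRatio_le hac
      (hC.mono fun v hv => hv.trans (le_abs_self C))⟩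
  have hempty : vNum P ℓ ∅ = vDen P ℓ := vNum_empty hdom hℓ hℓ2
  have hden0 : vDen P ℓ ≠ 0 := hden.ne'
  set N : ℕ → ℕ := fun k => n k 0 + n k 1 with hNdef
  have hNpos : ∀ᶠ k in atTop, (0 : ℝ) < N k := by
    filter_upwards [hn.eventually_gt_atTop 0] with k hk
    exact_mod_cast hk
  set r : Fin 2 → ℝ := ![1 - ρ, ρ] with hrdef
  have hr : ∀ d, 0 < r d := by
    intro d
    fin_cases d
    · simpa [hrdef] using hρ1
    · simpa [hrdef] using hρ0
  have hfr : ∀ d, Tendsto (fun k => (n k d : ℝ) / (N k : ℝ)) atTop (𝓝 (r d)) := by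
    intro d
    fin_cases d
    · refine (hfrac.const_sub 1).congr' ?_
      filter_upwards [hNpos] with k hk
      have hsum : (N k : ℝ) = n k 0 + n k 1 := by simp [hNdef]
      rw [hsum] at hk
      simp only [hNdef, Nat.cast_add]
      rw [eq_div_iff hk.ne', sub_mul, div_mul_cancel₀ _ hk.ne']
      simp
    · exact hfrac
  have hindep' : ∀ k d, iIndepFun (X k d) (μ k) := fun k d =>
    (hindep k).precomp (g := fun i : Fin (n k d) => (⟨d, i⟩ : Σ d : Fin 2, Fin (n k d)))
      fun _ _ h => eq_of_heq (Sigma.mk.inj h).2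
  have hsplit' : ∀ k d, IndepFun (T k) (fun ω i => X k d i ω) (μ k) := fun k d =>
    (hsplit k).comp measurable_id
      (ψ := fun (x : (Σ d : Fin 2, Fin (n k d)) → Obs m₁ m₂ 𝒴) (i : Fin (n k d)) => x ⟨d, i⟩)
      (measurable_pi_lambda _ fun i => measurable_pi_apply _)
  obtain ⟨B, hB⟩ := hreg.exists_bound
  obtain ⟨B', hB'⟩ := hreg'.exists_bound
  obtain ⟨ht, htint, hs, hsint⟩ := numerator_population hdom hC0 hℓ hℓ2
    (ae_abs_contrast_le hn hreg hℓ hrate fun k t w => (hB k t).1 w)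
  obtain ⟨ht', htint', hs', hsint'⟩ := numerator_population hdom hC0 hℓ hℓ2
    (ae_abs_contrast_le hn hreg' hℓ hrate' fun k t w => (hB' k t).1 w)
  -- the influence function
  have hψm : Measurable (psi P ℓ ρ s) := measurable_psi hℓ
  have hψ0 : (fun o => psi P ℓ ρ s (0, o)) = fun o => _ :=
    funext fun o => psi_source (ρ := ρ) (s := s) hden0 hempty o
  have hψ1 : (fun o => psi P ℓ ρ s (1, o)) = fun o => _ :=
    funext fun o => psi_target (ρ := ρ) (s := s) hden0 hempty o
  have hψ2 : ∀ d, MemLp (fun o => psi P ℓ ρ s (d, o)) 2 (P d) := by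
    intro d
    fin_cases d
    · change MemLp (fun o => psi P ℓ ρ s (0, o)) 2 (P 0)
      rw [hψ0]
      simp only [div_eq_inv_mul _ (1 - ρ)]
      exact ((hs.const_mul _).sub (hs'.const_mul _)).const_mul _
    · change MemLp (fun o => psi P ℓ ρ s (1, o)) 2 (P 1)
      rw [hψ1]
      simp only [div_eq_inv_mul _ ρ]
      exact ((ht.const_mul _).sub (ht'.const_mul _)).const_mul _
  -- The mean vanishes in each domain, not only in the mixture: in the target it is proportional to
  -- `v_s / v - (v_s / v²) v`, where `v_s = v_Z^num(s)` and `v = v_Z^den`.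
  have hψmean : ∀ d, ∫ o, psi P ℓ ρ s (d, o) ∂(P d) = 0 := by
    intro d
    fin_cases d
    · change ∫ o, psi P ℓ ρ s (0, o) ∂(P 0) = 0
      rw [hψ0, integral_div, integral_sub ((hs.integrable one_le_two).const_mul _)
        ((hs'.integrable one_le_two).const_mul _), integral_const_mul, integral_const_mul, hsint,
        hsint']
      simp
    · change ∫ o, psi P ℓ ρ s (1, o) ∂(P 1) = 0
      rw [hψ1, integral_div, integral_sub ((ht.integrable one_le_two).const_mul _)
        ((ht'.integrable one_le_two).const_mul _), integral_const_mul, integral_const_mul, htint,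
        htint', hempty]
      field_simp
      simp
  have hmem : MemLp (psi P ℓ ρ s) 2 (jointLaw P ρ) := memLp_two_jointLaw hψm hψ2
  have hmean : ∫ q, psi P ℓ ρ s q ∂(jointLaw P ρ) = 0 := by
    rw [integral_jointLaw hρ0.le hρ1.le hψm fun d => (hψ2 d).integrable one_le_two, hψmean, hψmean]
    simp
  have hvar : Var[psi P ℓ ρ s; jointLaw P ρ] = ∑ d, r d * ∫ o, psi P ℓ ρ s (d, o) ^ 2 ∂(P d) := by
    rw [variance_of_integral_eq_zero hψm.aemeasurable hmean,
      integral_jointLaw hρ0.le hρ1.le (hψm.pow_const 2) fun d => (hψ2 d).integrable_sq,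
      Fin.sum_univ_two]
    simp [hrdef]
  -- the numerators
  have hE := numHat_sub_oracle hdom hC0 hℓ hℓ2 hT hlaw hindep' hsplit' hn hr hfr hreg hrate
  have hE' := numHat_sub_oracle hdom hC0 hℓ hℓ2 hT hlaw hindep' hsplit' hn hr hfr hreg' hrate'
  -- The rate `n^{-1/4}` is weaker than what holds, but the product of two such errors is
  -- `o_p(n^{-1/2})`, all that the delta method needs.
  have hquarter : ∀ (d : Fin 2) {h : Obs m₁ m₂ 𝒴 → ℝ}, Measurable h → MemLp h 2 (P d) →
      IsLittleOP μ (fun k ω => ‖empMean (fun i => X k d i ω) h - ∫ o, h o ∂(P d)‖ₑ)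
        (fun k => (N k : ℝ) ^ (-(1 / 4) : ℝ)) := by
    intro d h hm hh
    have h1 := isLittleOP_mul_empMean_sub_integral hT (fun k i => hlaw k d i)
      (fun k => hindep' k d) (fun k => hsplit' k d) (hr d) hn (hfr d) hm hh
      (c := fun _ => 1) (b := fun k => (N k : ℝ) ^ (1 / 4 : ℝ))
      (by filter_upwards [hNpos] with k hk; exact Real.rpow_pos_of_pos hk _)
      (by
        simp only [one_div]
        refine tendsto_inv_atTop_zero.comp ?_
        exact (tendsto_rpow_atTop (by norm_num)).comp (tendsto_natCast_atTop_atTop.comp hn))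
    refine (h1.rate_mono ?_).mono (Eventually.of_forall fun k ω => by rw [one_mul])
    filter_upwards [hNpos] with k hk
    rw [← Real.rpow_add hk]
    norm_num
  have hhalf_le : ∀ᶠ k in atTop, (N k : ℝ) ^ (-(1 / 2) : ℝ) ≤ (N k : ℝ) ^ (-(1 / 4) : ℝ) := by
    filter_upwards [hn.eventually_ge_atTop 1] with k hk
    exact Real.rpow_le_rpow_of_exponent_le (by exact_mod_cast hk) (by norm_num)
  have hnum : IsLittleOP μ (fun k ω =>
      ‖numHat ℓ (ηhat k (T k ω)) s (fun d i => X k d i ω) - vNum P ℓ s‖ₑ)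
      (fun k => (N k : ℝ) ^ (-(1 / 4) : ℝ)) := by
    refine (((hE.rate_mono hhalf_le).add_real (hquarter 1
      (measurable_targetTerm_trueNuisance hℓ) ht)).add_real (hquarter 0
      (measurable_sourceTerm_trueNuisance hℓ) hs)).mono (Eventually.of_forall fun k ω => ?_)
    rw [htint, hsint]
    refine le_of_eq (congrArg _ ?_)
    ring
  have hnum' : IsLittleOP μ (fun k ω =>
      ‖numHat ℓ (ηhat k (T k ω)) ∅ (fun d i => X k d i ω) - vDen P ℓ‖ₑ)
      (fun k => (N k : ℝ) ^ (-(1 / 4) : ℝ)) := by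
    refine (((hE'.rate_mono hhalf_le).add_real (hquarter 1
      (measurable_targetTerm_trueNuisance hℓ) ht')).add_real (hquarter 0
      (measurable_sourceTerm_trueNuisance hℓ) hs')).mono (Eventually.of_forall fun k ω => ?_)
    rw [htint', hsint', hempty]
    refine le_of_eq (congrArg _ ?_)
    ring
  set L : (k : ℕ) → Ω k → ℝ := fun k ω =>
    1 / vDen P ℓ * (numHat ℓ (ηhat k (T k ω)) s (fun d i => X k d i ω) - vNum P ℓ s)
      - vNum P ℓ s / vDen P ℓ ^ 2
        * (numHat ℓ (ηhat k (T k ω)) ∅ (fun d i => X k d i ω) - vDen P ℓ) with hL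
  have hLquarter : IsLittleOP μ (fun k ω => ‖L k ω‖ₑ) (fun k => (N k : ℝ) ^ (-(1 / 4) : ℝ)) :=
    (hnum.const_mul_real _).sub_real (hnum'.const_mul_real _)
  have hdelta : IsLittleOP μ (fun k ω => ‖ratioHat ℓ (ηhat k (T k ω)) s (fun d i => X k d i ω)
        - vNum P ℓ s / vDen P ℓ - L k ω‖ₑ) (fun k => (N k : ℝ) ^ (-(1 / 2) : ℝ)) := by
    have hprod := ((hLquarter.mul hnum' fun k => by positivity).const_mul
      (c := 2 / vDen P ℓ) (by positivity)).rate_mono (b := fun k => (N k : ℝ) ^ (-(1 / 2) : ℝ))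
      (by
        filter_upwards [hNpos] with k hk
        rw [← Real.rpow_add hk]
        norm_num)
    -- The consistent quantity is `2 / v_Z^den` times the error of the denominator; where it is at
    -- most one, the estimated denominator is within half of the true one.
    refine hprod.mono_of_le_one ((hnum'.const_mul (c := 2 / vDen P ℓ) (by positivity)).rate_mono
      (eventually_rpow_le_one hn (by norm_num))) (Eventually.of_forall fun k ω hω => ?_)
    rw [Real.enorm_eq_ofReal_abs, ← ENNReal.ofReal_mul (by positivity), ENNReal.ofReal_le_one,
      div_mul_eq_mul_div, div_le_one hden] at hω
    simp only [Real.enorm_eq_ofReal_abs]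
    rw [← ENNReal.ofReal_mul (abs_nonneg _), ← ENNReal.ofReal_mul (by positivity)]
    exact ENNReal.ofReal_le_ofReal (abs_ratio_sub_linear_le hden (by linarith))
  have hlinear : IsLittleOP μ (fun k ω =>
      ‖L k ω - pooledMean (fun d i => X k d i ω) (psi P ℓ ρ s)‖ₑ)
      (fun k => (N k : ℝ) ^ (-(1 / 2) : ℝ)) := by
    -- The oracle average weights the domains by `r d`, the pooled mean by `n_d / N`. As `ψ_s` is
    -- centred in each domain, the vanishing discrepancy multiplies a centred average and is
    -- `o_p(n^{-1/2})`.
    have hscale : ∀ d, IsLittleOP μ (fun k ω => ‖(r d - (n k d : ℝ) / (N k : ℝ))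
        * (empMean (fun i => X k d i ω) (fun o => psi P ℓ ρ s (d, o))
          - ∫ o, psi P ℓ ρ s (d, o) ∂(P d))‖ₑ) (fun k => (N k : ℝ) ^ (-(1 / 2) : ℝ)) := fun d =>
      (isLittleOP_mul_empMean_sub_integral hT (fun k i => hlaw k d i)
        (fun k => hindep' k d) (fun k => hsplit' k d) (hr d) hn (hfr d)
        (hψm.comp measurable_prodMk_left) (hψ2 d) (b := fun _ => 1)
        (Eventually.of_forall fun _ => one_pos)
        (by simpa using (hfr d).const_sub (r d))).rate_mono
        (Eventually.of_forall fun k => (one_mul _).le)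
    refine ((((hE.const_mul_real (1 / vDen P ℓ)).sub_real
      (hE'.const_mul_real (vNum P ℓ s / vDen P ℓ ^ 2))).add_real (hscale 0)).add_real
      (hscale 1)).mono (Eventually.of_forall fun k ω => le_of_eq (congrArg _ ?_))
    have hemp0 : (1 - ρ) * empMean (fun i => X k 0 i ω) (fun o => psi P ℓ ρ s (0, o))
        = 1 / vDen P ℓ * empMean (fun i => X k 0 i ω) (sourceTerm ℓ (trueNuisance P ℓ) s)
          - vNum P ℓ s / vDen P ℓ ^ 2
            * empMean (fun i => X k 0 i ω) (sourceTerm ℓ (trueNuisance P ℓ) ∅) := by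
      rw [hψ0]
      simp only [empMean]
      rw [← Finset.sum_div, Finset.sum_sub_distrib, ← Finset.mul_sum, ← Finset.mul_sum]
      have : (1 - ρ) ≠ 0 := by linarith
      field_simp
    have hemp1 : ρ * empMean (fun i => X k 1 i ω) (fun o => psi P ℓ ρ s (1, o))
        = 1 / vDen P ℓ * empMean (fun i => X k 1 i ω) (targetTerm (trueNuisance P ℓ) s)
          - vNum P ℓ s / vDen P ℓ ^ 2
            * empMean (fun i => X k 1 i ω) (targetTerm (trueNuisance P ℓ) ∅) := by
      rw [hψ1]
      simp only [empMean]
      rw [← Finset.sum_div, Finset.sum_sub_distrib, ← Finset.mul_sum, ← Finset.mul_sum]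
      field_simp
    have hcancel : 1 / vDen P ℓ * vNum P ℓ s = vNum P ℓ s / vDen P ℓ ^ 2 * vDen P ℓ := by
      field_simp
    have hr0 : r 0 = 1 - ρ := rfl
    have hr1 : r 1 = ρ := rfl
    rw [pooledMean_eq, Fin.sum_univ_two, hψmean, hψmean, hr0, hr1]
    simp only [hL]
    linear_combination -hcancel - hemp0 - hemp1
  have hasymp : IsLittleOP μ (fun k ω => ‖ratioHat ℓ (ηhat k (T k ω)) s (fun d i => X k d i ω)
        - vNum P ℓ s / vDen P ℓ - pooledMean (fun d i => X k d i ω) (psi P ℓ ρ s)‖ₑ)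
      (fun k => (N k : ℝ) ^ (-(1 / 2) : ℝ)) :=
    (hdelta.add_real hlinear).mono (Eventually.of_forall fun k ω => le_of_eq (congrArg _ (by ring)))
  -- asymptotic normality
  have hratio_meas : ∀ k, AEMeasurable
      (fun ω => ratioHat ℓ (ηhat k (T k ω)) s fun d i => X k d i ω) (μ k) := by
    intro k
    exact (aemeasurable_numHat hℓ hT hlaw hreg k).div (aemeasurable_numHat hℓ hT hlaw hreg' k)
  -- `σ = 1` serves the ratio and `σ = -1` the value, whose estimation error is the negative of that
  -- of the ratio.
  have hnormal : ∀ σ : ℝ, σ ^ 2 = 1 → TendstoInDistribution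
      (fun k ω => √(N k : ℝ) * (σ * (ratioHat ℓ (ηhat k (T k ω)) s (fun d i => X k d i ω)
        - vNum P ℓ s / vDen P ℓ)))
      atTop (id : ℝ → ℝ) μ (gaussianReal 0 (Var[psi P ℓ ρ s; jointLaw P ρ]).toNNReal) := by
    intro σ hσ
    rw [hvar]
    refine tendstoInDistribution_of_isLittleOP
      (tendstoInDistribution_sqrt_mul_pooledMean hT hlaw hindep hindep' hsplit' hn hr hfr hψm hψ2
        hψmean hσ)
      (fun k => (((hratio_meas k).sub_const _).const_mul _).const_mul _)
      ((((hasymp.const_mul_real σ).seq_mul fun k => Real.sqrt_nonneg (N k : ℝ)).rate_mono ?_).mono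
        (Eventually.of_forall fun k ω => le_of_eq (congrArg _ (by ring))))
    filter_upwards [hNpos] with k hk
    rw [Real.sqrt_eq_rpow, ← Real.rpow_add hk]
    norm_num
  refine ⟨hmem, hmean, hasymp, by simpa only [one_mul] using hnormal 1 (one_pow 2), ?_⟩
  convert hnormal (-1) (by norm_num) using 4
  rw [value]
  ring
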